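/- **The protocol.** Fix $n\in\mathbb N$, $\alpha\in\mathbb R$, $0<\delta<\Delta$, $p^{\mathrm K}\in[0,1]$. In each of $n$ rounds Alice draws $x\in\{0,1,2,3\}$ uniformly and independently declares the round a key round ($I=0$, probability $p^{\mathrm K}$) or a test round ($I=1$). She prepares the coherent state $|i^x\alpha\rangle$; Eve, who holds a quantum system on a separable (possibly infinite-dimensional) Hilbert space, applies an arbitrary quantum channel to the mode and her system, which may differ from round to round and may depend on the values of $I$ and $\tilde X$ of the earlier rounds. Bob performs heterodyne detection with outcome $y\in\mathbb C$. In a key round his result is $\hat Z=z$ if $\arg y\in[\frac\pi4(2z-1),\frac\pi4(2z+1))$, $z\in\{0,\dots,3\}$; in a test round it is $\tilde Z=z\in\{0,\dots,3\}$ if moreover $|y|<\delta$, $\tilde Z=4$ if $\delta\le|y|<\Delta$ and $\tilde Z=5$ if $|y|\ge\Delta$. Put $\hat X=x$, $\tilde X=\tilde Z=\perp$ in key rounds and $\tilde X=x$, $\hat X=\hat Z=\perp$ in test rounds. Let $E'_n$ be Eve's quantum system after $n$ rounds. *Parameter estimation.* Given coefficients $h_{xz}\in\mathbb R$, a probability distribution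 $p_0^{\mathrm s}$ on $\{0,\dots,3\}\times\{0,\dots,5\}$ and $\delta^{\mathrm{tol}}>0$, $\Omega_{\mathrm{PE}}$ is the event that $\sum_{x,z}h_{xz}\operatorname{freq}(x,z)\ge\sum_{x,z}h_{xz}(1-p^{\mathrm K})p_0^{\mathrm s}(x,z)-\delta^{\mathrm{tol}}$, where $\operatorname{freq}(x,z)$ is $1/n$ times the number of rounds with $(\tilde X,\tilde Z)=(x,z)$. *Error correction (reverse reconciliation).* Bob draws a hash function $F$ from a finite family and sends Alice a string $L$ from a finite set of size $|L|$, computed (possibly randomly) from $\hat Z_1^n,\tilde Z_1^n,\tilde X_1^n$ and possibly $F$; $L$ stands for everything that error correction leaks to Eve, and $\mathrm{leak}_{\mathrm{EC}}:=\log|L|$. From $\hat X_1^n,\tilde X_1^n,L$ Alice computes (possibly randomly) a guess $\bar X_1^n$ of $\hat Z_1^n$. The event of passing is $\Omega_{\mathrm{EC}}=[F(\hat Z_1^n)=F(\bar X_1^n)]$, and $\Omega_{\mathrm{NA}}=\Omega_{\mathrm{PE}}\wedge\Omega_{\mathrm{EC}}$. Let $\sigma$ be the resulting joint state of all these classical registers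 and $E'_n$. *Privacy amplification.* For $\ell\in\mathbb N$, a function $f$ is drawn, independently of everything else, from a finite family of functions from the set of raw keys $\{\perp,0,1,2,3\}^n$ to $\{0,1\}^\ell$ that is two-universal: $\Pr_f[f(z)=f(z')]\le2^{-\ell}$ for $z\ne z'$. The keys are $K_A=f(\bar X_1^n)$, $K_B=f(\hat Z_1^n)$. **Definitions.** All logarithms are to base $2$. Write $\sigma|\Omega_{\mathrm{PE}}\wedge\Omega_{\mathrm{EC}}:=\frac1{\Pr[\Omega_{\mathrm{PE}}]}\,\sigma\wedge\Omega_{\mathrm{NA}}$ for the subnormalised state obtained from the part of $\sigma$ on $\Omega_{\mathrm{NA}}$ (and $0$ if $\Pr[\Omega_{\mathrm{PE}}]=0$). For subnormalised $\rho,\tau$ let $F(\rho,\tau)=\big(\operatorname{Tr}|\sqrt\rho\sqrt\tau|+\sqrt{(1-\operatorname{Tr}\rho)(1-\operatorname{Tr}\tau)}\big)^2$ and $P=\sqrt{1-F}$; let $H_{\min}(A|B)_\rho$ be the supremum of all $\lambda\in\mathbb R$ such that $\rho_{AB}\le2^{-\lambda}\,\mathbb 1_A\otimes\tau_B$ for some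 subnormalised $\tau_B$, and $H^\epsilon_{\min}(A|B)_\rho$ the supremum of $H_{\min}(A|B)_{\bar\rho}$ over all subnormalised $\bar\rho_{AB}$ with $P(\bar\rho,\rho)\le\epsilon$. The protocol is $\eta$-*sound* with respect to side information $E$ of Eve if $$\Pr[\Omega_{\mathrm{NA}}]\,\tfrac12\Big\|\rho_{K_AK_BE}|_{\Omega_{\mathrm{NA}}}-2^{-\ell}\sum_{k\in\{0,1\}^\ell}|kk\rangle\langle kk|\otimes\rho_E|_{\Omega_{\mathrm{NA}}}\Big\|_1\le\eta ,$$ where $\rho$ is the state after privacy amplification. **Corollary.** Let $\epsilon,\epsilon_{\mathrm{EC}}\in(0,1)$ and $\epsilon_{\mathrm{PA}}>0$. Assume $\Pr[K_A\ne K_B\wedge\Omega_{\mathrm{EC}}]\le\epsilon_{\mathrm{EC}}$ and $$\ell\le H^{\epsilon}_{\min}(\hat Z_1^n|\tilde X_1^nI_1^nE'_n)_{\sigma|\Omega_{\mathrm{PE}}\wedge\Omega_{\mathrm{EC}}}-\mathrm{leak}_{\mathrm{EC}}-2\log\frac1{\epsilon_{\mathrm{PA}}}.$$ Then the protocol yields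 a key of $\ell$ bits that is $\big(\tfrac12\epsilon_{\mathrm{PA}}+2\epsilon+\epsilon_{\mathrm{EC}}\big)$-sound with respect to $E=\tilde X_1^nI_1^nLE'_n$, and also if the function $f$ of privacy amplification is revealed to Eve, i.e. with respect to $E=\tilde X_1^nI_1^nLE'_n\,f$. -/

import Mathlib

open MeasureTheory
open scoped ENNReal InnerProductSpace Classical

noncomputable section

namespace QKD

universe u

section Operators

variable {H : Type*} [NormedAddCommGroup H] [InnerProductSpace ℂ H] [CompleteSpace H]
variable {K : Type*} [NormedAddCommGroup K] [InnerProductSpace ℂ K] [CompleteSpace K]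

/-- Index set of an orthonormal basis of the Hilbert space `H`. -/
def BasisIndex (H : Type*) [NormedAddCommGroup H] [InnerProductSpace ℂ H] [CompleteSpace H] :
    Set H :=
  (exists_hilbertBasis ℂ H).choose

/-- An orthonormal basis of the Hilbert space `H`. -/
def basis (H : Type*) [NormedAddCommGroup H] [InnerProductSpace ℂ H] [CompleteSpace H] :
    HilbertBasis (BasisIndex H) ℂ H :=
  (exists_hilbertBasis ℂ H).choose_spec.choose

/-- The trace `∑ ⟨b, T b⟩` (over an orthonormal basis) of a positive bounded operator, as an
extended nonnegative number. It is only applied to positive operators; for these it does not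
depend on the basis (`trace_eq_tsum` below). -/
def trace (T : H →L[ℂ] H) : ℝ≥0∞ :=
  ∑' i, ENNReal.ofReal (⟪basis H i, T (basis H i)⟫_ℂ).re

theorem parseval {H : Type*} [NormedAddCommGroup H] [InnerProductSpace ℂ H]
    {ι : Type*} (e : HilbertBasis ι ℂ H) (v : H) :
    ENNReal.ofReal (‖v‖ ^ 2) = ∑' k, ENNReal.ofReal (‖⟪e k, v⟫_ℂ‖ ^ 2) := by
  have h := lp.hasSum_norm (p := 2) (by norm_num) (e.repr v)
  simp only [ENNReal.toReal_ofNat, Real.rpow_ofNat, LinearIsometryEquiv.norm_map,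
    HilbertBasis.repr_apply_apply] at h
  rw [← h.tsum_eq, ENNReal.ofReal_tsum_of_nonneg (fun _ => by positivity) h.summable]

/-- The trace of a positive operator may be computed in any orthonormal basis. -/
theorem trace_eq_tsum {ι : Type*} (b : HilbertBasis ι ℂ H) {T : H →L[ℂ] H}
    (hT : T.IsPositive) : trace T = ∑' i, ENNReal.ofReal (⟪b i, T (b i)⟫_ℂ).re := by
  have hT0 : 0 ≤ T := (ContinuousLinearMap.nonneg_iff_isPositive T).2 hT
  set S : H →L[ℂ] H := CFC.sqrt T with hS
  have hSS : S * S = T := CFC.sqrt_mul_sqrt_self T hT0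
  have hSa : ∀ x y : H, ⟪S x, y⟫_ℂ = ⟪x, S y⟫_ℂ :=
    ((ContinuousLinearMap.nonneg_iff_isPositive S).1 (CFC.sqrt_nonneg T)).isSymmetric
  have hq : ∀ v : H, (⟪v, T v⟫_ℂ).re = ‖S v‖ ^ 2 := by
    intro v
    have h1 : T v = S (S v) := by rw [← hSS]; rfl
    rw [h1, ← hSa]
    exact (inner_self_eq_norm_sq (𝕜 := ℂ) (S v))
  unfold trace
  simp only [hq]
  simp only [parseval b (S (basis H _))]
  rw [ENNReal.tsum_comm]
  refine tsum_congr fun i => ?_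
  rw [parseval (basis H)]
  refine tsum_congr fun j => ?_
  rw [← hSa, norm_inner_symm]

/-- The space of trace class operators: the linear span of the positive operators of finite
trace. -/
def traceClass (H : Type*) [NormedAddCommGroup H] [InnerProductSpace ℂ H] [CompleteSpace H] :
    Submodule ℂ (H →L[ℂ] H) :=
  Submodule.span ℂ {T | T.IsPositive ∧ trace T ≠ ∞}

/-- The trace norm `‖T‖₁ = Tr |T|`, with `|T| = √(T† T)`. -/
def traceNorm (T : H →L[ℂ] H) : ℝ≥0∞ := trace (CFC.abs T)

/-- Subnormalised states: positive operators of trace at most one. -/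
def SubState (H : Type*) [NormedAddCommGroup H] [InnerProductSpace ℂ H] [CompleteSpace H] :
    Set (H →L[ℂ] H) :=
  {ρ | ρ.IsPositive ∧ trace ρ ≤ 1}

/-- States (density operators): positive operators of trace one. -/
def State (H : Type*) [NormedAddCommGroup H] [InnerProductSpace ℂ H] [CompleteSpace H] :
    Set (H →L[ℂ] H) :=
  {ρ | ρ.IsPositive ∧ trace ρ = 1}

/-- Generalised fidelity of subnormalised states. -/
def fidelity (ρ σ : H →L[ℂ] H) : ℝ :=
  ((traceNorm (CFC.sqrt ρ * CFC.sqrt σ)).toReal +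
    Real.sqrt ((1 - (trace ρ).toReal) * (1 - (trace σ).toReal))) ^ 2

/-- Purified distance of subnormalised states. -/
def purifiedDist (ρ σ : H →L[ℂ] H) : ℝ := Real.sqrt (1 - fidelity ρ σ)

/-- `ℂ^X ⊗ H` for a finite set `X`, realised as the Hilbert space of functions `X → H`. -/
abbrev Reg (X : Type*) (H : Type*) : Type _ := PiLp 2 (fun _ : X => H)

/-- The operator `∑ x y, |x⟩⟨y| ⊗ T x y` on `ℂ^X ⊗ H`. -/
def blockOp {X : Type*} [Fintype X] (T : X → X → (H →L[ℂ] H)) : Reg X H →L[ℂ] Reg X H :=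
  ∑ x, ∑ y, (PiLp.proj 2 (𝕜 := ℂ) (fun _ : X => H) x).adjoint ∘L T x y ∘L
    (PiLp.proj 2 (𝕜 := ℂ) (fun _ : X => H) y)

/-- The operator `∑ x, |x⟩⟨x| ⊗ ρ x` on `ℂ^X ⊗ H`. -/
def blockDiag {X : Type*} [Fintype X] (ρ : X → (H →L[ℂ] H)) : Reg X H →L[ℂ] Reg X H :=
  blockOp fun x y => if x = y then ρ x else 0

/-- Conditional min-entropy `H_min(A|B)` (in bits) of an operator on `ℂ^A ⊗ H`. -/
def minEntropy {A : Type*} [Fintype A] (ρ : Reg A H →L[ℂ] Reg A H) : EReal :=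
  ⨆ σ ∈ SubState H, ⨆ lam ∈ {lam : ℝ | ρ ≤ (2 : ℝ) ^ (-lam) • blockDiag fun _ : A => σ},
    (lam : EReal)

/-- Smooth conditional min-entropy `H_min^ε(A|B)`: optimisation of the conditional min-entropy
over all subnormalised states at purified distance at most `ε`. -/
def smoothMinEntropy (ε : ℝ) {A : Type*} [Fintype A] (ρ : Reg A H →L[ℂ] Reg A H) : EReal :=
  ⨆ τ ∈ {τ ∈ SubState (Reg A H) | purifiedDist τ ρ ≤ ε}, minEntropy τ

/-- A quantum channel: a completely positive and trace preserving linear map between spaces of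
trace class operators. -/
structure Channel (H K : Type*) [NormedAddCommGroup H] [InnerProductSpace ℂ H] [CompleteSpace H]
    [NormedAddCommGroup K] [InnerProductSpace ℂ K] [CompleteSpace K] where
  toLin : traceClass H →ₗ[ℂ] traceClass K
  completely_positive : ∀ (m : ℕ) (T : Fin m → Fin m → traceClass H),
    (blockOp fun i j => (T i j : H →L[ℂ] H)).IsPositive →
      (blockOp fun i j => (toLin (T i j) : K →L[ℂ] K)).IsPositive
  trace_preserving : ∀ T : traceClass H, (T : H →L[ℂ] H).IsPositive →
    trace (toLin T : K →L[ℂ] K) = trace (T : H →L[ℂ] H)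

/-- A channel applied to an operator (zero by convention outside the trace class). -/
def Channel.app (Φ : Channel H K) (T : H →L[ℂ] H) : K →L[ℂ] K :=
  if h : T ∈ traceClass H then (Φ.toLin ⟨T, h⟩ : K →L[ℂ] K) else 0

end Operators

section ClassicalQuantum

variable {H : Type*} [NormedAddCommGroup H] [InnerProductSpace ℂ H] [CompleteSpace H]
variable {X Y : Type*} [Fintype X]

/-- A classical-quantum operator `∑ x, |x⟩⟨x| ⊗ ρ x` given by its blocks; as an operator it is
`blockDiag ρ`. -/
abbrev CQ (X : Type*) (H : Type*) [NormedAddCommGroup H] [InnerProductSpace ℂ H] : Type _ :=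
  X → (H →L[ℂ] H)

/-- Probability of an event on the classical register. -/
def CQ.prob (ρ : CQ X H) (Ω : Set X) : ℝ≥0∞ := ∑ x, if x ∈ Ω then trace (ρ x) else 0

/-- The nonnormalised conditional state `ρ ∧ Ω`. -/
def CQ.restrict (ρ : CQ X H) (Ω : Set X) : CQ X H := fun x => if x ∈ Ω then ρ x else 0

/-- Keep of the classical register only the value of the function `g`. -/
def CQ.marginal (ρ : CQ X H) (g : X → Y) : CQ Y H := fun y => ∑ x, if g x = y then ρ x else 0

/-- Soundness of a key pair `(KA, KB)` against an adversary holding the classical register `S`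
and the quantum system `H`, where `NA` is the event of not aborting:
`Pr[NA] * 1/2 * ‖ρ_{KA KB S H}|NA - |𝒦|⁻¹ ∑ k, |kk⟩⟨kk| ⊗ ρ_{S H}|NA‖₁ ≤ ε`. -/
def IsSound {𝒦 S : Type*} [Fintype 𝒦] [Fintype S] (ρ : CQ X H) (NA : Set X)
    (KA KB : X → 𝒦) (side : X → S) (ε : ℝ) : Prop :=
  let cond : CQ X H := fun x => (ρ.prob NA).toReal⁻¹ • ρ.restrict NA x
  let real : CQ (𝒦 × 𝒦 × S) H := CQ.marginal cond fun x => (KA x, KB x, side x)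
  let ideal : CQ (𝒦 × 𝒦 × S) H := fun y =>
    if y.1 = y.2.1 then (Fintype.card 𝒦 : ℝ)⁻¹ • CQ.marginal cond side y.2.2 else 0
  ρ.prob NA * (1 / 2) * traceNorm (blockDiag real - blockDiag ideal) ≤ ENNReal.ofReal ε

end ClassicalQuantum

section Optics

variable {H : Type*} [NormedAddCommGroup H] [InnerProductSpace ℂ H] [CompleteSpace H]

/-- `ℓ²(ℕ) ⊗ H`: an optical mode (with its Fock basis indexed by `ℕ`) together with the
system `H`. -/
abbrev Mode (H : Type*) [NormedAddCommGroup H] : Type _ := lp (fun _ : ℕ => H) 2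

/-- Fock coefficients of the coherent state `|β⟩`. -/
def coherentCoeff (β : ℂ) (n : ℕ) : ℂ :=
  (Real.exp (-‖β‖ ^ 2 / 2) : ℂ) * β ^ n / (Real.sqrt n.factorial : ℂ)

theorem hasSum_coherentCoeff (β : ℂ) : HasSum (fun n => ‖coherentCoeff β n‖ ^ 2) 1 := by
  have h : HasSum (fun n : ℕ => (‖β‖ ^ 2) ^ n / n.factorial) (Real.exp (‖β‖ ^ 2)) := by
    rw [Real.exp_eq_exp_ℝ]
    exact NormedSpace.expSeries_div_hasSum_exp (‖β‖ ^ 2)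
  have h2 := h.mul_left (Real.exp (-‖β‖ ^ 2))
  rw [← Real.exp_add, neg_add_cancel, Real.exp_zero] at h2
  have h3 : (fun n => ‖coherentCoeff β n‖ ^ 2) =
      fun n : ℕ => Real.exp (-‖β‖ ^ 2) * ((‖β‖ ^ 2) ^ n / n.factorial) := by
    funext n
    have he : Real.exp (-‖β‖ ^ 2 / 2) ^ 2 = Real.exp (-‖β‖ ^ 2) := by
      rw [← Real.exp_nat_mul]; congr 1; push_cast; ring
    have hs : Real.sqrt n.factorial ^ 2 = n.factorial := Real.sq_sqrt (by positivity)
    have hn : ‖coherentCoeff β n‖ =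
        Real.exp (-‖β‖ ^ 2 / 2) * ‖β‖ ^ n / Real.sqrt n.factorial := by
      unfold coherentCoeff
      rw [norm_div, norm_mul, norm_pow, Complex.norm_real, Complex.norm_real,
        Real.norm_of_nonneg (Real.exp_nonneg _), Real.norm_of_nonneg (Real.sqrt_nonneg _)]
    rw [hn, div_pow, mul_pow, he, hs]
    ring
  rw [h3]
  exact h2

theorem hasSum_coherentCoeff_smul {H : Type*} [NormedAddCommGroup H] [InnerProductSpace ℂ H]
    (β : ℂ) (v : H) :
    HasSum (fun n => ‖coherentCoeff β n • v‖ ^ 2) (‖v‖ ^ 2) := by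
  simpa [norm_smul, mul_pow] using (hasSum_coherentCoeff β).mul_right (‖v‖ ^ 2)

/-- The isometry `v ↦ |β⟩ ⊗ v`. -/
def attachCoherent (β : ℂ) : H →L[ℂ] Mode H :=
  LinearMap.mkContinuous
    { toFun := fun v => ⟨fun n => coherentCoeff β n • v, memℓp_gen (by
        simpa using (hasSum_coherentCoeff_smul β v).summable)⟩
      map_add' := fun v w => by ext n; exact smul_add _ _ _
      map_smul' := fun c v => by ext n; simp [smul_comm c] } 1 (fun v => by
      refine lp.norm_le_of_tsum_le (by norm_num) (by positivity) (le_of_eq ?_)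
      simpa using (hasSum_coherentCoeff_smul β v).tsum_eq)

/-- `ρ ↦ |β⟩⟨β| ⊗ ρ`. -/
def prepare (β : ℂ) (ρ : H →L[ℂ] H) : Mode H →L[ℂ] Mode H :=
  attachCoherent β ∘L ρ ∘L (attachCoherent β).adjoint

/-- Heterodyne detection of the mode with outcome in the region `A` of phase space:
`ρ ↦ Tr_B[(R_A ⊗ 1) ρ]`, where `R_A = π⁻¹ ∫_A |β⟩⟨β| dβ`. -/
def heterodyne (A : Set ℂ) (ρ : Mode H →L[ℂ] Mode H) : H →L[ℂ] H :=
  Real.pi⁻¹ • ∫ β in A, (attachCoherent β).adjoint ∘L ρ ∘L attachCoherent β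

/-- The quadrant of phases in `[π(2z-1)/4, π(2z+1)/4)`. -/
def quadrant (z : ℕ) : Set ℂ :=
  {y | ∃ θ ∈ Set.Ico (Real.pi / 4 * (2 * z - 1)) (Real.pi / 4 * (2 * z + 1)),
    y = ‖y‖ * Complex.exp (θ * Complex.I)}

/-- The six phase space modules of the test rounds. -/
def testModule (δ Δ : ℝ) (z : Fin 6) : Set ℂ :=
  if (z : ℕ) < 4 then quadrant z ∩ {y | ‖y‖ < δ}
  else if (z : ℕ) = 4 then {y | δ ≤ ‖y‖ ∧ ‖y‖ < Δ}
  else {y | Δ ≤ ‖y‖}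

end Optics

section Protocol

/-- Parameters of the quantum part of the protocol and of parameter estimation. -/
structure Params where
  /-- amplitude of the coherent states -/
  α : ℝ
  /-- radii of the discretisation in test rounds -/
  δ : ℝ
  Δ : ℝ
  δ_pos : 0 < δ
  δ_lt : δ < Δ
  /-- probability of a key round -/
  pK : ℝ
  pK_mem : pK ∈ Set.Icc (0 : ℝ) 1
  /-- coefficients of the affine function used in parameter estimation -/
  h : Fin 4 × Fin 6 → ℝ
  /-- distribution of a test round's result in an honest run -/
  p₀ : Fin 4 × Fin 6 → ℝ
  p₀_mem : p₀ ∈ stdSimplex ℝ (Fin 4 × Fin 6)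
  /-- tolerance -/
  δtol : ℝ
  δtol_pos : 0 < δtol

/-- Classical record of one round: Alice's symbol and Bob's discretised outcome in a key round
or in a test round. -/
abbrev Round : Type := (Fin 4 × Fin 4) ⊕ (Fin 4 × Fin 6)

/-- The round type `I` (0 for key rounds, 1 for test rounds). -/
def Round.I : Round → Fin 2
  | .inl _ => 0
  | .inr _ => 1

/-- Alice's symbol in key rounds; `none` stands for `⊥`. -/
def Round.Xhat : Round → Option (Fin 4)
  | .inl t => some t.1
  | .inr _ => none

/-- Bob's outcome in key rounds. -/
def Round.Zhat : Round → Option (Fin 4)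
  | .inl t => some t.2
  | .inr _ => none

/-- Alice's symbol in test rounds. -/
def Round.Xtilde : Round → Option (Fin 4)
  | .inl _ => none
  | .inr t => some t.1

/-- Bob's outcome in test rounds. -/
def Round.Ztilde : Round → Option (Fin 6)
  | .inl _ => none
  | .inr t => some t.2

variable (E : ℕ → Type u) [∀ i, NormedAddCommGroup (E i)] [∀ i, InnerProductSpace ℂ (E i)]
  [∀ i, CompleteSpace (E i)]

/-- A coherent attack. `E i` is Eve's quantum system after `i` rounds. In each round a channel
acts on the incoming mode and her system and yields the mode received by Bob and her new
system; it may depend on what Alice has announced in the previous rounds. -/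
structure Attack where
  init : E 0 →L[ℂ] E 0
  init_mem : init ∈ State (E 0)
  channel : (i : ℕ) → (Fin i → Option (Fin 4)) → Channel (Mode (E i)) (Mode (E (i + 1)))

variable {E}

/-- One round with record `t`, for an attack channel `Φ`: Alice chooses the round type and a
uniformly random symbol `x`, prepares the coherent state with amplitude `i^x α`, the channel
acts, and Bob performs discretised heterodyne detection. -/
def roundMap {H K : Type*} [NormedAddCommGroup H] [InnerProductSpace ℂ H] [CompleteSpace H]
    [NormedAddCommGroup K] [InnerProductSpace ℂ K] [CompleteSpace K]
    (P : Params) (Φ : Channel (Mode H) (Mode K)) : Round → (H →L[ℂ] H) → (K →L[ℂ] K)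
  | .inl (x, z), ρ => (P.pK / 4) •
      heterodyne (quadrant z) (Φ.app (prepare (Complex.I ^ (x : ℕ) * P.α) ρ))
  | .inr (x, z), ρ => ((1 - P.pK) / 4) •
      heterodyne (testModule P.δ P.Δ z) (Φ.app (prepare (Complex.I ^ (x : ℕ) * P.α) ρ))

/-- The joint state of the records of the first `n` rounds and Eve's system. -/
def roundsState (P : Params) (𝒜 : Attack E) : (n : ℕ) → CQ (Fin n → Round) (E n)
  | 0 => fun _ => 𝒜.init
  | n + 1 => fun r =>
      roundMap P (𝒜.channel n fun i => (r i.castSucc).Xtilde) (r (Fin.last n))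
        (roundsState P 𝒜 n fun i => r i.castSucc)

/-- Frequency of the test result `(x, z)` among `n` rounds. -/
def freq {n : ℕ} (r : Fin n → Round) (c : Fin 4 × Fin 6) : ℝ :=
  (Finset.univ.filter fun i => (r i).Xtilde = some c.1 ∧ (r i).Ztilde = some c.2).card / n

/-- The affine function `f^PE`. -/
def Params.fPE (P : Params) (p : Fin 4 × Fin 6 → ℝ) : ℝ := ∑ c, P.h c * p c

/-- The event of passing parameter estimation. The honest distribution on test results is
`(1 - pK) p₀`. -/
def passPE (P : Params) {n : ℕ} : Set (Fin n → Round) :=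
  {r | P.fPE (freq r) ≥ P.fPE (fun c => (1 - P.pK) * P.p₀ c) - P.δtol}

/-- The raw key alphabet of `n` rounds. -/
abbrev RawKey (n : ℕ) : Type := Fin n → Option (Fin 4)

/-- Reverse-reconciliation error correction. Bob draws a hash function `F` (with index in `𝓕`)
and sends Alice a string `L ∈ 𝓛`, produced from his data `Ẑ, X̃, Z̃` and possibly from `F`;
`L` stands for all that is leaked to Eve. Alice computes a guess of Bob's raw key from her
data `X̂, X̃` and `L`. Then the values of `F` on the two raw keys are compared. -/
structure ErrorCorrection (n : ℕ) (𝓕 𝓥 𝓛 : Type*) where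
  hashDist : PMF 𝓕
  hash : 𝓕 → RawKey n → 𝓥
  encode : 𝓕 → RawKey n → (Fin n → Option (Fin 4)) → (Fin n → Option (Fin 6)) → PMF 𝓛
  guess : RawKey n → (Fin n → Option (Fin 4)) → 𝓛 → PMF (RawKey n)

/-- A two-universal family of hash functions from `Z` to `𝒦`. -/
structure TwoUniversal (Z 𝒦 𝓖 : Type*) [Fintype 𝓖] [Fintype 𝒦] where
  dist : PMF 𝓖
  hash : 𝓖 → Z → 𝒦
  two_universal : ∀ z z', z ≠ z' →
    ∑ g, (if hash g z = hash g z' then dist g else 0) ≤ (Fintype.card 𝒦 : ℝ≥0∞)⁻¹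

/-- Values of all classical registers after error correction: the records of all rounds, Bob's
hash function, the leaked string and Alice's guess. -/
structure Outcome (n : ℕ) (𝓕 𝓛 : Type*) where
  rounds : Fin n → Round
  F : 𝓕
  L : 𝓛
  Xbar : RawKey n
deriving Fintype

namespace Outcome

variable {n : ℕ} {𝓕 𝓥 𝓛 : Type*}

def I (o : Outcome n 𝓕 𝓛) : Fin n → Fin 2 := fun i => (o.rounds i).I
def Xhat (o : Outcome n 𝓕 𝓛) : RawKey n := fun i => (o.rounds i).Xhat
def Zhat (o : Outcome n 𝓕 𝓛) : RawKey n := fun i => (o.rounds i).Zhat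
def Xtilde (o : Outcome n 𝓕 𝓛) : Fin n → Option (Fin 4) := fun i => (o.rounds i).Xtilde
def Ztilde (o : Outcome n 𝓕 𝓛) : Fin n → Option (Fin 6) := fun i => (o.rounds i).Ztilde

end Outcome

variable {n : ℕ} {𝓕 𝓥 𝓛 𝓖 : Type*}

/-- The event of passing parameter estimation. -/
def omegaPE (P : Params) : Set (Outcome n 𝓕 𝓛) := {o | o.rounds ∈ passPE P}

/-- The event of passing error correction. -/
def omegaEC (C : ErrorCorrection n 𝓕 𝓥 𝓛) : Set (Outcome n 𝓕 𝓛) :=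
  {o | C.hash o.F o.Zhat = C.hash o.F o.Xbar}

/-- The event of not aborting. -/
def omegaNA (P : Params) (C : ErrorCorrection n 𝓕 𝓥 𝓛) : Set (Outcome n 𝓕 𝓛) :=
  omegaPE P ∩ omegaEC C

/-- The raw key state `σ^QKD`: all classical registers after error correction together with
Eve's quantum system. -/
def rawState (P : Params) (𝒜 : Attack E) (C : ErrorCorrection n 𝓕 𝓥 𝓛) :
    CQ (Outcome n 𝓕 𝓛) (E n) := fun o =>
  (C.hashDist o.F * C.encode o.F o.Zhat o.Xtilde o.Ztilde o.L *
    C.guess o.Xhat o.Xtilde o.L o.Xbar).toReal • roundsState P 𝒜 n o.rounds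

/-- The state before hashing together with the independently drawn hash function. -/
def keyState [Fintype 𝓖] (P : Params) (𝒜 : Attack E) (C : ErrorCorrection n 𝓕 𝓥 𝓛)
    {𝒦 : Type*} [Fintype 𝒦] (G : TwoUniversal (RawKey n) 𝒦 𝓖) :
    CQ (Outcome n 𝓕 𝓛 × 𝓖) (E n) := fun q =>
  (G.dist q.2).toReal • rawState P 𝒜 C q.1

/-- Alice's key: the hash of her guess. -/
def keyA [Fintype 𝓖] {𝒦 : Type*} [Fintype 𝒦] (G : TwoUniversal (RawKey n) 𝒦 𝓖)
    (q : Outcome n 𝓕 𝓛 × 𝓖) : 𝒦 := G.hash q.2 q.1.Xbar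

/-- Bob's key: the hash of his raw key. -/
def keyB [Fintype 𝓖] {𝒦 : Type*} [Fintype 𝒦] (G : TwoUniversal (RawKey n) 𝒦 𝓖)
    (q : Outcome n 𝓕 𝓛 × 𝓖) : 𝒦 := G.hash q.2 q.1.Zhat

/-- Values of the registers `X̃ I` of `n` rounds. -/
abbrev PublicReg (n : ℕ) : Type := (Fin n → Option (Fin 4)) × (Fin n → Fin 2)

/-- The state of `Ẑ X̃ I E'` for `σ|Ω_PE ∧ Ω_EC = (1 / Pr[Ω_PE]) σ ∧ Ω_PE ∧ Ω_EC`, as an operator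
on `ℂ^Ẑ ⊗ (ℂ^(X̃ I) ⊗ E')`. -/
def conditionedState [Fintype 𝓕] [Fintype 𝓛] (P : Params) (𝒜 : Attack E)
    (C : ErrorCorrection n 𝓕 𝓥 𝓛) :
    Reg (RawKey n) (Reg (PublicReg n) (E n)) →L[ℂ] Reg (RawKey n) (Reg (PublicReg n) (E n)) :=
  let σ := rawState P 𝒜 C
  let ω : CQ (Outcome n 𝓕 𝓛) (E n) := fun o =>
    (σ.prob (omegaPE P)).toReal⁻¹ • σ.restrict (omegaNA P C) o
  blockDiag fun z => blockDiag fun s =>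
    CQ.marginal ω (fun o => (o.Zhat, (o.Xtilde, o.I))) (z, s)

end Protocol

end QKD

end

/-!
Write the distance of the real from the ideal key state as the sum of two errors. Replacing the
key of Alice by the key of Bob costs at most `Pr[K_A ≠ K_B ∧ Ω_EC] ≤ ε_EC`. What remains is half
of the distance of the key of Bob from a uniform one for Eve (`isSound_of_le`), and this is at
most `4 ε + ε_PA` by the leftover hashing lemma (`nonuniformity_keyState_le`).

*Leftover hashing.* Suppose `τ_z ≤ c σ` for all raw keys `z`. The usual proof compares `τ_z` with
`σ^{-1/4} τ_z σ^{-1/4}`. In infinite dimension `σ^{-1/4}` is unbounded, but the factorisation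
lemma of Douglas gives `τ_z = σ^{1/4} S_z σ^{1/4}` with `S_z ≥ 0` and `Tr S_z² ≤ c Tr τ_z`
(`exists_sandwich`). By Hölder's inequality `‖σ^{1/4} D σ^{1/4}‖₁ ≤ ‖D‖₂ (Tr σ)^{1/2}`
(`traceNorm_conj_le_hs`) it is enough to bound the second moment of the deviation from uniform in
the Hilbert--Schmidt norm. There two-universality applies, because `Tr S_z S_z' ≥ 0`
(`re_inner_hsVec_nonneg`).

*Smoothing and the leaked string.* The smooth min-entropy supplies a state `τ` near `ρ`, which
bears no relation to the string `L`. Since `ρ = ∑ l, ρ_l`, the square roots `√ρ_l` are together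
the image of `√ρ` under a contraction. Applied to a purification of `τ` that is as close to `√ρ`
as Uhlmann's theorem permits, this contraction gives operators `τ_l ≤ τ` that are jointly
`2 ε`-close to the `ρ_l` (`exists_extension`). Leftover hashing is applied to each `τ_l`, with the
same `σ`. Summation over `l` replaces `Tr σ` by `|𝓛| Tr σ`, which accounts for the term `leak_EC`,
and the distance `2 ε` enters twice, for the hashed state and for its uniform part
(`TwoUniversal.leftover_hashing_of_purifiedDist_le`).

*Normalisation.* The estimates need that the state of the protocol has total trace at most one. A
channel preserves the trace. Heterodyne detection does not increase it, since the Fock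
coefficients of the coherent states are orthogonal with squared norm `π` and the regions of
detection overlap in a null set only (`sum_trace_heterodyne_le`).
-/

namespace QKD

set_option linter.unusedSectionVars false

/-! ### Hilbert--Schmidt operators and the trace -/

section HilbertSchmidt

variable {H : Type*} [NormedAddCommGroup H] [InnerProductSpace ℂ H] [CompleteSpace H]
variable {K : Type*} [NormedAddCommGroup K] [InnerProductSpace ℂ K] [CompleteSpace K]
variable {L : Type*} [NormedAddCommGroup L] [InnerProductSpace ℂ L] [CompleteSpace L]

/-- The factorisation lemma of Douglas. It takes the place of inverting `B`, which need not be
invertible and whose inverse may be unbounded. -/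
theorem exists_contraction_comp_eq (A : H →L[ℂ] K) (B : H →L[ℂ] L) (h : ∀ x, ‖A x‖ ≤ ‖B x‖) :
    ∃ C : L →L[ℂ] K, ‖C‖ ≤ 1 ∧ A = C ∘L B := by
  let V : Submodule ℂ L := (LinearMap.range (B : H →ₗ[ℂ] L)).topologicalClosure
  have hV : ∀ x, B x ∈ V := fun x =>
    Submodule.le_topologicalClosure _ (LinearMap.mem_range_self (B : H →ₗ[ℂ] L) x)
  have : CompleteSpace V := (Submodule.isClosed_topologicalClosure _).completeSpace_coe
  let e : H →ₗ[ℂ] V := (B : H →ₗ[ℂ] L).codRestrict V hV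
  have hd : DenseRange e := by
    intro y
    rw [Metric.mem_closure_iff]
    intro r hr
    have hy : (y : L) ∈ closure (LinearMap.range (B : H →ₗ[ℂ] L) : Set L) := y.2
    obtain ⟨_, ⟨x, rfl⟩, hx⟩ := Metric.mem_closure_iff.1 hy r hr
    exact ⟨e x, ⟨x, rfl⟩, hx⟩
  have hn : ∀ x, ‖(A : H →ₗ[ℂ] K) x‖ ≤ 1 * ‖e x‖ := fun x => by
    rw [one_mul]; exact h x
  refine ⟨(LinearMap.extendOfNorm (A : H →ₗ[ℂ] K) e) ∘L V.orthogonalProjectionOnto, ?_, ?_⟩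
  · refine (ContinuousLinearMap.opNorm_comp_le _ _).trans ?_
    refine mul_le_one₀ (LinearMap.opNorm_extendOfNorm_le hd zero_le_one hn) (norm_nonneg _) ?_
    exact Submodule.orthogonalProjectionOnto_norm_le V
  · ext x
    have h1 : V.orthogonalProjectionOnto (B x) = e x :=
      Submodule.orthogonalProjectionOnto_mem_subspace_eq_self (⟨B x, hV x⟩ : V)
    rw [ContinuousLinearMap.comp_apply, ContinuousLinearMap.comp_apply, h1,
      LinearMap.extendOfNorm_eq hd ⟨1, hn⟩]
    rfl

/-- Squared Hilbert--Schmidt norm `∑ ‖A b‖²` over an orthonormal basis, as an extended nonnegative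
number, so that it makes sense for every bounded operator. -/
noncomputable def hs (A : H →L[ℂ] K) : ℝ≥0∞ := ∑' i, ENNReal.ofReal (‖A (basis H i)‖ ^ 2)

/-- Summing squared matrix elements by rows or by columns gives the same result; in particular the
Hilbert--Schmidt norm depends neither on the basis nor on taking the adjoint. -/
theorem tsum_sq_norm_adjoint {ι κ : Type*} (b : HilbertBasis ι ℂ H) (c : HilbertBasis κ ℂ K)
    (A : H →L[ℂ] K) :
    ∑' i, ENNReal.ofReal (‖A (b i)‖ ^ 2) = ∑' j, ENNReal.ofReal (‖A.adjoint (c j)‖ ^ 2) := by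
  simp only [parseval c (A (b _)), parseval b (A.adjoint (c _))]
  rw [ENNReal.tsum_comm]
  refine tsum_congr fun j => tsum_congr fun i => ?_
  rw [ContinuousLinearMap.adjoint_inner_right, norm_inner_symm]

theorem hs_adjoint (A : H →L[ℂ] K) : hs A.adjoint = hs A :=
  (tsum_sq_norm_adjoint _ _ A).symm

theorem hs_comp_le_left (C : K →L[ℂ] L) (hC : ‖C‖ ≤ 1) (A : H →L[ℂ] K) : hs (C ∘L A) ≤ hs A := by
  refine ENNReal.tsum_le_tsum fun i => ENNReal.ofReal_le_ofReal ?_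
  have : ‖(C ∘L A) (basis H i)‖ ≤ ‖A (basis H i)‖ := C.le_of_opNorm_le hC _ |>.trans (by simp)
  gcongr

theorem norm_adjoint_le_one {C : H →L[ℂ] K} (hC : ‖C‖ ≤ 1) : ‖C.adjoint‖ ≤ 1 := by
  rwa [LinearIsometryEquiv.norm_map]

theorem hs_comp_le_right (C : L →L[ℂ] H) (hC : ‖C‖ ≤ 1) (A : H →L[ℂ] K) : hs (A ∘L C) ≤ hs A := by
  rw [← hs_adjoint (A ∘L C), ContinuousLinearMap.adjoint_comp, ← hs_adjoint A]
  exact hs_comp_le_left _ (norm_adjoint_le_one hC) _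

theorem inner_adjoint_comp_self (A : H →L[ℂ] K) (x : H) :
    (⟪x, (A.adjoint ∘L A) x⟫_ℂ).re = ‖A x‖ ^ 2 := by
  rw [ContinuousLinearMap.comp_apply, ContinuousLinearMap.adjoint_inner_right]
  exact inner_self_eq_norm_sq (𝕜 := ℂ) (A x)

theorem trace_adjoint_comp (A : H →L[ℂ] K) : trace (A.adjoint ∘L A) = hs A := by
  simp only [trace, hs, inner_adjoint_comp_self]

theorem sqrt_isSelfAdjoint (T : H →L[ℂ] H) : (CFC.sqrt T).adjoint = CFC.sqrt T :=
  (IsSelfAdjoint.of_nonneg (CFC.sqrt_nonneg T)).star_eq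

theorem sqrt_comp_sqrt {T : H →L[ℂ] H} (hT : T.IsPositive) : CFC.sqrt T ∘L CFC.sqrt T = T :=
  CFC.sqrt_mul_sqrt_self T ((ContinuousLinearMap.nonneg_iff_isPositive T).2 hT)

theorem isPositive_sqrt (T : H →L[ℂ] H) : (CFC.sqrt T).IsPositive :=
  (ContinuousLinearMap.nonneg_iff_isPositive _).1 (CFC.sqrt_nonneg T)

theorem trace_eq_hs_sqrt {T : H →L[ℂ] H} (hT : T.IsPositive) : trace T = hs (CFC.sqrt T) := by
  rw [← trace_adjoint_comp, sqrt_isSelfAdjoint, sqrt_comp_sqrt hT]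

theorem sq_norm_sqrt {T : H →L[ℂ] H} (hT : T.IsPositive) (x : H) :
    ‖CFC.sqrt T x‖ ^ 2 = (⟪x, T x⟫_ℂ).re := by
  rw [← inner_adjoint_comp_self, sqrt_isSelfAdjoint, sqrt_comp_sqrt hT]

theorem re_inner_nonneg {T : H →L[ℂ] H} (hT : T.IsPositive) (x : H) : 0 ≤ (⟪x, T x⟫_ℂ).re :=
  hT.re_inner_nonneg_right x

theorem re_inner_le {S T : H →L[ℂ] H} (h : S ≤ T) (x : H) :
    (⟪x, S x⟫_ℂ).re ≤ (⟪x, T x⟫_ℂ).re := by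
  have := re_inner_nonneg ((ContinuousLinearMap.le_def S T).1 h) x
  simpa [inner_sub_right] using this

theorem trace_add {S T : H →L[ℂ] H} (hS : S.IsPositive) (hT : T.IsPositive) :
    trace (S + T) = trace S + trace T := by
  unfold trace
  rw [← ENNReal.tsum_add]
  refine tsum_congr fun i => ?_
  rw [← ENNReal.ofReal_add (re_inner_nonneg hS _) (re_inner_nonneg hT _)]
  simp

theorem trace_zero : trace (0 : H →L[ℂ] H) = 0 := by simp [trace]

theorem trace_sum {ι : Type*} (s : Finset ι) {T : ι → H →L[ℂ] H} (hT : ∀ i, (T i).IsPositive) :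
    trace (∑ i ∈ s, T i) = ∑ i ∈ s, trace (T i) := by
  induction s using Finset.induction_on with
  | empty => simp [trace_zero]
  | insert a s ha ih =>
    rw [Finset.sum_insert ha, Finset.sum_insert ha, trace_add (hT a), ih]
    exact ContinuousLinearMap.isPositive_sum s fun i _ => hT i

theorem trace_smul {c : ℝ} (hc : 0 ≤ c) (T : H →L[ℂ] H) :
    trace (c • T) = ENNReal.ofReal c * trace T := by
  unfold trace
  rw [← ENNReal.tsum_mul_left]
  refine tsum_congr fun i => ?_
  rw [← ENNReal.ofReal_mul hc]
  congr 1
  rw [smul_apply, inner_smul_right_eq_smul]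
  simp

theorem isPositive_smul {c : ℝ} (hc : 0 ≤ c) {T : H →L[ℂ] H} (hT : T.IsPositive) :
    (c • T).IsPositive := by
  have := hT.smul_of_nonneg (c := (c : ℂ)) (by exact_mod_cast hc)
  simpa using this

/-- Polar decomposition in both directions, with contractions instead of partial isometries. -/
theorem exists_abs_eq (T : H →L[ℂ] H) :
    (∃ W : H →L[ℂ] H, ‖W‖ ≤ 1 ∧ CFC.abs T = W ∘L T) ∧
      ∃ U : H →L[ℂ] H, ‖U‖ ≤ 1 ∧ T = U ∘L CFC.abs T := by
  have h : ∀ x, ‖CFC.abs T x‖ = ‖T x‖ := by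
    intro x
    have h1 : (CFC.abs T).adjoint ∘L CFC.abs T = T.adjoint ∘L T := by
      have h2 : (CFC.abs T).adjoint = CFC.abs T :=
        (IsSelfAdjoint.of_nonneg (CFC.abs_nonneg T)).star_eq
      rw [h2]; exact CFC.abs_mul_abs T
    have h3 := inner_adjoint_comp_self (CFC.abs T) x
    rw [h1, inner_adjoint_comp_self] at h3
    exact ((sq_eq_sq₀ (norm_nonneg _) (norm_nonneg _)).1 h3).symm
  exact ⟨exists_contraction_comp_eq _ _ fun x => (h x).le,
    exists_contraction_comp_eq _ _ fun x => (h x).ge⟩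

end HilbertSchmidt

/-! ### The trace norm -/

section TraceNorm

variable {H : Type*} [NormedAddCommGroup H] [InnerProductSpace ℂ H] [CompleteSpace H]
variable {K : Type*} [NormedAddCommGroup K] [InnerProductSpace ℂ K] [CompleteSpace K]
variable {L : Type*} [NormedAddCommGroup L] [InnerProductSpace ℂ L] [CompleteSpace L]

/-- The Cauchy--Schwarz inequality for sums of geometric means. -/
theorem sum_sqrt_mul_sqrt_le {ι : Type*} (s : Finset ι) (a b : ι → ℝ≥0∞) :
    ∑ i ∈ s, a i ^ (1 / 2 : ℝ) * b i ^ (1 / 2 : ℝ) ≤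
      (∑ i ∈ s, a i) ^ (1 / 2 : ℝ) * (∑ i ∈ s, b i) ^ (1 / 2 : ℝ) := by
  have h := ENNReal.inner_le_Lp_mul_Lq s (fun i => a i ^ (1 / 2 : ℝ))
    (fun i => b i ^ (1 / 2 : ℝ)) (p := 2) (q := 2) Real.HolderConjugate.two_two
  have h2 : ∀ x : ℝ≥0∞, (x ^ (1 / 2 : ℝ)) ^ (2 : ℝ) = x := fun x => by
    rw [← ENNReal.rpow_mul]; norm_num
  simpa only [h2] using h

theorem ofReal_eq_sqrt_sq {x : ℝ} (hx : 0 ≤ x) :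
    ENNReal.ofReal x = ENNReal.ofReal (x ^ 2) ^ (1 / 2 : ℝ) := by
  rw [ENNReal.ofReal_rpow_of_nonneg (by positivity) (by norm_num), ← Real.sqrt_eq_rpow,
    Real.sqrt_sq hx]

theorem ofReal_sum_re_inner_le {ι : Type*} (s : Finset ι) (u v : ι → K) :
    ENNReal.ofReal (∑ i ∈ s, (⟪u i, v i⟫_ℂ).re) ≤
      (∑ i ∈ s, ENNReal.ofReal (‖u i‖ ^ 2)) ^ (1 / 2 : ℝ) *
        (∑ i ∈ s, ENNReal.ofReal (‖v i‖ ^ 2)) ^ (1 / 2 : ℝ) := by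
  refine le_trans ?_ (sum_sqrt_mul_sqrt_le s _ _)
  have h : ∑ i ∈ s, (⟪u i, v i⟫_ℂ).re ≤ ∑ i ∈ s, ‖u i‖ * ‖v i‖ :=
    Finset.sum_le_sum fun i _ => (Complex.re_le_norm _).trans (norm_inner_le_norm _ _)
  refine (ENNReal.ofReal_le_ofReal h).trans ?_
  rw [ENNReal.ofReal_sum_of_nonneg fun i _ => by positivity]
  refine Finset.sum_le_sum fun i _ => ?_
  rw [ENNReal.ofReal_mul (norm_nonneg _), ofReal_eq_sqrt_sq (norm_nonneg (u i)),
    ofReal_eq_sqrt_sq (norm_nonneg (v i))]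

theorem ofReal_sum_re_inner_le_hs (s : Finset (BasisIndex H)) (A B : H →L[ℂ] K) :
    ENNReal.ofReal (∑ i ∈ s, (⟪A (basis H i), B (basis H i)⟫_ℂ).re) ≤
      hs A ^ (1 / 2 : ℝ) * hs B ^ (1 / 2 : ℝ) := by
  refine (ofReal_sum_re_inner_le s _ _).trans ?_
  gcongr <;> exact ENNReal.sum_le_tsum s

/-- The trace norm is the supremum of `Re ∑ ⟨b, W T b⟩` over all contractions `W` and finite sets
of basis vectors `b`: upper bound. -/
theorem traceNorm_le_of_forall {T : H →L[ℂ] H} {c : ℝ≥0∞}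
    (h : ∀ W : H →L[ℂ] H, ‖W‖ ≤ 1 → ∀ s : Finset (BasisIndex H),
      ENNReal.ofReal (∑ i ∈ s, (⟪basis H i, W (T (basis H i))⟫_ℂ).re) ≤ c) :
    traceNorm T ≤ c := by
  obtain ⟨⟨W, hW, hT⟩, -⟩ := exists_abs_eq T
  have hpos : (CFC.abs T).IsPositive :=
    (ContinuousLinearMap.nonneg_iff_isPositive _).1 (CFC.abs_nonneg T)
  unfold traceNorm trace
  rw [ENNReal.tsum_eq_iSup_sum]
  refine iSup_le fun s => ?_
  rw [← ENNReal.ofReal_sum_of_nonneg fun i _ => re_inner_nonneg hpos _, hT]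
  exact h W hW s

/-- A trace class operator is a product of two operators whose squared Hilbert--Schmidt norms are
at most its trace norm. -/
theorem exists_eq_adjoint_comp (T : H →L[ℂ] H) :
    ∃ A B : H →L[ℂ] H, T = A.adjoint ∘L B ∧ hs A ≤ traceNorm T ∧ hs B ≤ traceNorm T := by
  obtain ⟨-, U, hU, hT⟩ := exists_abs_eq T
  have hpos : (CFC.abs T).IsPositive :=
    (ContinuousLinearMap.nonneg_iff_isPositive _).1 (CFC.abs_nonneg T)
  have htr : traceNorm T = hs (CFC.sqrt (CFC.abs T)) := trace_eq_hs_sqrt hpos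
  refine ⟨CFC.sqrt (CFC.abs T) ∘L U.adjoint, CFC.sqrt (CFC.abs T), ?_, ?_, htr.ge⟩
  · rw [ContinuousLinearMap.adjoint_comp, ContinuousLinearMap.adjoint_adjoint,
      sqrt_isSelfAdjoint, ContinuousLinearMap.comp_assoc, sqrt_comp_sqrt hpos]
    exact hT
  · rw [htr]
    exact hs_comp_le_right _ (norm_adjoint_le_one hU) _

/-- Hölder's inequality `‖A† B‖₁ ≤ ‖A‖₂ ‖B‖₂`. -/
theorem traceNorm_adjoint_comp_le (A B : H →L[ℂ] K) :
    traceNorm (A.adjoint ∘L B) ≤ hs A ^ (1 / 2 : ℝ) * hs B ^ (1 / 2 : ℝ) := by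
  refine traceNorm_le_of_forall fun W hW s => ?_
  have h := ofReal_sum_re_inner_le_hs s (A ∘L W.adjoint) B
  have h2 : ∀ x : H, ⟪x, W ((A.adjoint ∘L B) x)⟫_ℂ = ⟪(A ∘L W.adjoint) x, B x⟫_ℂ := by
    intro x
    simp only [ContinuousLinearMap.comp_apply]
    rw [← ContinuousLinearMap.adjoint_inner_left, ContinuousLinearMap.adjoint_inner_right]
  simp only [h2]
  refine h.trans ?_
  gcongr
  exact hs_comp_le_right _ (norm_adjoint_le_one hW) _

theorem sqrt_mul_sqrt_self (x : ℝ≥0∞) : x ^ (1 / 2 : ℝ) * x ^ (1 / 2 : ℝ) = x := by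
  rw [← ENNReal.rpow_add_of_nonneg _ _ (by norm_num) (by norm_num)]; norm_num

/-- The trace norm is the supremum of `Re ∑ ⟨b, W T b⟩` over all contractions `W` and finite sets
of basis vectors `b`: lower bound. -/
theorem ofReal_sum_le_traceNorm (T W : H →L[ℂ] H) (hW : ‖W‖ ≤ 1) (s : Finset (BasisIndex H)) :
    ENNReal.ofReal (∑ i ∈ s, (⟪basis H i, W (T (basis H i))⟫_ℂ).re) ≤ traceNorm T := by
  obtain ⟨A, B, hT, hA, hB⟩ := exists_eq_adjoint_comp T
  have h := ofReal_sum_re_inner_le_hs s (A ∘L W.adjoint) B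
  have h2 : ∀ x : H, ⟪x, W (T x)⟫_ℂ = ⟪(A ∘L W.adjoint) x, B x⟫_ℂ := by
    intro x
    rw [hT]
    simp only [ContinuousLinearMap.comp_apply]
    rw [← ContinuousLinearMap.adjoint_inner_left, ContinuousLinearMap.adjoint_inner_right]
  simp only [h2]
  refine h.trans ?_
  calc _ ≤ traceNorm T ^ (1 / 2 : ℝ) * traceNorm T ^ (1 / 2 : ℝ) := by
        gcongr
        exact (hs_comp_le_right _ (norm_adjoint_le_one hW) _).trans hA
    _ = traceNorm T := sqrt_mul_sqrt_self _

theorem traceNorm_add_le (S T : H →L[ℂ] H) : traceNorm (S + T) ≤ traceNorm S + traceNorm T := by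
  refine traceNorm_le_of_forall fun W hW s => ?_
  have : ∑ i ∈ s, (⟪basis H i, W ((S + T) (basis H i))⟫_ℂ).re =
      ∑ i ∈ s, (⟪basis H i, W (S (basis H i))⟫_ℂ).re +
        ∑ i ∈ s, (⟪basis H i, W (T (basis H i))⟫_ℂ).re := by
    rw [← Finset.sum_add_distrib]
    simp
  rw [this]
  exact ENNReal.ofReal_add_le.trans
    (add_le_add (ofReal_sum_le_traceNorm S W hW s) (ofReal_sum_le_traceNorm T W hW s))

theorem traceNorm_zero : traceNorm (0 : H →L[ℂ] H) = 0 := by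
  simp [traceNorm, trace_zero]

theorem traceNorm_sum_le {ι : Type*} (s : Finset ι) (T : ι → H →L[ℂ] H) :
    traceNorm (∑ i ∈ s, T i) ≤ ∑ i ∈ s, traceNorm (T i) := by
  induction s using Finset.induction_on with
  | empty => simp [traceNorm_zero]
  | insert a s ha ih =>
    rw [Finset.sum_insert ha, Finset.sum_insert ha]
    exact (traceNorm_add_le _ _).trans (by gcongr)

theorem traceNorm_neg (T : H →L[ℂ] H) : traceNorm (-T) = traceNorm T := by
  simp [traceNorm]

theorem traceNorm_smul_le {c : ℝ} (hc : 0 ≤ c) (T : H →L[ℂ] H) :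
    traceNorm (c • T) ≤ ENNReal.ofReal c * traceNorm T := by
  refine traceNorm_le_of_forall fun W hW s => ?_
  have : ∑ i ∈ s, (⟪basis H i, W ((c • T) (basis H i))⟫_ℂ).re =
      c * ∑ i ∈ s, (⟪basis H i, W (T (basis H i))⟫_ℂ).re := by
    rw [Finset.mul_sum]
    refine Finset.sum_congr rfl fun i _ => ?_
    rw [smul_apply, ContinuousLinearMap.map_smul_of_tower, inner_smul_right_eq_smul]
    simp
  rw [this, ENNReal.ofReal_mul hc]
  gcongr
  exact ofReal_sum_le_traceNorm T W hW s

theorem traceNorm_of_isPositive {T : H →L[ℂ] H} (hT : T.IsPositive) : traceNorm T = trace T := by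
  rw [traceNorm, CFC.abs_of_nonneg T ((ContinuousLinearMap.nonneg_iff_isPositive T).2 hT)]

/-- Compressing by a contraction does not increase the trace norm. -/
theorem traceNorm_conj_le (J : K →L[ℂ] H) (hJ : ‖J‖ ≤ 1) (T : H →L[ℂ] H) :
    traceNorm (J.adjoint ∘L T ∘L J) ≤ traceNorm T := by
  obtain ⟨A, B, hT, hA, hB⟩ := exists_eq_adjoint_comp T
  have h : J.adjoint ∘L T ∘L J = (A ∘L J).adjoint ∘L (B ∘L J) := by
    rw [hT, ContinuousLinearMap.adjoint_comp]; rfl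
  rw [h]
  refine (traceNorm_adjoint_comp_le _ _).trans ?_
  calc _ ≤ traceNorm T ^ (1 / 2 : ℝ) * traceNorm T ^ (1 / 2 : ℝ) := by
        gcongr
        · exact (hs_comp_le_right _ hJ _).trans hA
        · exact (hs_comp_le_right _ hJ _).trans hB
    _ = traceNorm T := sqrt_mul_sqrt_self _

end TraceNorm

/-! ### Operators on `ℂ^X ⊗ H` -/

section Blocks

variable {H : Type*} [NormedAddCommGroup H] [InnerProductSpace ℂ H] [CompleteSpace H]
variable {K : Type*} [NormedAddCommGroup K] [InnerProductSpace ℂ K] [CompleteSpace K]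
variable {X : Type*} [Fintype X]

/-- The component map `ℂ^X ⊗ H → H`, `v ↦ (⟨x| ⊗ 1) v`. -/
noncomputable def coord (H : Type*) [NormedAddCommGroup H] [InnerProductSpace ℂ H] (x : X) :
    Reg X H →L[ℂ] H :=
  PiLp.proj 2 (𝕜 := ℂ) (fun _ : X => H) x

theorem sq_norm_reg (v : Reg X H) : ‖v‖ ^ 2 = ∑ x, ‖coord H x v‖ ^ 2 := by
  rw [PiLp.norm_sq_eq_of_L2]; rfl

theorem norm_coord_le (x : X) : ‖coord H x‖ ≤ 1 := by
  refine ContinuousLinearMap.opNorm_le_bound _ zero_le_one fun v => ?_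
  rw [one_mul]
  exact PiLp.norm_apply_le v x

theorem inner_reg (v w : Reg X H) : ⟪v, w⟫_ℂ = ∑ x, ⟪coord H x v, coord H x w⟫_ℂ :=
  PiLp.inner_apply v w

theorem coord_apply (x : X) (v : Reg X H) : coord H x v = v x := rfl

theorem blockDiag_eq (ρ : X → H →L[ℂ] H) :
    blockDiag ρ = ∑ x, (coord H x).adjoint ∘L ρ x ∘L coord H x := by
  unfold blockDiag blockOp
  change ∑ x, ∑ y, (coord H x).adjoint ∘L (if x = y then ρ x else 0) ∘L coord H y = _
  refine Finset.sum_congr rfl fun x _ => ?_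
  rw [Finset.sum_eq_single x]
  · simp
  · intro y _ hy; simp [hy.symm]
  · simp

theorem inner_blockDiag (ρ : X → H →L[ℂ] H) (v w : Reg X H) :
    ⟪v, blockDiag ρ w⟫_ℂ = ∑ x, ⟪coord H x v, ρ x (coord H x w)⟫_ℂ := by
  rw [blockDiag_eq, sum_apply, inner_sum]
  refine Finset.sum_congr rfl fun x _ => ?_
  simp only [ContinuousLinearMap.comp_apply]
  rw [ContinuousLinearMap.adjoint_inner_right]

theorem traceNorm_blockDiag_le (D : X → H →L[ℂ] H) :
    traceNorm (blockDiag D) ≤ ∑ x, traceNorm (D x) := by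
  rw [blockDiag_eq]
  exact (traceNorm_sum_le _ _).trans
    (Finset.sum_le_sum fun x _ => traceNorm_conj_le (coord H x) (norm_coord_le x) (D x))

theorem coord_adjoint_apply (x y : X) (v : H) :
    coord H y ((coord H x).adjoint v) = if x = y then v else 0 := by
  have h : (coord H x).adjoint v = PiLp.single 2 x v := by
    refine ext_inner_right ℂ fun w => ?_
    rw [ContinuousLinearMap.adjoint_inner_left, inner_reg, Finset.sum_eq_single x]
    · simp [coord_apply]
    · intro y _ hy; simp [coord_apply, hy]
    · simp
  rw [h, coord_apply]
  by_cases hxy : x = y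
  · subst hxy; simp
  · simp [hxy, Ne.symm hxy]

theorem coord_comp_blockDiag (ρ : X → H →L[ℂ] H) (x : X) :
    coord H x ∘L blockDiag ρ ∘L (coord H x).adjoint = ρ x := by
  ext v
  refine ext_inner_left ℂ fun w => ?_
  simp only [ContinuousLinearMap.comp_apply]
  rw [← ContinuousLinearMap.adjoint_inner_left, inner_blockDiag, Finset.sum_eq_single x]
  · simp only [coord_adjoint_apply, if_true]
  · intro y _ hy
    simp only [coord_adjoint_apply, hy.symm, if_false, map_zero, inner_zero_left]
  · simp

theorem isPositive_blockDiag {ρ : X → H →L[ℂ] H} (h : ∀ x, (ρ x).IsPositive) :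
    (blockDiag ρ).IsPositive := by
  rw [blockDiag_eq]
  exact ContinuousLinearMap.isPositive_sum _ fun x _ => (h x).adjoint_conj (coord H x)

theorem trace_conj_le (J : K →L[ℂ] H) (hJ : ‖J‖ ≤ 1) {T : H →L[ℂ] H} (hT : T.IsPositive) :
    trace (J.adjoint ∘L T ∘L J) ≤ trace T := by
  rw [← traceNorm_of_isPositive hT, ← traceNorm_of_isPositive (hT.adjoint_conj J)]
  exact traceNorm_conj_le J hJ T

theorem trace_blockDiag_le {ρ : X → H →L[ℂ] H} (h : ∀ x, (ρ x).IsPositive) :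
    trace (blockDiag ρ) ≤ ∑ x, trace (ρ x) := by
  rw [blockDiag_eq, trace_sum _ fun x => (h x).adjoint_conj (coord H x)]
  exact Finset.sum_le_sum fun x _ => trace_conj_le (coord H x) (norm_coord_le x) (h x)

/-- The block columns of an operator on `ℂ^X ⊗ H` have together the squared Hilbert--Schmidt norm
of the operator. -/
theorem sum_hs_comp_coord_adjoint (A : Reg X H →L[ℂ] K) :
    ∑ x, hs (A ∘L (coord H x).adjoint) = hs A := by
  rw [← hs_adjoint A]
  simp only [← hs_adjoint (A ∘L _), ContinuousLinearMap.adjoint_comp,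
    ContinuousLinearMap.adjoint_adjoint]
  unfold hs
  rw [← Summable.tsum_finsetSum fun _ _ => ENNReal.summable]
  refine tsum_congr fun i => ?_
  rw [← ENNReal.ofReal_sum_of_nonneg fun _ _ => by positivity, sq_norm_reg]
  rfl

/-- The trace of an operator on `ℂ^X ⊗ H` is the sum of the traces of its diagonal blocks. -/
theorem sum_trace_coord {T : Reg X H →L[ℂ] Reg X H} (hT : T.IsPositive) :
    ∑ x, trace (coord H x ∘L T ∘L (coord H x).adjoint) = trace T := by
  rw [trace_eq_hs_sqrt hT, ← sum_hs_comp_coord_adjoint]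
  refine Finset.sum_congr rfl fun x _ => ?_
  rw [← trace_adjoint_comp, ContinuousLinearMap.adjoint_comp, ContinuousLinearMap.adjoint_adjoint,
    sqrt_isSelfAdjoint]
  conv_lhs => rw [← sqrt_comp_sqrt hT]
  rfl

end Blocks

/-! ### Hölder inequalities with a sandwiching operator -/

section Hoelder

variable {H : Type*} [NormedAddCommGroup H] [InnerProductSpace ℂ H] [CompleteSpace H]

theorem inner_sqrt_left (T : H →L[ℂ] H) (x y : H) :
    ⟪CFC.sqrt T x, y⟫_ℂ = ⟪x, CFC.sqrt T y⟫_ℂ := by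
  rw [← ContinuousLinearMap.adjoint_inner_right, sqrt_isSelfAdjoint]

theorem sqrt_sqrt_apply {T : H →L[ℂ] H} (hT : T.IsPositive) (x : H) :
    CFC.sqrt T (CFC.sqrt T x) = T x :=
  congrArg (fun S : H →L[ℂ] H => S x) (sqrt_comp_sqrt hT)

theorem sq_norm_eq_re_inner_sqrt {A : H →L[ℂ] H} (hA : A.IsPositive) (x : H) :
    ‖A x‖ ^ 2 = (⟪CFC.sqrt A x, A (CFC.sqrt A x)⟫_ℂ).re := by
  rw [← sqrt_sqrt_apply hA x, sq_norm_sqrt hA]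

theorem hs_le_tsum_of_le {A N : H →L[ℂ] H} (hA : A.IsPositive) (h : A ≤ N) :
    hs A ≤ ∑' i, ENNReal.ofReal
      (⟪CFC.sqrt A (basis H i), N (CFC.sqrt A (basis H i))⟫_ℂ).re := by
  refine ENNReal.tsum_le_tsum fun i => ENNReal.ofReal_le_ofReal ?_
  rw [sq_norm_eq_re_inner_sqrt hA]
  exact re_inner_le h _

/-- The Hilbert--Schmidt norm is monotone on positive operators, although squaring is not operator
monotone: `Tr A² ≤ Tr B^{1/2} A B^{1/2} ≤ Tr B²`. -/
theorem hs_mono {A B : H →L[ℂ] H} (hA : A.IsPositive) (h : A ≤ B) : hs A ≤ hs B := by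
  have hB : B.IsPositive := by
    rw [← ContinuousLinearMap.nonneg_iff_isPositive] at hA ⊢
    exact hA.trans h
  calc hs A ≤ hs (CFC.sqrt B ∘L CFC.sqrt A) := by
        refine (hs_le_tsum_of_le hA h).trans_eq (tsum_congr fun i => ?_)
        rw [← sq_norm_sqrt hB]; rfl
    _ = hs (CFC.sqrt A ∘L CFC.sqrt B) := by
        rw [← hs_adjoint, ContinuousLinearMap.adjoint_comp, sqrt_isSelfAdjoint, sqrt_isSelfAdjoint]
    _ ≤ hs B := by
        refine ENNReal.tsum_le_tsum fun i => ENNReal.ofReal_le_ofReal ?_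
        rw [sq_norm_eq_re_inner_sqrt hB, ContinuousLinearMap.comp_apply, sq_norm_sqrt hA]
        exact re_inner_le h _

/-- A Hilbert--Schmidt operator as the vector of its values on the basis, in the Hilbert space
`ℓ²(H)`; the inner product of `ℓ²(H)` becomes the Hilbert--Schmidt inner product `Tr (A† B)`. -/
noncomputable def hsVec (A : H →L[ℂ] H) (hA : hs A ≠ ∞) : lp (fun _ : BasisIndex H => H) 2 :=
  ⟨fun i => A (basis H i), memℓp_gen (by
    have h := ENNReal.summable_toReal hA
    simpa using h)⟩

theorem hs_eq_ofReal_of_coe_eq (A : H →L[ℂ] H) (v : lp (fun _ : BasisIndex H => H) 2)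
    (h : ∀ i, A (basis H i) = v i) : hs A = ENNReal.ofReal (‖v‖ ^ 2) := by
  have h1 := lp.hasSum_norm (p := 2) (by norm_num) v
  simp only [ENNReal.toReal_ofNat, Real.rpow_ofNat] at h1
  rw [← h1.tsum_eq, ENNReal.ofReal_tsum_of_nonneg (fun _ => by positivity) h1.summable]
  unfold hs
  simp only [h]

theorem ofReal_sq_norm_hsVec (A : H →L[ℂ] H) (hA : hs A ≠ ∞) :
    ENNReal.ofReal (‖hsVec A hA‖ ^ 2) = hs A :=
  (hs_eq_ofReal_of_coe_eq A (hsVec A hA) fun _ => rfl).symm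

/-- `Tr (A B) ≥ 0` for positive Hilbert--Schmidt operators. It follows by differentiating the
inequality `‖A‖₂ ≤ ‖A + t B‖₂` at `t = 0`. -/
theorem re_inner_hsVec_nonneg {A B : H →L[ℂ] H} (hA : A.IsPositive) (hB : B.IsPositive)
    (hA' : hs A ≠ ∞) (hB' : hs B ≠ ∞) : 0 ≤ (⟪hsVec A hA', hsVec B hB'⟫_ℂ).re := by
  -- `‖A‖₂² ≤ ‖A + t B‖₂²`, expanded and divided by `t`
  have key : ∀ t : ℝ, 0 < t →
      0 ≤ 2 * (⟪hsVec A hA', hsVec B hB'⟫_ℂ).re + t * ‖hsVec B hB'‖ ^ 2 := by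
    intro t ht
    have h1 : hs A ≤ hs (A + t • B) := by
      refine hs_mono hA ?_
      rw [ContinuousLinearMap.le_def, add_sub_cancel_left]
      exact isPositive_smul ht.le hB
    rw [hs_eq_ofReal_of_coe_eq (A + t • B) (hsVec A hA' + (t : ℂ) • hsVec B hB') fun i => by
      change A _ + t • B _ = A _ + (t : ℂ) • B _
      simp, ← ofReal_sq_norm_hsVec A hA',
      ENNReal.ofReal_le_ofReal_iff (by positivity), @norm_add_sq ℂ, inner_smul_right, norm_smul] at h1
    simp only [RCLike.re_to_complex, Complex.re_ofReal_mul, Complex.norm_real, Real.norm_eq_abs,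
      abs_of_pos ht] at h1
    nlinarith
  by_contra hneg
  push Not at hneg
  set a := (⟪hsVec A hA', hsVec B hB'⟫_ℂ).re
  have hb : 0 ≤ ‖hsVec B hB'‖ ^ 2 := by positivity
  have h2 := key (-a / (‖hsVec B hB'‖ ^ 2 + 1)) (div_pos (by linarith) (by positivity))
  have h3 : -a / (‖hsVec B hB'‖ ^ 2 + 1) * ‖hsVec B hB'‖ ^ 2 ≤ -a := by
    rw [div_mul_eq_mul_div, div_le_iff₀ (by positivity)]
    nlinarith
  linarith

/-- Cyclicity of the trace for a trace over finitely many basis vectors. With `P` the orthogonal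
projection to their span, `Tr (P A† B)` may be rewritten as `Tr (X† Y)` as soon as the matrix
elements of `B P A†` and `X† Y` agree, and is then bounded by the Cauchy--Schwarz inequality. -/
theorem exists_projection (s : Finset (BasisIndex H)) :
    ∃ P : H →L[ℂ] H, ‖P‖ ≤ 1 ∧ P.IsPositive ∧ P ≤ 1 ∧ ∀ A B X Y : H →L[ℂ] H,
      (∀ x, ⟪B.adjoint x, P (A.adjoint x)⟫_ℂ = ⟪X x, Y x⟫_ℂ) →
        ENNReal.ofReal (∑ i ∈ s, (⟪A (basis H i), B (basis H i)⟫_ℂ).re) ≤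
          hs X ^ (1 / 2 : ℝ) * hs Y ^ (1 / 2 : ℝ) := by
  let P : H →L[ℂ] H := ∑ i ∈ s, (innerSL ℂ (basis H i)).smulRight (basis H i)
  have hP : ∀ x, P x = ∑ i ∈ s, ⟪basis H i, x⟫_ℂ • basis H i := fun x => by
    simp [P, sum_apply]
  have hin : ∀ x y, ⟪x, P y⟫_ℂ = ∑ i ∈ s, ⟪x, basis H i⟫_ℂ * ⟪basis H i, y⟫_ℂ := fun x y => by
    rw [hP, inner_sum]
    exact Finset.sum_congr rfl fun i _ => by rw [inner_smul_right, mul_comm]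
  have hre : ∀ x, ⟪x, P x⟫_ℂ = ((∑ i ∈ s, ‖⟪basis H i, x⟫_ℂ‖ ^ 2 : ℝ) : ℂ) := fun x => by
    rw [hin, Complex.ofReal_sum]
    refine Finset.sum_congr rfl fun i _ => ?_
    rw [← inner_conj_symm, RCLike.conj_mul]
    push_cast; rfl
  have hbes : ∀ x, ∑ i ∈ s, ‖⟪basis H i, x⟫_ℂ‖ ^ 2 ≤ ‖x‖ ^ 2 := fun x =>
    (basis H).orthonormal.sum_inner_products_le x
  have hsymm : (P : H →ₗ[ℂ] H).IsSymmetric := fun x y => by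
    change ⟪P x, y⟫_ℂ = ⟪x, P y⟫_ℂ
    rw [← inner_conj_symm, hin, hin, map_sum]
    refine Finset.sum_congr rfl fun i _ => ?_
    rw [map_mul, inner_conj_symm, inner_conj_symm, mul_comm]
  have hpos : P.IsPositive := by
    refine ContinuousLinearMap.isPositive_def.2 ⟨hsymm, fun x => ?_⟩
    rw [ContinuousLinearMap.reApplyInnerSelf_apply, inner_re_symm, hre]
    exact Finset.sum_nonneg fun i _ => by positivity
  have hle : P ≤ 1 := by
    rw [ContinuousLinearMap.le_def]
    refine ContinuousLinearMap.isPositive_def.2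
      ⟨(LinearMap.IsSymmetric.id : (LinearMap.id : H →ₗ[ℂ] H).IsSymmetric).sub hsymm, fun x => ?_⟩
    rw [ContinuousLinearMap.reApplyInnerSelf_apply]
    have h1 := hre x
    have h2 := hbes x
    have h3 : RCLike.re ⟪(1 - P) x, x⟫_ℂ = ‖x‖ ^ 2 - ∑ i ∈ s, ‖⟪basis H i, x⟫_ℂ‖ ^ 2 := by
      rw [inner_re_symm, sub_apply, inner_sub_right, map_sub, h1]
      simp [inner_self_eq_norm_sq_to_K, ← Complex.ofReal_pow]
    rw [h3]; linarith
  have hnorm : ‖P‖ ≤ 1 := by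
    refine ContinuousLinearMap.opNorm_le_bound _ zero_le_one fun x => ?_
    rw [one_mul]
    have h1 : ‖P x‖ ^ 2 ≤ ‖x‖ ^ 2 := by
      refine le_trans (le_of_eq ?_) (hbes x)
      have : P (P x) = P x := by
        rw [hP (P x)]
        conv_rhs => rw [hP]
        refine Finset.sum_congr rfl fun i hi => ?_
        congr 1
        rw [hP]
        exact (basis H).orthonormal.inner_right_sum _ hi
      have h2 : ⟪P x, P x⟫_ℂ = ⟪x, P x⟫_ℂ := by
        rw [show ⟪P x, P x⟫_ℂ = ⟪x, P (P x)⟫_ℂ from hsymm x (P x), this]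
      have h3 := congrArg Complex.re h2
      rw [hre, Complex.ofReal_re] at h3
      rw [← h3]
      exact (inner_self_eq_norm_sq (𝕜 := ℂ) _).symm
    exact (sq_le_sq₀ (norm_nonneg _) (norm_nonneg _)).1 h1
  refine ⟨P, hnorm, hpos, hle, fun A B X Y h => ?_⟩
  have hsum : HasSum (fun j => (⟪X (basis H j), Y (basis H j)⟫_ℂ).re)
      (∑ i ∈ s, (⟪A (basis H i), B (basis H i)⟫_ℂ).re) := by
    have h1 : ∀ i ∈ s, HasSum (fun j => (⟪A (basis H i), basis H j⟫_ℂ *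
        ⟪basis H j, B (basis H i)⟫_ℂ).re) (⟪A (basis H i), B (basis H i)⟫_ℂ).re := fun i _ =>
      Complex.hasSum_re ((basis H).hasSum_inner_mul_inner _ _)
    refine (hasSum_sum h1).congr_fun ?_
    intro j
    rw [← h, hin, Complex.re_sum]
    refine Finset.sum_congr rfl fun i _ => ?_
    rw [ContinuousLinearMap.adjoint_inner_left, ContinuousLinearMap.adjoint_inner_right, mul_comm]
  refine le_of_tendsto (ENNReal.continuous_ofReal.continuousAt.tendsto.comp hsum)
    (Filter.Eventually.of_forall fun t => ?_)
  exact ofReal_sum_re_inner_le_hs t X Y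

/-- `‖R V R‖₂ ≤ ‖R²‖₂` for self-adjoint `R` and a contraction `V`: by cyclicity `‖R V R‖₂²` is the
Hilbert--Schmidt inner product of `V† R² V` and `R P R`, both of norm at most `‖R²‖₂`. -/
theorem hs_conj_le (R V : H →L[ℂ] H) (hR : R.adjoint = R) (hV : ‖V‖ ≤ 1) :
    hs (R ∘L V ∘L R) ≤ hs (R ∘L R) := by
  have hRi : ∀ x y : H, ⟪R x, y⟫_ℂ = ⟪x, R y⟫_ℂ := fun x y => by
    rw [← ContinuousLinearMap.adjoint_inner_right, hR]
  unfold hs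
  rw [ENNReal.tsum_eq_iSup_sum]
  refine iSup_le fun s => ?_
  obtain ⟨P, hP, hPpos, hP1, hsw⟩ := exists_projection s
  rw [← ENNReal.ofReal_sum_of_nonneg fun _ _ => by positivity]
  have h1 := hsw R (V.adjoint ∘L R ∘L R ∘L V ∘L R) (V.adjoint ∘L (R ∘L R) ∘L V) (R ∘L P ∘L R)
    (fun x => by
      simp only [ContinuousLinearMap.adjoint_comp, ContinuousLinearMap.adjoint_adjoint, hR,
        ContinuousLinearMap.comp_apply, hRi])
  have h2 : ∀ x : H, ‖(R ∘L V ∘L R) x‖ ^ 2 =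
      (⟪R x, (V.adjoint ∘L R ∘L R ∘L V ∘L R) x⟫_ℂ).re := fun x => by
    simp only [ContinuousLinearMap.comp_apply, ContinuousLinearMap.adjoint_inner_right]
    rw [← hRi]
    exact (inner_self_eq_norm_sq (𝕜 := ℂ) _).symm
  simp only [h2]
  refine h1.trans ?_
  have h3 : hs (V.adjoint ∘L (R ∘L R) ∘L V) ≤ hs (R ∘L R) :=
    (hs_comp_le_left _ (norm_adjoint_le_one hV) _).trans (hs_comp_le_right _ hV _)
  have h4 : hs (R ∘L P ∘L R) ≤ hs (R ∘L R) := by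
    have hp := hPpos.adjoint_conj R
    rw [hR] at hp
    refine hs_mono hp ?_
    have h5 := ((ContinuousLinearMap.le_def P 1).1 hP1).adjoint_conj R
    rw [hR] at h5
    rw [ContinuousLinearMap.le_def]
    convert h5 using 1
    ext x; simp
  calc _ ≤ hs (R ∘L R) ^ (1 / 2 : ℝ) * hs (R ∘L R) ^ (1 / 2 : ℝ) := by gcongr
    _ = _ := sqrt_mul_sqrt_self _

/-- Hölder's inequality `‖R S R‖₁ ≤ ‖S‖₂ ‖R‖₄²`. -/
theorem traceNorm_conj_le_hs (R S : H →L[ℂ] H) (hR : R.adjoint = R) (hS : S.adjoint = S) :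
    traceNorm (R ∘L S ∘L R) ≤ hs S ^ (1 / 2 : ℝ) * hs (R ∘L R) ^ (1 / 2 : ℝ) := by
  have hRi : ∀ x y : H, ⟪R x, y⟫_ℂ = ⟪x, R y⟫_ℂ := fun x y => by
    rw [← ContinuousLinearMap.adjoint_inner_right, hR]
  refine traceNorm_le_of_forall fun W hW s => ?_
  obtain ⟨P, hP, -, -, hsw⟩ := exists_projection s
  have h1 := hsw (R ∘L W.adjoint) (S ∘L R) S (R ∘L (P ∘L W) ∘L R) (fun x => by
    simp only [ContinuousLinearMap.adjoint_comp, ContinuousLinearMap.adjoint_adjoint, hR, hS,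
      ContinuousLinearMap.comp_apply, hRi])
  have h2 : ∀ x : H, ⟪x, W ((R ∘L S ∘L R) x)⟫_ℂ = ⟪(R ∘L W.adjoint) x, (S ∘L R) x⟫_ℂ := by
    intro x
    simp only [ContinuousLinearMap.comp_apply]
    rw [hRi, ContinuousLinearMap.adjoint_inner_left]
  simp only [h2]
  refine h1.trans ?_
  gcongr
  refine hs_conj_le R _ hR ((ContinuousLinearMap.opNorm_comp_le _ _).trans ?_)
  exact mul_le_one₀ hP (norm_nonneg _) hW

end Hoelder

/-! ### Leftover hashing -/

section LeftoverHashing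

variable {H : Type*} [NormedAddCommGroup H] [InnerProductSpace ℂ H] [CompleteSpace H]

/-- If `τ ≤ c σ`, then `τ = σ^{1/4} S σ^{1/4}` with `S` positive and `Tr S² ≤ c Tr τ`. The operator
`S` is `σ^{-1/4} τ σ^{-1/4}`, but is constructed without inverting `σ`: by Douglas,
`√τ = √c C σ^{1/2}` for a contraction `C`, so `S = D† D` with `D = √c C σ^{1/4}`. -/
theorem exists_sandwich {τ σ : H →L[ℂ] H} (hτ : τ.IsPositive) (hσ : σ.IsPositive) {c : ℝ}
    (hc : 0 ≤ c) (h : τ ≤ c • σ) :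
    ∃ S : H →L[ℂ] H, S.IsPositive ∧
      τ = CFC.sqrt (CFC.sqrt σ) ∘L S ∘L CFC.sqrt (CFC.sqrt σ) ∧
      hs S ≤ ENNReal.ofReal c * trace τ := by
  set R := CFC.sqrt (CFC.sqrt σ) with hRdef
  have hRR : ∀ x, R (R x) = CFC.sqrt σ x := sqrt_sqrt_apply (isPositive_sqrt σ)
  have hR : R.adjoint = R := sqrt_isSelfAdjoint _
  have hRi : ∀ x y, ⟪R x, y⟫_ℂ = ⟪x, R y⟫_ℂ := inner_sqrt_left _
  obtain ⟨C, hC, hCeq⟩ := exists_contraction_comp_eq (CFC.sqrt τ)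
    (((Real.sqrt c : ℝ) : ℂ) • CFC.sqrt σ) (fun x => by
      have h1 : ‖CFC.sqrt τ x‖ ^ 2 ≤ ‖(((Real.sqrt c : ℝ) : ℂ) • CFC.sqrt σ) x‖ ^ 2 := by
        rw [smul_apply, norm_smul, mul_pow, sq_norm_sqrt hτ, sq_norm_sqrt hσ, Complex.norm_real,
          Real.norm_eq_abs, sq_abs, Real.sq_sqrt hc]
        refine (re_inner_le h x).trans_eq ?_
        rw [smul_apply, inner_smul_right_eq_smul]
        simp
      exact (sq_le_sq₀ (norm_nonneg _) (norm_nonneg _)).1 h1)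
  set D : H →L[ℂ] H := ((Real.sqrt c : ℝ) : ℂ) • (C ∘L R) with hD
  have hDR : ∀ x, D (R x) = CFC.sqrt τ x := fun x => by
    rw [hCeq, hD]
    simp [hRR]
  have hDn : ∀ x, ‖D x‖ ^ 2 ≤ c * ‖R x‖ ^ 2 := fun x => by
    have h1 : ‖C (R x)‖ ≤ ‖R x‖ := (C.le_of_opNorm_le hC _).trans_eq (one_mul _)
    rw [hD, smul_apply, norm_smul, mul_pow, Complex.norm_real, Real.norm_eq_abs, sq_abs,
      Real.sq_sqrt hc]
    gcongr
    exact h1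
  have hSpos : (D.adjoint ∘L D).IsPositive := ContinuousLinearMap.isPositive_adjoint_comp_self D
  have hτeq : τ = R ∘L (D.adjoint ∘L D) ∘L R := by
    ext x
    refine ext_inner_left ℂ fun y => ?_
    simp only [ContinuousLinearMap.comp_apply]
    rw [← hRi, ContinuousLinearMap.adjoint_inner_right, hDR, hDR, inner_sqrt_left,
      sqrt_sqrt_apply hτ]
  refine ⟨D.adjoint ∘L D, hSpos, hτeq, ?_⟩
  set S := D.adjoint ∘L D with hS
  calc hs S ≤ ENNReal.ofReal c * hs (R ∘L CFC.sqrt S) := by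
        unfold hs
        rw [← ENNReal.tsum_mul_left]
        refine ENNReal.tsum_le_tsum fun i => ?_
        rw [← ENNReal.ofReal_mul hc]
        refine ENNReal.ofReal_le_ofReal ?_
        rw [sq_norm_eq_re_inner_sqrt hSpos, hS, inner_adjoint_comp_self]
        exact hDn _
    _ = ENNReal.ofReal c * hs (CFC.sqrt S ∘L R) := by
        rw [← hs_adjoint, ContinuousLinearMap.adjoint_comp, sqrt_isSelfAdjoint, hR]
    _ = ENNReal.ofReal c * trace τ := by
        rw [← trace_adjoint_comp, ContinuousLinearMap.adjoint_comp, hR, sqrt_isSelfAdjoint, hτeq]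
        congr 2
        conv_rhs => rw [← sqrt_comp_sqrt hSpos]
        rfl

variable {Z 𝒦 𝓖 : Type*} [Fintype Z] [Fintype 𝒦] [Fintype 𝓖]

theorem sum_pmf_eq_one {α : Type*} [Fintype α] (p : PMF α) : ∑ a, p a = 1 := by
  rw [← tsum_fintype (L := .unconditional _), p.tsum_coe]

theorem TwoUniversal.sum_toReal (G : TwoUniversal Z 𝒦 𝓖) : ∑ g, (G.dist g).toReal = 1 := by
  rw [← ENNReal.toReal_sum fun g _ => G.dist.apply_ne_top g, sum_pmf_eq_one,
    ENNReal.toReal_one]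

theorem TwoUniversal.collision_le (G : TwoUniversal Z 𝒦 𝓖) {z z' : Z} (h : z ≠ z') :
    ∑ g, (G.dist g).toReal * (if G.hash g z = G.hash g z' then 1 else 0) ≤
      (Fintype.card 𝒦 : ℝ)⁻¹ := by
  rcases isEmpty_or_nonempty 𝒦 with h𝒦 | h𝒦
  · have : IsEmpty 𝓖 := ⟨fun g => h𝒦.elim (G.hash g z)⟩
    simp
  have h1 := G.two_universal z z' h
  have h2 : (∑ g, (if G.hash g z = G.hash g z' then G.dist g else 0)).toReal ≤
      ((Fintype.card 𝒦 : ℝ≥0∞)⁻¹).toReal :=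
    ENNReal.toReal_mono (by simp) h1
  rw [ENNReal.toReal_sum fun g _ => by split_ifs <;> simp [G.dist.apply_ne_top]] at h2
  simp only [ENNReal.toReal_inv, ENNReal.toReal_natCast] at h2
  refine le_trans (le_of_eq (Finset.sum_congr rfl fun g _ => ?_)) h2
  split_ifs <;> simp

/-- Coefficient of `z` in the deviation of the hash value `k` from uniform. -/
noncomputable def TwoUniversal.deviation (G : TwoUniversal Z 𝒦 𝓖) (g : 𝓖) (k : 𝒦) (z : Z) : ℝ :=
  (if G.hash g z = k then 1 else 0) - (Fintype.card 𝒦 : ℝ)⁻¹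

/-- Two-universality says that the deviations from uniform of different raw keys are, on average,
not positively correlated. -/
theorem TwoUniversal.sum_deviation_mul_le [Nonempty 𝒦] (G : TwoUniversal Z 𝒦 𝓖) (z z' : Z) :
    ∑ g, (G.dist g).toReal * ∑ k, G.deviation g k z * G.deviation g k z' ≤
      if z = z' then 1 else 0 := by
  have hK : (Fintype.card 𝒦 : ℝ) ≠ 0 := by exact_mod_cast Fintype.card_ne_zero
  have h1 : ∀ g, ∑ k, G.deviation g k z * G.deviation g k z' =
      (if G.hash g z = G.hash g z' then 1 else 0) - (Fintype.card 𝒦 : ℝ)⁻¹ := by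
    intro g
    have : ∀ k, G.deviation g k z * G.deviation g k z' =
        (if G.hash g z = k then (if G.hash g z' = k then 1 else 0) else 0)
          - (Fintype.card 𝒦 : ℝ)⁻¹ * (if G.hash g z = k then 1 else 0)
          - (Fintype.card 𝒦 : ℝ)⁻¹ * (if G.hash g z' = k then 1 else 0)
          + (Fintype.card 𝒦 : ℝ)⁻¹ * (Fintype.card 𝒦 : ℝ)⁻¹ := by
      intro k
      unfold TwoUniversal.deviation
      split_ifs <;> ring
    simp only [this, Finset.sum_add_distrib, Finset.sum_sub_distrib, ← Finset.mul_sum,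
      Finset.sum_ite_eq, Finset.mem_univ, if_true, Finset.sum_const, Finset.card_univ,
      nsmul_eq_mul]
    rw [mul_inv_cancel₀ hK]
    simp only [eq_comm (a := G.hash g z')]
    ring
  simp only [h1, mul_sub, Finset.sum_sub_distrib, ← Finset.sum_mul, G.sum_toReal, one_mul]
  split_ifs with h
  · subst h
    simp [G.sum_toReal]
  · linarith [G.collision_le h]

/-- The second moment of the deviation from uniform. Nonnegativity of the inner products is needed
because two-universality bounds the collision probability from above only. -/
theorem TwoUniversal.sum_sq_norm_le [Nonempty 𝒦] (G : TwoUniversal Z 𝒦 𝓖) {V : Type*}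
    [NormedAddCommGroup V] [InnerProductSpace ℂ V] (v : Z → V)
    (hv : ∀ z z', 0 ≤ (⟪v z, v z'⟫_ℂ).re) :
    ∑ g, (G.dist g).toReal * ∑ k, ‖∑ z, (G.deviation g k z : ℂ) • v z‖ ^ 2 ≤ ∑ z, ‖v z‖ ^ 2 := by
  have h1 : ∀ g k, ‖∑ z, (G.deviation g k z : ℂ) • v z‖ ^ 2 =
      ∑ z, ∑ z', G.deviation g k z * G.deviation g k z' * (⟪v z, v z'⟫_ℂ).re := by
    intro g k
    rw [← inner_self_eq_norm_sq (𝕜 := ℂ), sum_inner, map_sum]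
    refine Finset.sum_congr rfl fun z _ => ?_
    rw [inner_sum, map_sum]
    refine Finset.sum_congr rfl fun z' _ => ?_
    rw [inner_smul_left, inner_smul_right, Complex.conj_ofReal, RCLike.re_to_complex,
      Complex.re_ofReal_mul, Complex.re_ofReal_mul, mul_assoc]
  calc ∑ g, (G.dist g).toReal * ∑ k, ‖∑ z, (G.deviation g k z : ℂ) • v z‖ ^ 2
      = ∑ z, ∑ z', (∑ g, (G.dist g).toReal * ∑ k, G.deviation g k z * G.deviation g k z') *
          (⟪v z, v z'⟫_ℂ).re := by
        simp only [h1, Finset.mul_sum, Finset.sum_mul]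
        rw [Finset.sum_congr rfl fun g _ => Finset.sum_comm]
        rw [Finset.sum_comm]
        refine Finset.sum_congr rfl fun z _ => ?_
        rw [Finset.sum_congr rfl fun g _ => Finset.sum_comm]
        rw [Finset.sum_comm]
        refine Finset.sum_congr rfl fun z' _ => ?_
        refine Finset.sum_congr rfl fun g _ => ?_
        refine Finset.sum_congr rfl fun k _ => ?_
        ring
    _ ≤ ∑ z, ∑ z', (if z = z' then 1 else 0) * (⟪v z, v z'⟫_ℂ).re := by
        gcongr with z _ z' _
        · exact hv z z'
        · exact G.sum_deviation_mul_le z z'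
    _ = ∑ z, ‖v z‖ ^ 2 := by
        refine Finset.sum_congr rfl fun z _ => ?_
        simp only [ite_mul, one_mul, zero_mul, Finset.sum_ite_eq, Finset.mem_univ, if_true]
        exact inner_self_eq_norm_sq (𝕜 := ℂ) _

/-- Leftover hashing against quantum side information: if `τ_z ≤ c σ` for all `z`, then the hash
value of a two-universal family is close to uniform. By `exists_sandwich` the deviation has the form
`σ^{1/4} D σ^{1/4}`, Hölder reduces it to the Hilbert--Schmidt norm of `D`, and
`TwoUniversal.sum_sq_norm_le` bounds the second moment of that. -/
theorem TwoUniversal.leftover_hashing [Nonempty 𝒦] (G : TwoUniversal Z 𝒦 𝓖)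
    {τ : Z → H →L[ℂ] H} (hτ : ∀ z, (τ z).IsPositive) (hτ' : ∀ z, trace (τ z) ≠ ∞)
    {σ : H →L[ℂ] H} (hσ : σ.IsPositive) {c : ℝ} (hc : 0 ≤ c) (h : ∀ z, τ z ≤ c • σ) :
    ∑ g, G.dist g * ∑ k, traceNorm (∑ z, G.deviation g k z • τ z) ≤
      (Fintype.card 𝒦 * ENNReal.ofReal c * ∑ z, trace (τ z)) ^ (1 / 2 : ℝ) *
        trace σ ^ (1 / 2 : ℝ) := by
  set R := CFC.sqrt (CFC.sqrt σ) with hRdef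
  have hR : R.adjoint = R := sqrt_isSelfAdjoint _
  have hRR : hs (R ∘L R) = trace σ := by
    rw [trace_eq_hs_sqrt hσ, hRdef, sqrt_comp_sqrt (isPositive_sqrt σ)]
  choose S hSpos hSeq hShs using fun z => exists_sandwich (hτ z) hσ hc (h z)
  have hSfin : ∀ z, hs (S z) ≠ ∞ := fun z =>
    ne_top_of_le_ne_top (ENNReal.mul_ne_top ENNReal.ofReal_ne_top (hτ' z)) (hShs z)
  let v : Z → lp (fun _ : BasisIndex H => H) 2 := fun z => hsVec (S z) (hSfin z)
  have hv : ∀ z z', 0 ≤ (⟪v z, v z'⟫_ℂ).re := fun z z' =>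
    re_inner_hsVec_nonneg (hSpos z) (hSpos z') _ _
  have hcomb : ∀ g k, hs (∑ z, G.deviation g k z • S z) =
      ENNReal.ofReal (‖∑ z, (G.deviation g k z : ℂ) • v z‖ ^ 2) := fun g k => by
    refine hs_eq_ofReal_of_coe_eq _ _ fun i => ?_
    have h1 : (∑ z, (G.deviation g k z : ℂ) • v z) i =
        ∑ z, ((G.deviation g k z : ℂ) • v z) i := by
      rw [lp.coeFn_sum, Finset.sum_apply]
    rw [h1, sum_apply]
    refine Finset.sum_congr rfl fun z _ => ?_
    change G.deviation g k z • S z _ = (G.deviation g k z : ℂ) • S z _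
    simp
  have hbound : ∑ g, ∑ k, G.dist g * hs (∑ z, G.deviation g k z • S z) ≤
      ENNReal.ofReal c * ∑ z, trace (τ z) := by
    calc ∑ g, ∑ k, G.dist g * hs (∑ z, G.deviation g k z • S z)
        = ENNReal.ofReal (∑ g, (G.dist g).toReal *
            ∑ k, ‖∑ z, (G.deviation g k z : ℂ) • v z‖ ^ 2) := by
          rw [ENNReal.ofReal_sum_of_nonneg fun g _ => by positivity]
          refine Finset.sum_congr rfl fun g _ => ?_
          rw [ENNReal.ofReal_mul ENNReal.toReal_nonneg, ENNReal.ofReal_toReal (G.dist.apply_ne_top g),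
            ENNReal.ofReal_sum_of_nonneg fun k _ => by positivity, Finset.mul_sum]
          simp only [hcomb]
      _ ≤ ENNReal.ofReal (∑ z, ‖v z‖ ^ 2) := ENNReal.ofReal_le_ofReal (G.sum_sq_norm_le v hv)
      _ = ∑ z, hs (S z) := by
          rw [ENNReal.ofReal_sum_of_nonneg fun z _ => by positivity]
          exact Finset.sum_congr rfl fun z _ => ofReal_sq_norm_hsVec _ _
      _ ≤ _ := by
          rw [Finset.mul_sum]
          exact Finset.sum_le_sum fun z _ => hShs z
  have hfac : ∀ g k, traceNorm (∑ z, G.deviation g k z • τ z) ≤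
      hs (∑ z, G.deviation g k z • S z) ^ (1 / 2 : ℝ) * trace σ ^ (1 / 2 : ℝ) := fun g k => by
    have h1 : ∑ z, G.deviation g k z • τ z = R ∘L (∑ z, G.deviation g k z • S z) ∘L R := by
      ext x
      simp only [ContinuousLinearMap.comp_apply, sum_apply, smul_apply, map_sum,
        ContinuousLinearMap.map_smul_of_tower]
      refine Finset.sum_congr rfl fun z _ => ?_
      rw [hSeq z]; rfl
    rw [h1, ← hRR]
    refine traceNorm_conj_le_hs R _ hR ?_
    rw [map_sum]
    refine Finset.sum_congr rfl fun z _ => ?_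
    exact ((IsSelfAdjoint.all (G.deviation g k z)).smul (hSpos z).isSelfAdjoint).star_eq
  calc ∑ g, G.dist g * ∑ k, traceNorm (∑ z, G.deviation g k z • τ z)
      ≤ ∑ g, ∑ k, (G.dist g ^ (1 / 2 : ℝ) *
          (G.dist g * hs (∑ z, G.deviation g k z • S z)) ^ (1 / 2 : ℝ)) *
            trace σ ^ (1 / 2 : ℝ) := by
        refine Finset.sum_le_sum fun g _ => ?_
        rw [Finset.mul_sum]
        refine Finset.sum_le_sum fun k _ => ?_
        rw [ENNReal.mul_rpow_of_nonneg _ _ (by norm_num), ← mul_assoc, sqrt_mul_sqrt_self, mul_assoc]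
        gcongr
        exact hfac g k
    _ = (∑ x : 𝓖 × 𝒦, G.dist x.1 ^ (1 / 2 : ℝ) *
          (G.dist x.1 * hs (∑ z, G.deviation x.1 x.2 z • S z)) ^ (1 / 2 : ℝ)) *
            trace σ ^ (1 / 2 : ℝ) := by
        rw [Fintype.sum_prod_type, Finset.sum_mul]
        simp only [Finset.sum_mul]
    _ ≤ ((∑ x : 𝓖 × 𝒦, G.dist x.1) ^ (1 / 2 : ℝ) *
          (∑ x : 𝓖 × 𝒦, G.dist x.1 * hs (∑ z, G.deviation x.1 x.2 z • S z)) ^ (1 / 2 : ℝ)) *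
            trace σ ^ (1 / 2 : ℝ) := by
        gcongr
        exact sum_sqrt_mul_sqrt_le _ _ _
    _ ≤ _ := by
        rw [← ENNReal.mul_rpow_of_nonneg _ _ (by norm_num), Fintype.sum_prod_type,
          Fintype.sum_prod_type, mul_assoc]
        refine mul_le_mul' (ENNReal.rpow_le_rpow (mul_le_mul' (le_of_eq ?_) hbound)
          (by norm_num)) le_rfl
        simp only [Finset.sum_const, Finset.card_univ, nsmul_eq_mul, ← Finset.mul_sum]
        rw [sum_pmf_eq_one, mul_one]

end LeftoverHashing

/-! ### Extensions of nearby states -/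

section Extension

variable {H : Type*} [NormedAddCommGroup H] [InnerProductSpace ℂ H] [CompleteSpace H]
variable {K : Type*} [NormedAddCommGroup K] [InnerProductSpace ℂ K] [CompleteSpace K]
variable {X Y : Type*} [Fintype X] [Fintype Y]

/-- Pinching does not increase the trace norm. -/
theorem sum_traceNorm_coord_le (T : Reg X H →L[ℂ] Reg X H) :
    ∑ x, traceNorm (coord H x ∘L T ∘L (coord H x).adjoint) ≤ traceNorm T := by
  obtain ⟨A, B, hT, hA, hB⟩ := exists_eq_adjoint_comp T
  calc ∑ x, traceNorm (coord H x ∘L T ∘L (coord H x).adjoint)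
      ≤ ∑ x, hs (A ∘L (coord H x).adjoint) ^ (1 / 2 : ℝ) *
          hs (B ∘L (coord H x).adjoint) ^ (1 / 2 : ℝ) := by
        refine Finset.sum_le_sum fun x _ => ?_
        have h : coord H x ∘L T ∘L (coord H x).adjoint =
            (A ∘L (coord H x).adjoint).adjoint ∘L (B ∘L (coord H x).adjoint) := by
          rw [hT, ContinuousLinearMap.adjoint_comp, ContinuousLinearMap.adjoint_adjoint]; rfl
        rw [h]
        exact traceNorm_adjoint_comp_le _ _
    _ ≤ _ := sum_sqrt_mul_sqrt_le _ _ _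
    _ ≤ traceNorm T ^ (1 / 2 : ℝ) * traceNorm T ^ (1 / 2 : ℝ) := by
        rw [sum_hs_comp_coord_adjoint, sum_hs_comp_coord_adjoint]
        gcongr
    _ = traceNorm T := sqrt_mul_sqrt_self _

theorem sum_hs_coord_comp (A : H →L[ℂ] Reg X K) : ∑ x, hs (coord K x ∘L A) = hs A := by
  unfold hs
  rw [← Summable.tsum_finsetSum fun _ _ => ENNReal.summable]
  refine tsum_congr fun i => ?_
  rw [← ENNReal.ofReal_sum_of_nonneg fun _ _ => by positivity, sq_norm_reg]
  rfl

theorem hasSum_re_inner {T : H →L[ℂ] H} (hT : T.IsPositive) (h : trace T ≠ ∞) :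
    HasSum (fun i => (⟪basis H i, T (basis H i)⟫_ℂ).re) (trace T).toReal := by
  have h1 := ENNReal.hasSum_toReal h
  simp only [ENNReal.toReal_ofReal (re_inner_nonneg hT _)] at h1
  rwa [trace, ENNReal.tsum_toReal_eq fun i => ENNReal.ofReal_ne_top,
    tsum_congr fun i => ENNReal.toReal_ofReal (re_inner_nonneg hT _)]

theorem hasSum_sq_norm (A : H →L[ℂ] K) (h : hs A ≠ ∞) :
    HasSum (fun i => ‖A (basis H i)‖ ^ 2) (hs A).toReal := by
  have h1 := ENNReal.hasSum_toReal h
  simp only [ENNReal.toReal_ofReal (sq_nonneg _)] at h1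
  rwa [hs, ENNReal.tsum_toReal_eq fun i => ENNReal.ofReal_ne_top,
    tsum_congr fun i => ENNReal.toReal_ofReal (sq_nonneg _)]

/-- The identity `a† a - b† b = ½ ((a - b)† (a + b) + (a + b)† (a - b))` with Hölder. -/
theorem traceNorm_sub_adjoint_comp_le (a b : H →L[ℂ] K) :
    traceNorm (a.adjoint ∘L a - b.adjoint ∘L b) ≤
      hs (a - b) ^ (1 / 2 : ℝ) * hs (a + b) ^ (1 / 2 : ℝ) := by
  have h : a.adjoint ∘L a - b.adjoint ∘L b =
      (1 / 2 : ℝ) • ((a - b).adjoint ∘L (a + b) + (a + b).adjoint ∘L (a - b)) := by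
    ext x
    simp only [map_sub, map_add, sub_apply, add_apply, smul_apply, ContinuousLinearMap.comp_apply]
    module
  rw [h]
  refine (traceNorm_smul_le (by norm_num) _).trans ?_
  have h1 : traceNorm ((a - b).adjoint ∘L (a + b) + (a + b).adjoint ∘L (a - b)) ≤
      2 * (hs (a - b) ^ (1 / 2 : ℝ) * hs (a + b) ^ (1 / 2 : ℝ)) := by
    refine (traceNorm_add_le _ _).trans ?_
    rw [two_mul]
    refine add_le_add (traceNorm_adjoint_comp_le _ _) ?_
    rw [mul_comm]
    exact traceNorm_adjoint_comp_le _ _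
  calc _ ≤ ENNReal.ofReal (1 / 2) *
        (2 * (hs (a - b) ^ (1 / 2 : ℝ) * hs (a + b) ^ (1 / 2 : ℝ))) := by gcongr
    _ = _ := by
        rw [← mul_assoc, show (2 : ℝ≥0∞) = ENNReal.ofReal 2 by simp,
          ← ENNReal.ofReal_mul (by norm_num)]
        norm_num

/-- The real inequality behind `½ ‖ρ - τ‖₁ ≤ P(ρ, τ)` for subnormalised states of traces `a`
and `b`, where `f = Tr |√ρ √τ|`. -/
theorem mul_le_four_mul_one_sub_sq {a b f : ℝ} (ha : a ≤ 1) (hb : b ≤ 1)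
    (h0 : 0 ≤ a + b - 2 * f) (hf : 0 ≤ f) :
    (a + b - 2 * f) * (a + b + 2 * f) ≤
      4 * (1 - (f + Real.sqrt ((1 - a) * (1 - b))) ^ 2) := by
  set g := Real.sqrt ((1 - a) * (1 - b)) with hg
  have hg0 : 0 ≤ g := Real.sqrt_nonneg _
  have hg2 : g ^ 2 = (1 - a) * (1 - b) :=
    Real.sq_sqrt (mul_nonneg (by linarith) (by linarith))
  have h1 : 2 * g ≤ 2 - a - b := by
    refine abs_le_of_sq_le_sq' ?_ (by linarith) |>.2
    nlinarith [sq_nonneg (a - b)]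
  have h2 : (a + b - 2 * f) * (a + b + 2 * f) ≤ (2 - 2 * g - 2 * f) * (2 + 2 * g + 2 * f) :=
    mul_le_mul (by linarith) (by linarith) (by linarith) (by linarith)
  nlinarith

/-- An Uhlmann purification: writing `√ρ` as a purification of `ρ`, there is a purification
`q = W √τ` of (a part of) `τ` whose overlap with `√ρ` is `Tr |√τ √ρ|`. Here `W` comes from the polar
decomposition of `√τ √ρ`, and it is only a contraction, so `q† q ≤ τ`. The norms of `√ρ ± q` are
stated through the sign `t = ±1`. -/
theorem hs_add_smul_le {ρ τ : H →L[ℂ] H} (hρ : ρ.IsPositive) (hρ1 : trace ρ ≤ 1)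
    (hτ : τ.IsPositive) (hτ1 : trace τ ≤ 1) :
    traceNorm (CFC.sqrt τ * CFC.sqrt ρ) ≠ ∞ ∧
    ∃ q : H →L[ℂ] H, q.adjoint ∘L q ≤ τ ∧ hs q ≤ trace τ ∧
      (∀ t : ℝ, t ^ 2 = 1 → 0 ≤ (trace ρ).toReal + (trace τ).toReal +
        2 * t * (traceNorm (CFC.sqrt τ * CFC.sqrt ρ)).toReal ∧
        hs (CFC.sqrt ρ + (t : ℂ) • q) ≤ ENNReal.ofReal ((trace ρ).toReal + (trace τ).toReal +
        2 * t * (traceNorm (CFC.sqrt τ * CFC.sqrt ρ)).toReal)) := by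
  set p := CFC.sqrt ρ with hp
  have hpadj : p.adjoint = p := sqrt_isSelfAdjoint ρ
  have hhp : hs p = trace ρ := (trace_eq_hs_sqrt hρ).symm
  have hhτ : hs (CFC.sqrt τ) = trace τ := (trace_eq_hs_sqrt hτ).symm
  have hρt : trace ρ ≠ ∞ := ne_top_of_le_ne_top ENNReal.one_ne_top hρ1
  have hτt : trace τ ≠ ∞ := ne_top_of_le_ne_top ENNReal.one_ne_top hτ1
  have hft : traceNorm (CFC.sqrt τ * p) ≠ ∞ := by
    have h1 := traceNorm_adjoint_comp_le (CFC.sqrt τ) p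
    rw [sqrt_isSelfAdjoint, hhτ, hhp] at h1
    refine ne_top_of_le_ne_top (ENNReal.mul_ne_top ?_ ?_) h1
    · exact ENNReal.rpow_ne_top_of_nonneg (by norm_num) hτt
    · exact ENNReal.rpow_ne_top_of_nonneg (by norm_num) hρt
  refine ⟨hft, ?_⟩
  obtain ⟨⟨W, hW, hWeq⟩, -⟩ := exists_abs_eq (CFC.sqrt τ * p)
  have hpos : (CFC.abs (CFC.sqrt τ * p)).IsPositive :=
    (ContinuousLinearMap.nonneg_iff_isPositive _).1 (CFC.abs_nonneg _)
  have hq : hs (W ∘L CFC.sqrt τ) ≤ trace τ := by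
    rw [← hhτ]; exact hs_comp_le_left W hW _
  refine ⟨W ∘L CFC.sqrt τ, ?_, hq, ?_⟩
  · rw [ContinuousLinearMap.le_def]
    refine ContinuousLinearMap.isPositive_def'.2 ⟨?_, fun x => ?_⟩
    · exact hτ.isSelfAdjoint.sub
        (ContinuousLinearMap.isPositive_adjoint_comp_self (W ∘L CFC.sqrt τ)).isSelfAdjoint
    · rw [ContinuousLinearMap.reApplyInnerSelf_apply, inner_re_symm, RCLike.re_to_complex,
        sub_apply, inner_sub_right, Complex.sub_re, inner_adjoint_comp_self, ← sq_norm_sqrt hτ,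
        sub_nonneg]
      have : ‖(W ∘L CFC.sqrt τ) x‖ ≤ ‖CFC.sqrt τ x‖ :=
        (W.le_of_opNorm_le hW _).trans_eq (one_mul _)
      gcongr
  · intro t ht
    set q := W ∘L CFC.sqrt τ with hqdef
    have hqt : hs q ≠ ∞ := ne_top_of_le_ne_top hτt hq
    have hsum := ((hasSum_sq_norm p (by rwa [hhp])).add
      (hasSum_sq_norm q.adjoint (by rwa [hs_adjoint]))).add
      ((hasSum_re_inner hpos hft).mul_left (2 * t))
    have hterm : ∀ x, ‖p x‖ ^ 2 + ‖q.adjoint x‖ ^ 2 +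
        2 * t * (⟪x, CFC.abs (CFC.sqrt τ * p) x⟫_ℂ).re = ‖(p + (t : ℂ) • q.adjoint) x‖ ^ 2 := by
      intro x
      have h1 : ⟪x, CFC.abs (CFC.sqrt τ * p) x⟫_ℂ = ⟪q.adjoint x, p x⟫_ℂ := by
        rw [ContinuousLinearMap.adjoint_inner_left, hWeq]; rfl
      have h2 : (⟪q.adjoint x, p x⟫_ℂ).re = (⟪p x, q.adjoint x⟫_ℂ).re :=
        inner_re_symm (𝕜 := ℂ) _ _
      rw [h1, h2, add_apply, smul_apply, @norm_add_sq ℂ, inner_smul_right, norm_smul,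
        RCLike.re_to_complex, Complex.re_ofReal_mul, Complex.norm_real, mul_pow,
        Real.norm_eq_abs, sq_abs, ht]
      ring
    simp only [hterm] at hsum
    rw [hhp, hs_adjoint,
      show trace (CFC.abs (CFC.sqrt τ * p)) = traceNorm (CFC.sqrt τ * p) from rfl] at hsum
    have hadj : hs (p + (t : ℂ) • q) = hs (p + (t : ℂ) • q.adjoint) := by
      rw [← hs_adjoint (p + (t : ℂ) • q), map_add, hpadj, map_smulₛₗ, Complex.conj_ofReal]
    have hle : (hs q).toReal ≤ (trace τ).toReal := ENNReal.toReal_mono hτt hq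
    have hge := hsum.nonneg fun i => by positivity
    refine ⟨by linarith, ?_⟩
    rw [hadj, hs, ← ENNReal.ofReal_tsum_of_nonneg (fun _ => by positivity) hsum.summable,
      hsum.tsum_eq]
    exact ENNReal.ofReal_le_ofReal (by linarith)

/-- An extension of a nearby state: if `τ` has purified distance at most `ε` from `ρ = ∑ l, ρ l`,
then `τ` dominates operators `τ' l` that are jointly `2 ε`-close to the `ρ l` in trace norm. Some
contraction `C` maps `√ρ` to the family `√(ρ l)`; applied to the Uhlmann purification of `τ` it
yields the `τ' l`. -/
theorem exists_extension {ρ : Y → H →L[ℂ] H} (hρ : ∀ l, (ρ l).IsPositive)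
    (hρ1 : trace (∑ l, ρ l) ≤ 1) {τ : H →L[ℂ] H} (hτ : τ ∈ SubState H) {ε : ℝ} (hε : 0 ≤ ε)
    (h : purifiedDist τ (∑ l, ρ l) ≤ ε) :
    ∃ τ' : Y → H →L[ℂ] H, (∀ l, (τ' l).IsPositive) ∧ (∀ l, τ' l ≤ τ) ∧
      ∑ l, trace (τ' l) ≤ 1 ∧ ∑ l, traceNorm (ρ l - τ' l) ≤ ENNReal.ofReal (2 * ε) := by
  have hρpos : (∑ l, ρ l).IsPositive := ContinuousLinearMap.isPositive_sum _ fun l _ => hρ l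
  obtain ⟨hft, q, hqτ, hqt, hbd⟩ := hs_add_smul_le hρpos hρ1 hτ.1 hτ.2
  set p := CFC.sqrt (∑ l, ρ l) with hp
  let A : H →L[ℂ] Reg Y H := ∑ l, (coord H l).adjoint ∘L CFC.sqrt (ρ l)
  have hA : ∀ l, coord H l ∘L A = CFC.sqrt (ρ l) := fun l => by
    ext x
    simp only [A, ContinuousLinearMap.comp_apply, sum_apply, map_sum, coord_adjoint_apply]
    simp
  have hAn : ∀ x, ‖A x‖ = ‖p x‖ := fun x => by
    refine (sq_eq_sq₀ (norm_nonneg _) (norm_nonneg _)).1 ?_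
    rw [sq_norm_reg, hp, sq_norm_sqrt hρpos, sum_apply (f := ρ), inner_sum, Complex.re_sum]
    refine Finset.sum_congr rfl fun l _ => ?_
    rw [← sq_norm_sqrt (hρ l), ← hA l]; rfl
  obtain ⟨C, hC, hCeq⟩ := exists_contraction_comp_eq A p fun x => (hAn x).le
  have hCl : ∀ l, coord H l ∘L C ∘L p = CFC.sqrt (ρ l) := fun l => by rw [← hCeq, hA]
  have hsumC : ∀ B : H →L[ℂ] H, ∑ l, hs (coord H l ∘L C ∘L B) ≤ hs B := fun B => by
    rw [sum_hs_coord_comp]; exact hs_comp_le_left C hC B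
  have hcl : ∀ l, ‖coord H l ∘L C‖ ≤ 1 := fun l =>
    (ContinuousLinearMap.opNorm_comp_le _ _).trans
      (mul_le_one₀ (norm_coord_le l) (norm_nonneg _) hC)
  refine ⟨fun l => (coord H l ∘L C ∘L q).adjoint ∘L (coord H l ∘L C ∘L q),
    fun l => ContinuousLinearMap.isPositive_adjoint_comp_self _, fun l => ?_, ?_, ?_⟩
  · refine le_trans ?_ hqτ
    rw [ContinuousLinearMap.le_def]
    refine ContinuousLinearMap.isPositive_def'.2 ⟨?_, fun x => ?_⟩
    · exact (ContinuousLinearMap.isPositive_adjoint_comp_self _).isSelfAdjoint.sub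
        (ContinuousLinearMap.isPositive_adjoint_comp_self _).isSelfAdjoint
    · rw [ContinuousLinearMap.reApplyInnerSelf_apply, inner_re_symm, RCLike.re_to_complex,
        sub_apply, inner_sub_right, Complex.sub_re, inner_adjoint_comp_self,
        inner_adjoint_comp_self, sub_nonneg]
      have : ‖(coord H l ∘L C ∘L q) x‖ ≤ ‖q x‖ :=
        ((coord H l ∘L C).le_of_opNorm_le (hcl l) _).trans_eq (one_mul _)
      gcongr
  · simp only [trace_adjoint_comp]
    exact (hsumC q).trans (hqt.trans hτ.2)
  · set a := (trace (∑ l, ρ l)).toReal with ha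
    set b := (trace τ).toReal with hb
    set f := (traceNorm (CFC.sqrt τ * p)).toReal with hf
    have ha1 : a ≤ 1 := by
      simpa using ENNReal.toReal_mono ENNReal.one_ne_top hρ1
    have hb1 : b ≤ 1 := by
      simpa using ENNReal.toReal_mono ENNReal.one_ne_top hτ.2
    obtain ⟨hm0, hm⟩ := hbd (-1) (by norm_num)
    obtain ⟨hp0, hpl⟩ := hbd 1 (by norm_num)
    have hm' : hs (p - q) ≤ ENNReal.ofReal (a + b - 2 * f) := by
      convert hm using 2
      · simp [sub_eq_add_neg]
      · ring
    have hp' : hs (p + q) ≤ ENNReal.ofReal (a + b + 2 * f) := by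
      convert hpl using 2
      · simp
      · ring
    have hm0' : 0 ≤ a + b - 2 * f := by linarith
    have hfin : (a + b - 2 * f) * (a + b + 2 * f) ≤ (2 * ε) ^ 2 := by
      refine (mul_le_four_mul_one_sub_sq ha1 hb1 hm0' ENNReal.toReal_nonneg).trans ?_
      have h1 : 1 - fidelity τ (∑ l, ρ l) ≤ ε ^ 2 := (Real.sqrt_le_left hε).1 h
      unfold fidelity at h1
      rw [mul_comm (1 - (trace τ).toReal)] at h1
      linarith
    calc ∑ l, traceNorm (ρ l - (coord H l ∘L C ∘L q).adjoint ∘L (coord H l ∘L C ∘L q))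
        ≤ ∑ l, hs (coord H l ∘L C ∘L (p - q)) ^ (1 / 2 : ℝ) *
            hs (coord H l ∘L C ∘L (p + q)) ^ (1 / 2 : ℝ) := by
          refine Finset.sum_le_sum fun l _ => ?_
          have h1 : ρ l = (coord H l ∘L C ∘L p).adjoint ∘L (coord H l ∘L C ∘L p) := by
            rw [hCl, sqrt_isSelfAdjoint, sqrt_comp_sqrt (hρ l)]
          rw [h1]
          refine (traceNorm_sub_adjoint_comp_le _ _).trans_eq ?_
          simp only [ContinuousLinearMap.comp_add, ContinuousLinearMap.comp_sub]
      _ ≤ _ := sum_sqrt_mul_sqrt_le _ _ _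
      _ ≤ ENNReal.ofReal (a + b - 2 * f) ^ (1 / 2 : ℝ) *
            ENNReal.ofReal (a + b + 2 * f) ^ (1 / 2 : ℝ) := by
          gcongr
          · exact (hsumC _).trans hm'
          · exact (hsumC _).trans hp'
      _ = ENNReal.ofReal ((a + b - 2 * f) * (a + b + 2 * f)) ^ (1 / 2 : ℝ) := by
          rw [ENNReal.ofReal_mul hm0', ENNReal.mul_rpow_of_nonneg _ _ (by norm_num)]
      _ ≤ ENNReal.ofReal ((2 * ε) ^ 2) ^ (1 / 2 : ℝ) := by gcongr
      _ = ENNReal.ofReal (2 * ε) := (ofReal_eq_sqrt_sq (by positivity)).symm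

end Extension

/-! ### Leftover hashing for a smoothed state with classical side information -/

section SmoothLeftoverHashing

variable {H : Type*} [NormedAddCommGroup H] [InnerProductSpace ℂ H] [CompleteSpace H]
variable {Z S Y 𝒦 𝓖 : Type*} [Fintype Z] [Fintype S] [Fintype Y] [Fintype 𝒦] [Fintype 𝓖]

theorem blockDiag_sum (ρ : Y → Z → H →L[ℂ] H) :
    ∑ l, blockDiag (ρ l) = blockDiag fun z => ∑ l, ρ l z := by
  simp only [blockDiag_eq]
  rw [Finset.sum_comm]
  refine Finset.sum_congr rfl fun z _ => ?_
  ext1 x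
  simp only [sum_apply, ContinuousLinearMap.comp_apply, map_sum]

theorem blockDiag_sub (ρ σ : Z → H →L[ℂ] H) :
    blockDiag ρ - blockDiag σ = blockDiag fun z => ρ z - σ z := by
  simp only [blockDiag_eq, ← Finset.sum_sub_distrib]
  refine Finset.sum_congr rfl fun z _ => ?_
  ext1 x
  simp only [sub_apply, ContinuousLinearMap.comp_apply, map_sub]

theorem traceNorm_smul_le_abs (c : ℝ) (T : H →L[ℂ] H) :
    traceNorm (c • T) ≤ ENNReal.ofReal |c| * traceNorm T := by
  rcases abs_choice c with h | h
  · rw [h]; exact traceNorm_smul_le (h ▸ abs_nonneg c) T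
  · rw [h, ← traceNorm_neg (c • T), ← neg_smul]
    exact traceNorm_smul_le (h ▸ abs_nonneg c) T

theorem TwoUniversal.sum_abs_deviation_le [Nonempty 𝒦] (G : TwoUniversal Z 𝒦 𝓖) (g : 𝓖) (z : Z) :
    ∑ k, |G.deviation g k z| ≤ 2 := by
  have hK : (Fintype.card 𝒦 : ℝ) ≠ 0 := by exact_mod_cast Fintype.card_ne_zero
  calc ∑ k, |G.deviation g k z|
      ≤ ∑ k, ((if G.hash g z = k then 1 else 0) + (Fintype.card 𝒦 : ℝ)⁻¹) := by
        refine Finset.sum_le_sum fun k _ => ?_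
        refine (abs_sub _ _).trans_eq ?_
        rw [abs_of_nonneg (by split_ifs <;> norm_num), abs_of_nonneg (by positivity)]
    _ = 2 := by
        simp only [Finset.sum_add_distrib, Finset.sum_ite_eq, Finset.mem_univ, if_true,
          Finset.sum_const, Finset.card_univ, nsmul_eq_mul]
        rw [mul_inv_cancel₀ hK]
        norm_num

theorem TwoUniversal.sum_traceNorm_deviation_le [Nonempty 𝒦] (G : TwoUniversal Z 𝒦 𝓖)
    (T : Z → H →L[ℂ] H) (g : 𝓖) :
    ∑ k, traceNorm (∑ z, G.deviation g k z • T z) ≤ 2 * ∑ z, traceNorm (T z) := by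
  calc ∑ k, traceNorm (∑ z, G.deviation g k z • T z)
      ≤ ∑ k, ∑ z, ENNReal.ofReal |G.deviation g k z| * traceNorm (T z) := by
        refine Finset.sum_le_sum fun k _ => (traceNorm_sum_le _ _).trans ?_
        exact Finset.sum_le_sum fun z _ => traceNorm_smul_le_abs _ _
    _ = ∑ z, ENNReal.ofReal (∑ k, |G.deviation g k z|) * traceNorm (T z) := by
        rw [Finset.sum_comm]
        refine Finset.sum_congr rfl fun z _ => ?_
        rw [ENNReal.ofReal_sum_of_nonneg fun _ _ => abs_nonneg _, Finset.sum_mul]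
    _ ≤ ∑ z, 2 * traceNorm (T z) := by
        gcongr with z _
        exact (ENNReal.ofReal_le_ofReal (G.sum_abs_deviation_le g z)).trans_eq (by simp)
    _ = _ := by rw [Finset.mul_sum]

/-- Leftover hashing in terms of a state near the given one, with side information consisting of a
classical register `S`, a further classical register `Y` on which the nearby state is not
conditioned and which costs a factor `|Y|`, and a quantum system. Smoothing costs `4 ε`: the
extension of the nearby state is `2 ε`-close, and hashing and subtracting the uniform part at most
doubles the distance. -/
theorem TwoUniversal.leftover_hashing_of_purifiedDist_le [Nonempty 𝒦] (G : TwoUniversal Z 𝒦 𝓖)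
    {ω : Z → S → Y → H →L[ℂ] H} (hω : ∀ z s l, (ω z s l).IsPositive)
    (hω1 : ∑ z, ∑ s, ∑ l, trace (ω z s l) ≤ 1)
    {τ : Reg Z (Reg S H) →L[ℂ] Reg Z (Reg S H)} (hτ : τ ∈ SubState (Reg Z (Reg S H)))
    {ε : ℝ} (hε : 0 ≤ ε)
    (hdist : purifiedDist τ (blockDiag fun z => blockDiag fun s => ∑ l, ω z s l) ≤ ε)
    {σ : Reg S H →L[ℂ] Reg S H} (hσ : σ ∈ SubState (Reg S H)) {c : ℝ} (hc : 0 ≤ c)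
    (hτσ : τ ≤ c • blockDiag fun _ : Z => σ) :
    ∑ s, ∑ l, ∑ g, G.dist g * ∑ k, traceNorm (∑ z, G.deviation g k z • ω z s l) ≤
      ENNReal.ofReal (4 * ε) +
        (Fintype.card 𝒦 * ENNReal.ofReal c * Fintype.card Y) ^ (1 / 2 : ℝ) := by
  let T : Y → Reg Z (Reg S H) →L[ℂ] Reg Z (Reg S H) := fun l =>
    blockDiag fun z => blockDiag fun s => ω z s l
  have hT : ∀ l, (T l).IsPositive := fun l =>
    isPositive_blockDiag fun z => isPositive_blockDiag fun s => hω z s l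
  have hTsum : ∑ l, T l = blockDiag fun z => blockDiag fun s => ∑ l, ω z s l := by
    simp only [T, blockDiag_sum]
  have hT1 : trace (∑ l, T l) ≤ 1 := by
    rw [trace_sum _ hT]
    refine le_trans ?_ hω1
    calc ∑ l, trace (T l) ≤ ∑ l, ∑ z, ∑ s, trace (ω z s l) := by
          refine Finset.sum_le_sum fun l _ => ?_
          refine (trace_blockDiag_le fun z => isPositive_blockDiag fun s => hω z s l).trans ?_
          exact Finset.sum_le_sum fun z _ => trace_blockDiag_le fun s => hω z s l
      _ = _ := by
          rw [Finset.sum_comm]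
          exact Finset.sum_congr rfl fun z _ => Finset.sum_comm
  rw [← hTsum] at hdist
  obtain ⟨τ', hτ'pos, hτ'le, hτ'1, hτ'd⟩ := exists_extension hT hT1 hτ hε hdist
  -- the block `|z⟩⟨z| ⊗ |s⟩⟨s|` of an operator
  let blk (z : Z) (s : S) (A : Reg Z (Reg S H) →L[ℂ] Reg Z (Reg S H)) : H →L[ℂ] H :=
    coord H s ∘L (coord (Reg S H) z ∘L A ∘L (coord (Reg S H) z).adjoint) ∘L (coord H s).adjoint
  have hblkpos : ∀ z s A, A.IsPositive → (blk z s A).IsPositive := fun z s A hA =>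
    (hA.conj_adjoint (coord (Reg S H) z)).conj_adjoint (coord H s)
  have hblksub : ∀ z s A B, blk z s (A - B) = blk z s A - blk z s B := fun z s A B => by
    ext1 x
    simp only [blk, ContinuousLinearMap.comp_apply, sub_apply, map_sub]
  have hblkT : ∀ z s l, blk z s (T l) = ω z s l := fun z s l => by
    simp only [blk, T, coord_comp_blockDiag]
  let t : Z → S → Y → H →L[ℂ] H := fun z s l => blk z s (τ' l)
  let σs : S → H →L[ℂ] H := fun s => coord H s ∘L σ ∘L (coord H s).adjoint
  have htpos : ∀ z s l, (t z s l).IsPositive := fun z s l => hblkpos z s _ (hτ'pos l)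
  have hσspos : ∀ s, (σs s).IsPositive := fun s => hσ.1.conj_adjoint (coord H s)
  have htσ : ∀ z s l, t z s l ≤ c • σs s := fun z s l => by
    have h1 : τ' l ≤ c • blockDiag fun _ : Z => σ := (hτ'le l).trans hτσ
    have h2 := hblkpos z s _ ((ContinuousLinearMap.le_def _ _).1 h1)
    rw [hblksub] at h2
    rw [ContinuousLinearMap.le_def]
    convert h2 using 2
    have h3 : blk z s (c • blockDiag fun _ : Z => σ) = c • blk z s (blockDiag fun _ : Z => σ) := by
      ext1 x
      simp only [blk, ContinuousLinearMap.comp_apply, smul_apply,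
        ContinuousLinearMap.map_smul_of_tower]
    rw [h3]
    simp only [blk, coord_comp_blockDiag, σs]
  have htr : ∑ l, ∑ s, ∑ z, trace (t z s l) ≤ 1 := by
    refine le_trans (le_of_eq ?_) hτ'1
    refine Finset.sum_congr rfl fun l _ => ?_
    rw [Finset.sum_comm, ← sum_trace_coord (hτ'pos l)]
    refine Finset.sum_congr rfl fun z _ => ?_
    rw [← sum_trace_coord ((hτ'pos l).conj_adjoint (coord (Reg S H) z))]
  have htfin : ∀ z s l, trace (t z s l) ≠ ∞ := fun z s l => by
    refine ne_top_of_le_ne_top ENNReal.one_ne_top (le_trans ?_ htr)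
    refine le_trans ?_ (Finset.single_le_sum (f := fun l => ∑ s, ∑ z, trace (t z s l))
      (fun _ _ => zero_le) (Finset.mem_univ l))
    refine le_trans ?_ (Finset.single_le_sum (f := fun s => ∑ z, trace (t z s l))
      (fun _ _ => zero_le) (Finset.mem_univ s))
    exact Finset.single_le_sum (f := fun z => trace (t z s l))
      (fun _ _ => zero_le) (Finset.mem_univ z)
  have hdiff : ∑ s, ∑ l, ∑ z, traceNorm (ω z s l - t z s l) ≤ ENNReal.ofReal (2 * ε) := by
    refine le_trans ?_ hτ'd
    rw [Finset.sum_comm]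
    refine Finset.sum_le_sum fun l _ => ?_
    rw [Finset.sum_comm]
    refine le_trans ?_ (sum_traceNorm_coord_le _)
    refine Finset.sum_le_sum fun z _ => ?_
    refine le_trans (le_of_eq ?_) (sum_traceNorm_coord_le _)
    refine Finset.sum_congr rfl fun s _ => ?_
    rw [← hblkT z s l, ← hblksub]
  have hsplit : ∀ g k s l, traceNorm (∑ z, G.deviation g k z • ω z s l) ≤
      traceNorm (∑ z, G.deviation g k z • (ω z s l - t z s l)) +
        traceNorm (∑ z, G.deviation g k z • t z s l) := fun g k s l => by
    refine le_trans (le_of_eq ?_) (traceNorm_add_le _ _)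
    rw [← Finset.sum_add_distrib]
    simp only [← smul_add, sub_add_cancel]
  calc ∑ s, ∑ l, ∑ g, G.dist g * ∑ k, traceNorm (∑ z, G.deviation g k z • ω z s l)
      ≤ ∑ s, ∑ l, ∑ g, G.dist g * (∑ k, traceNorm (∑ z, G.deviation g k z • (ω z s l - t z s l)) +
          ∑ k, traceNorm (∑ z, G.deviation g k z • t z s l)) := by
        gcongr with s _ l _ g _
        rw [← Finset.sum_add_distrib]
        exact Finset.sum_le_sum fun k _ => hsplit g k s l
    _ = (∑ s, ∑ l, ∑ g, G.dist g *
            ∑ k, traceNorm (∑ z, G.deviation g k z • (ω z s l - t z s l))) +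
          ∑ s, ∑ l, ∑ g, G.dist g * ∑ k, traceNorm (∑ z, G.deviation g k z • t z s l) := by
        simp only [mul_add, Finset.sum_add_distrib]
    _ ≤ _ := add_le_add ?_ ?_
  · calc ∑ s, ∑ l, ∑ g, G.dist g *
            ∑ k, traceNorm (∑ z, G.deviation g k z • (ω z s l - t z s l))
        ≤ ∑ s, ∑ l, ∑ g, G.dist g * (2 * ∑ z, traceNorm (ω z s l - t z s l)) := by
          gcongr with s _ l _ g _
          exact G.sum_traceNorm_deviation_le _ g
      _ = 2 * ∑ s, ∑ l, ∑ z, traceNorm (ω z s l - t z s l) := by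
          simp only [← Finset.sum_mul, sum_pmf_eq_one, one_mul]
          simp only [Finset.mul_sum]
      _ ≤ 2 * ENNReal.ofReal (2 * ε) := by gcongr
      _ = ENNReal.ofReal (4 * ε) := by
          rw [show (2 : ℝ≥0∞) = ENNReal.ofReal 2 by simp, ← ENNReal.ofReal_mul (by norm_num)]
          congr 1; ring
  · calc ∑ s, ∑ l, ∑ g, G.dist g * ∑ k, traceNorm (∑ z, G.deviation g k z • t z s l)
        ≤ ∑ s, ∑ l, (Fintype.card 𝒦 * ENNReal.ofReal c * ∑ z, trace (t z s l)) ^ (1 / 2 : ℝ) *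
            trace (σs s) ^ (1 / 2 : ℝ) := by
          gcongr with s _ l _
          exact G.leftover_hashing (fun z => htpos z s l) (fun z => htfin z s l) (hσspos s) hc
            fun z => htσ z s l
      _ = ∑ x : S × Y, (Fintype.card 𝒦 * ENNReal.ofReal c * ∑ z, trace (t z x.1 x.2)) ^ (1 / 2 : ℝ) *
            trace (σs x.1) ^ (1 / 2 : ℝ) := by rw [Fintype.sum_prod_type]
      _ ≤ _ := sum_sqrt_mul_sqrt_le _ _ _
      _ = (Fintype.card 𝒦 * ENNReal.ofReal c * ∑ l, ∑ s, ∑ z, trace (t z s l)) ^ (1 / 2 : ℝ) *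
            (Fintype.card Y * trace σ) ^ (1 / 2 : ℝ) := by
          rw [← Finset.mul_sum, Fintype.sum_prod_type, Fintype.sum_prod_type, Finset.sum_comm,
            ← sum_trace_coord hσ.1]
          simp only [Finset.sum_const, Finset.card_univ, nsmul_eq_mul, ← Finset.mul_sum, σs]
      _ ≤ (Fintype.card 𝒦 * ENNReal.ofReal c * 1) ^ (1 / 2 : ℝ) *
            (Fintype.card Y * 1) ^ (1 / 2 : ℝ) := by
          gcongr
          exact hσ.2
      _ = _ := by rw [mul_one, mul_one, ← ENNReal.mul_rpow_of_nonneg _ _ (by norm_num)]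

end SmoothLeftoverHashing

/-! ### Orthogonality of the Fock coefficients of coherent states -/

section Coherent

open ComplexConjugate

theorem continuous_coherentCoeff (n : ℕ) : Continuous fun β => coherentCoeff β n := by
  unfold coherentCoeff
  fun_prop

theorem sq_norm_coherentCoeff (β : ℂ) (n : ℕ) :
    ‖coherentCoeff β n‖ ^ 2 = (n.factorial : ℝ)⁻¹ *
      (‖β‖ ^ (2 * n : ℝ) * Real.exp (-‖β‖ ^ (2 : ℝ))) := by
  have he : Real.exp (-‖β‖ ^ 2 / 2) ^ 2 = Real.exp (-‖β‖ ^ 2) := by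
    rw [← Real.exp_nat_mul]; congr 1; push_cast; ring
  have hs : Real.sqrt n.factorial ^ 2 = n.factorial := Real.sq_sqrt (by positivity)
  have hn : ‖coherentCoeff β n‖ =
      Real.exp (-‖β‖ ^ 2 / 2) * ‖β‖ ^ n / Real.sqrt n.factorial := by
    unfold coherentCoeff
    rw [norm_div, norm_mul, norm_pow, Complex.norm_real, Complex.norm_real,
      Real.norm_of_nonneg (Real.exp_nonneg _), Real.norm_of_nonneg (Real.sqrt_nonneg _)]
  rw [hn, div_pow, mul_pow, he, hs, Real.rpow_two,
    show (2 * n : ℝ) = ((n * 2 : ℕ) : ℝ) by push_cast; ring, Real.rpow_natCast, pow_mul]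
  field_simp

theorem integral_sq_norm_coherentCoeff (n : ℕ) : ∫ β, ‖coherentCoeff β n‖ ^ 2 = Real.pi := by
  simp only [sq_norm_coherentCoeff]
  rw [integral_const_mul, Complex.integral_rpow_mul_exp_neg_rpow (by norm_num)
    (by linarith [(Nat.cast_nonneg n : (0 : ℝ) ≤ n)]),
    show ((2 * n + 2) / 2 : ℝ) = n + 1 by ring, Real.Gamma_nat_eq_factorial]
  field_simp

theorem integrable_sq_norm_coherentCoeff (n : ℕ) :
    Integrable fun β => ‖coherentCoeff β n‖ ^ 2 := by
  by_contra h
  have h1 := integral_undef h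
  rw [integral_sq_norm_coherentCoeff] at h1
  exact Real.pi_ne_zero h1

theorem integrable_coherentCoeff_mul (n m : ℕ) :
    Integrable fun β => conj (coherentCoeff β n) * coherentCoeff β m := by
  refine Integrable.mono' ((integrable_sq_norm_coherentCoeff n).add
    (integrable_sq_norm_coherentCoeff m)) ?_ (Filter.Eventually.of_forall fun β => ?_)
  · exact ((Complex.continuous_conj.comp (continuous_coherentCoeff n)).mul
      (continuous_coherentCoeff m)).aestronglyMeasurable
  · rw [norm_mul, RCLike.norm_conj]
    change _ ≤ ‖coherentCoeff β n‖ ^ 2 + ‖coherentCoeff β m‖ ^ 2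
    nlinarith [sq_nonneg (‖coherentCoeff β n‖ - ‖coherentCoeff β m‖),
      sq_nonneg ‖coherentCoeff β n‖, sq_nonneg ‖coherentCoeff β m‖]

/-- The Fock coefficients of coherent states are orthogonal as functions of the amplitude, by
rotation invariance. -/
theorem integral_coherentCoeff_mul (n m : ℕ) :
    ∫ β, conj (coherentCoeff β n) * coherentCoeff β m = if n = m then (Real.pi : ℂ) else 0 := by
  split_ifs with h
  · subst h
    have h1 : ∀ β, conj (coherentCoeff β n) * coherentCoeff β n =
        ((‖coherentCoeff β n‖ ^ 2 : ℝ) : ℂ) := fun β => by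
      rw [Complex.conj_mul']; push_cast; rfl
    simp only [h1]
    rw [integral_complex_ofReal, integral_sq_norm_coherentCoeff]
  · have hmn : (m : ℝ) - n ≠ 0 := sub_ne_zero.2 (by exact_mod_cast (Ne.symm h))
    -- the rotation by the angle `π / (m - n)` changes the sign of the integrand
    let θ : ℝ := Real.pi / (m - n)
    let u : ℂ := Complex.exp (θ * Complex.I)
    have hu : ‖u‖ = 1 := Complex.norm_exp_ofReal_mul_I θ
    have hrot : ∀ β k, coherentCoeff (u * β) k = u ^ k * coherentCoeff β k := fun β k => by
      unfold coherentCoeff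
      rw [norm_mul, hu, one_mul, mul_pow]
      ring
    have hsign : conj (u ^ n) * u ^ m = -1 := by
      rw [map_pow, ← Complex.exp_conj, ← Complex.exp_nat_mul, ← Complex.exp_nat_mul,
        ← Complex.exp_add, ← Complex.exp_pi_mul_I]
      congr 1
      rw [map_mul, Complex.conj_ofReal, Complex.conj_I]
      have hθ : (θ : ℂ) * (m - n) = Real.pi := by
        have h2 : θ * (m - n) = Real.pi := div_mul_cancel₀ _ hmn
        exact_mod_cast congrArg (fun x : ℝ => (x : ℂ)) h2
      linear_combination Complex.I * hθ
    have hinv := (rotation (Circle.exp θ)).measurePreserving.integral_comp'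
      (f := (rotation (Circle.exp θ)).toHomeomorph.toMeasurableEquiv)
      (fun β => conj (coherentCoeff β n) * coherentCoeff β m)
    have hval : ∀ β, (rotation (Circle.exp θ)).toHomeomorph.toMeasurableEquiv β = u * β := fun β => by
      change rotation (Circle.exp θ) β = _
      rw [rotation_apply, Circle.coe_exp]
    have hneg : ∀ β, conj (coherentCoeff (u * β) n) * coherentCoeff (u * β) m =
        -(conj (coherentCoeff β n) * coherentCoeff β m) := fun β => by
      rw [hrot, hrot, map_mul]
      linear_combination (conj (coherentCoeff β n) * coherentCoeff β m) * hsign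
    simp only [hval, hneg, integral_neg] at hinv
    exact self_eq_neg.1 hinv.symm

theorem lintegral_sq_norm_sum (s : Finset ℕ) (a : ℕ → ℂ) :
    ∫⁻ β, ENNReal.ofReal (‖∑ n ∈ s, coherentCoeff β n * a n‖ ^ 2) =
      ENNReal.ofReal Real.pi * ∑ n ∈ s, ENNReal.ofReal (‖a n‖ ^ 2) := by
  have hexp : ∀ β, ((‖∑ n ∈ s, coherentCoeff β n * a n‖ ^ 2 : ℝ) : ℂ) =
      ∑ n ∈ s, ∑ m ∈ s, (conj (coherentCoeff β n) * coherentCoeff β m) * (conj (a n) * a m) := by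
    intro β
    push_cast
    rw [← Complex.conj_mul', map_sum, Finset.sum_mul_sum]
    refine Finset.sum_congr rfl fun n _ => Finset.sum_congr rfl fun m _ => ?_
    rw [map_mul]; ring
  have hint : ∀ n m, Integrable fun β =>
      (conj (coherentCoeff β n) * coherentCoeff β m) * (conj (a n) * a m) := fun n m =>
    (integrable_coherentCoeff_mul n m).mul_const _
  have hintC : Integrable fun β => ((‖∑ n ∈ s, coherentCoeff β n * a n‖ ^ 2 : ℝ) : ℂ) := by
    simp only [hexp]
    exact integrable_finsetSum _ fun n _ => integrable_finsetSum _ fun m _ => hint n m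
  have hintR : Integrable fun β => ‖∑ n ∈ s, coherentCoeff β n * a n‖ ^ 2 := by
    exact hintC.re
  have hval : ∫ β, ‖∑ n ∈ s, coherentCoeff β n * a n‖ ^ 2 = Real.pi * ∑ n ∈ s, ‖a n‖ ^ 2 := by
    have h1 : ((∫ β, ‖∑ n ∈ s, coherentCoeff β n * a n‖ ^ 2 : ℝ) : ℂ) =
        ((Real.pi * ∑ n ∈ s, ‖a n‖ ^ 2 : ℝ) : ℂ) := by
      rw [← integral_complex_ofReal]
      simp only [hexp]
      rw [integral_finsetSum _ fun n _ => integrable_finsetSum _ fun m _ => hint n m]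
      push_cast
      rw [Finset.mul_sum]
      refine Finset.sum_congr rfl fun n hn => ?_
      rw [integral_finsetSum _ fun m _ => hint n m]
      simp only [integral_mul_const, integral_coherentCoeff_mul, ite_mul, zero_mul,
        Finset.sum_ite_eq, hn, if_true]
      rw [Complex.conj_mul']
    exact_mod_cast h1
  rw [← ofReal_integral_eq_lintegral_ofReal hintR (Filter.Eventually.of_forall fun _ => by positivity),
    hval, ENNReal.ofReal_mul Real.pi_pos.le, ENNReal.ofReal_sum_of_nonneg fun _ _ => by positivity]

variable {H : Type*} [NormedAddCommGroup H] [InnerProductSpace ℂ H] [CompleteSpace H]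

theorem hasSum_inner_attachCoherent (w : Mode H) (v : H) (β : ℂ) :
    HasSum (fun n => coherentCoeff β n * ⟪w n, v⟫_ℂ) ⟪w, attachCoherent β v⟫_ℂ := by
  have h := lp.hasSum_inner (𝕜 := ℂ) w (attachCoherent β v)
  refine h.congr_fun fun n => ?_
  change _ = ⟪w n, coherentCoeff β n • v⟫_ℂ
  rw [inner_smul_right]

theorem measurable_inner_attachCoherent (w : Mode H) (v : H) :
    Measurable fun β => ⟪w, attachCoherent β v⟫_ℂ := by
  refine measurable_of_tendsto_metrizable (f := fun (N : ℕ) β =>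
    ∑ n ∈ Finset.range N, coherentCoeff β n * ⟪w n, v⟫_ℂ) (fun N => ?_) ?_
  · exact Finset.measurable_sum _ fun n _ => ((continuous_coherentCoeff n).measurable).mul_const _
  · exact tendsto_pi_nhds.2 fun β => (hasSum_inner_attachCoherent w v β).tendsto_sum_nat

/-- One half of the resolution of identity `π⁻¹ ∫ |β⟩⟨β| dβ = 1`, obtained from finite sums with the
lemma of Fatou. It says that detection does not increase the trace, which is all that is needed. -/
theorem lintegral_sq_norm_inner_attachCoherent_le (w : Mode H) (v : H) :
    ∫⁻ β, ENNReal.ofReal (‖⟪w, attachCoherent β v⟫_ℂ‖ ^ 2) ≤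
      ENNReal.ofReal Real.pi * ∑' n, ENNReal.ofReal (‖⟪w n, v⟫_ℂ‖ ^ 2) := by
  let f : ℕ → ℂ → ℝ≥0∞ := fun N β =>
    ENNReal.ofReal (‖∑ n ∈ Finset.range N, coherentCoeff β n * ⟪w n, v⟫_ℂ‖ ^ 2)
  have hlim : ∀ β, Filter.Tendsto (fun N => f N β) Filter.atTop
      (nhds (ENNReal.ofReal (‖⟪w, attachCoherent β v⟫_ℂ‖ ^ 2))) := fun β =>
    (ENNReal.continuous_ofReal.tendsto _).comp
      (((hasSum_inner_attachCoherent w v β).tendsto_sum_nat).norm.pow 2)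
  calc ∫⁻ β, ENNReal.ofReal (‖⟪w, attachCoherent β v⟫_ℂ‖ ^ 2)
      = ∫⁻ β, Filter.liminf (fun N => f N β) Filter.atTop :=
        lintegral_congr fun β => (hlim β).liminf_eq.symm
    _ ≤ Filter.liminf (fun N => ∫⁻ β, f N β) Filter.atTop := by
        refine lintegral_liminf_le fun N => ?_
        refine ENNReal.measurable_ofReal.comp (Measurable.pow_const (Measurable.norm ?_) 2)
        exact Finset.measurable_sum _ fun n _ =>
          ((continuous_coherentCoeff n).measurable).mul_const _
    _ ≤ _ := by
        refine Filter.liminf_le_of_le (by isBoundedDefault) fun b hb => ?_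
        obtain ⟨N, hN⟩ := hb.exists
        refine hN.trans ?_
        rw [lintegral_sq_norm_sum]
        gcongr
        exact ENNReal.sum_le_tsum _

end Coherent

/-! ### Heterodyne detection and channels -/

section Heterodyne

variable {H : Type*} [NormedAddCommGroup H] [InnerProductSpace ℂ H] [CompleteSpace H]
variable {K : Type*} [NormedAddCommGroup K] [InnerProductSpace ℂ K] [CompleteSpace K]

/-- The positive square root. The wrapper fixes the scalar structures of the algebra of operators
for an abstract Hilbert space; at concrete spaces such as `Mode H` they are not found by
unification. -/
noncomputable def posSqrt (T : H →L[ℂ] H) : H →L[ℂ] H := CFC.sqrt T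

theorem inner_posSqrt_left (T : H →L[ℂ] H) (x y : H) : ⟪posSqrt T x, y⟫_ℂ = ⟪x, posSqrt T y⟫_ℂ :=
  inner_sqrt_left T x y

theorem posSqrt_posSqrt_apply {T : H →L[ℂ] H} (hT : T.IsPositive) (x : H) :
    posSqrt T (posSqrt T x) = T x := sqrt_sqrt_apply hT x

theorem trace_eq_hs_posSqrt {T : H →L[ℂ] H} (hT : T.IsPositive) : trace T = hs (posSqrt T) :=
  trace_eq_hs_sqrt hT

theorem inner_conj_attachCoherent {ρ : Mode H →L[ℂ] Mode H} (hρ : ρ.IsPositive) (v : H) (β : ℂ) :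
    ⟪v, ((attachCoherent β).adjoint ∘L ρ ∘L attachCoherent β) v⟫_ℂ =
      ((‖posSqrt ρ (attachCoherent β v)‖ ^ 2 : ℝ) : ℂ) := by
  have h1 : ⟪v, ((attachCoherent β).adjoint ∘L ρ ∘L attachCoherent β) v⟫_ℂ =
      ⟪attachCoherent β v, ρ (attachCoherent β v)⟫_ℂ := by
    simp only [ContinuousLinearMap.comp_apply]
    rw [ContinuousLinearMap.adjoint_inner_right]
  rw [h1, ← posSqrt_posSqrt_apply hρ, ← inner_posSqrt_left, inner_self_eq_norm_sq_to_K]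
  push_cast; rfl

theorem inner_heterodyne {ρ : Mode H →L[ℂ] Mode H} (hρ : ρ.IsPositive) {A : Set ℂ}
    (h : IntegrableOn (fun β => (attachCoherent β).adjoint ∘L ρ ∘L attachCoherent (H := H) β) A)
    (v : H) :
    IntegrableOn (fun β => ‖posSqrt ρ (attachCoherent β v)‖ ^ 2) A ∧
    ⟪v, heterodyne A ρ v⟫_ℂ =
      ((Real.pi⁻¹ * ∫ β in A, ‖posSqrt ρ (attachCoherent β v)‖ ^ 2 : ℝ) : ℂ) := by
  let L : (H →L[ℂ] H) →L[ℂ] ℂ := (innerSL ℂ v) ∘L (ContinuousLinearMap.apply ℂ H v)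
  have hL : ∀ T, L T = ⟪v, T v⟫_ℂ := fun T => rfl
  have h2 := L.integral_comp_comm h
  have h3 := L.integrable_comp h
  simp only [hL, inner_conj_attachCoherent hρ] at h2 h3
  refine ⟨h3.re, ?_⟩
  rw [heterodyne, smul_apply, inner_smul_right_eq_smul, ← h2, integral_complex_ofReal]
  push_cast
  simp

theorem heterodyne_eq_zero {ρ : Mode H →L[ℂ] Mode H} {A : Set ℂ}
    (h : ¬ IntegrableOn (fun β => (attachCoherent β).adjoint ∘L ρ ∘L attachCoherent (H := H) β) A) :
    heterodyne A ρ = 0 := by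
  rw [heterodyne, integral_undef h, smul_zero]

theorem isPositive_heterodyne {ρ : Mode H →L[ℂ] Mode H} (hρ : ρ.IsPositive) (A : Set ℂ) :
    (heterodyne A ρ).IsPositive := by
  by_cases h : IntegrableOn (fun β => (attachCoherent β).adjoint ∘L ρ ∘L attachCoherent (H := H) β) A
  · rw [ContinuousLinearMap.isPositive_iff_complex]
    intro v
    rw [← inner_conj_symm, (inner_heterodyne hρ h v).2, Complex.conj_ofReal]
    refine ⟨by simp, ?_⟩
    have : 0 ≤ Real.pi⁻¹ * ∫ β in A, ‖posSqrt ρ (attachCoherent β v)‖ ^ 2 :=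
      mul_nonneg (by positivity) (integral_nonneg fun _ => by positivity)
    simpa using this
  · rw [heterodyne_eq_zero h]
    exact ContinuousLinearMap.isPositive_zero

/-- An inequality suffices, and it holds also where the integral defining `heterodyne` does not
exist and has the value `0`. -/
theorem ofReal_re_inner_heterodyne_le {ρ : Mode H →L[ℂ] Mode H} (hρ : ρ.IsPositive) (A : Set ℂ)
    (v : H) : ENNReal.ofReal (⟪v, heterodyne A ρ v⟫_ℂ).re ≤
      ENNReal.ofReal Real.pi⁻¹ *
        ∫⁻ β in A, ENNReal.ofReal (‖posSqrt ρ (attachCoherent β v)‖ ^ 2) := by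
  by_cases h : IntegrableOn (fun β => (attachCoherent β).adjoint ∘L ρ ∘L attachCoherent (H := H) β) A
  · obtain ⟨h1, h2⟩ := inner_heterodyne hρ h v
    rw [h2, Complex.ofReal_re, ENNReal.ofReal_mul (by positivity),
      ofReal_integral_eq_lintegral_ofReal h1 (Filter.Eventually.of_forall fun _ => by positivity)]
  · rw [heterodyne_eq_zero h]
    simp

/-- Up to the factor `π`, the right-hand side is `⟨v, Tr_B[ρ] v⟩`. The space need not be
separable: only countably many basis vectors contribute to the trace of `ρ`, and this is what allows
integration and summation to be exchanged. -/
theorem lintegral_sq_norm_sqrt_attachCoherent_le {ρ : Mode H →L[ℂ] Mode H} (hρ : ρ.IsPositive)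
    (htr : trace ρ ≠ ∞) (v : H) :
    ∫⁻ β, ENNReal.ofReal (‖posSqrt ρ (attachCoherent β v)‖ ^ 2) ≤
      ENNReal.ofReal Real.pi * ∑' j, ∑' n, ENNReal.ofReal
        (‖⟪(posSqrt ρ (basis (Mode H) j)) n, v⟫_ℂ‖ ^ 2) := by
  let w : BasisIndex (Mode H) → Mode H := fun j => posSqrt ρ (basis (Mode H) j)
  have hsum : ∑' j, ENNReal.ofReal (‖w j‖ ^ 2) ≠ ∞ := by
    have h1 := trace_eq_hs_posSqrt hρ
    rw [hs] at h1
    rwa [← h1]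
  let J : Set (BasisIndex (Mode H)) := Function.support fun j => ENNReal.ofReal (‖w j‖ ^ 2)
  have hJ : J.Countable := Summable.countable_support_ennreal hsum
  have : Countable J := hJ.to_subtype
  have hw : ∀ j, j ∉ J → w j = 0 := fun j hj => by
    have h1 : ENNReal.ofReal (‖w j‖ ^ 2) = 0 := Function.notMem_support.1 hj
    rw [ENNReal.ofReal_eq_zero] at h1
    simpa using le_antisymm h1 (by positivity)
  have hpars : ∀ β, ENNReal.ofReal (‖posSqrt ρ (attachCoherent β v)‖ ^ 2) =
      ∑' j : J, ENNReal.ofReal (‖⟪w j, attachCoherent β v⟫_ℂ‖ ^ 2) := fun β => by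
    rw [parseval (basis (Mode H)), tsum_subtype_eq_of_support_subset
      (f := fun j => ENNReal.ofReal (‖⟪w j, attachCoherent β v⟫_ℂ‖ ^ 2))]
    · refine tsum_congr fun j => ?_
      rw [← inner_posSqrt_left]
    · intro j hj
      by_contra h1
      exact hj (by simp [hw j h1])
  simp only [hpars]
  rw [lintegral_tsum fun j => ?_]
  · rw [← ENNReal.tsum_mul_left]
    calc _ ≤ ∑' j : J, ENNReal.ofReal Real.pi * ∑' n, ENNReal.ofReal (‖⟪w j n, v⟫_ℂ‖ ^ 2) :=
          ENNReal.tsum_le_tsum fun j => lintegral_sq_norm_inner_attachCoherent_le _ _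
      _ ≤ _ := ENNReal.tsum_comp_le_tsum_of_injective Subtype.val_injective
          (fun j => ENNReal.ofReal Real.pi * ∑' n, ENNReal.ofReal (‖⟪w j n, v⟫_ℂ‖ ^ 2))
  · exact (ENNReal.measurable_ofReal.comp
      ((measurable_inner_attachCoherent (w j) v).norm.pow_const 2)).aemeasurable

/-- Heterodyne detection in disjoint regions does not increase the total trace. -/
theorem sum_trace_heterodyne_le {ι : Type*} [Fintype ι] {A : ι → Set ℂ}
    (hA : ∀ z, MeasurableSet (A z)) (hd : Pairwise (Function.onFun (AEDisjoint volume) A))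
    {ρ : Mode H →L[ℂ] Mode H} (hρ : ρ.IsPositive) :
    ∑ z, trace (heterodyne (A z) ρ) ≤ trace ρ := by
  by_cases htr : trace ρ = ∞
  · rw [htr]; exact le_top
  have hterm : ∀ v : H, ∑ z, ENNReal.ofReal (⟪v, heterodyne (A z) ρ v⟫_ℂ).re ≤
      ∑' j, ∑' n, ENNReal.ofReal (‖⟪(posSqrt ρ (basis (Mode H) j)) n, v⟫_ℂ‖ ^ 2) := by
    intro v
    calc ∑ z, ENNReal.ofReal (⟪v, heterodyne (A z) ρ v⟫_ℂ).re
        ≤ ∑ z, ENNReal.ofReal Real.pi⁻¹ *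
            ∫⁻ β in A z, ENNReal.ofReal (‖posSqrt ρ (attachCoherent β v)‖ ^ 2) :=
          Finset.sum_le_sum fun z _ => ofReal_re_inner_heterodyne_le hρ (A z) v
      _ = ENNReal.ofReal Real.pi⁻¹ *
            ∫⁻ β in ⋃ z ∈ Finset.univ, A z,
              ENNReal.ofReal (‖posSqrt ρ (attachCoherent β v)‖ ^ 2) := by
          rw [← Finset.mul_sum, lintegral_biUnion_finset₀ (fun a _ b _ hab => hd hab)
            fun z _ => (hA z).nullMeasurableSet]
      _ ≤ ENNReal.ofReal Real.pi⁻¹ *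
            ∫⁻ β, ENNReal.ofReal (‖posSqrt ρ (attachCoherent β v)‖ ^ 2) := by
          gcongr
          exact Measure.restrict_le_self
      _ ≤ ENNReal.ofReal Real.pi⁻¹ * (ENNReal.ofReal Real.pi * _) := by
          gcongr
          exact lintegral_sq_norm_sqrt_attachCoherent_le hρ htr v
      _ = _ := by
          rw [← mul_assoc, ← ENNReal.ofReal_mul (by positivity), inv_mul_cancel₀ Real.pi_ne_zero,
            ENNReal.ofReal_one, one_mul]
  unfold trace
  rw [← Summable.tsum_finsetSum fun _ _ => ENNReal.summable]
  calc _ ≤ ∑' i, ∑' j, ∑' n, ENNReal.ofReal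
          (‖⟪(posSqrt ρ (basis (Mode H) j)) n, basis H i⟫_ℂ‖ ^ 2) :=
        ENNReal.tsum_le_tsum fun i => hterm _
    _ = ∑' j, ∑' n, ENNReal.ofReal (‖(posSqrt ρ (basis (Mode H) j)) n‖ ^ 2) := by
        rw [ENNReal.tsum_comm]
        refine tsum_congr fun j => ?_
        rw [ENNReal.tsum_comm]
        refine tsum_congr fun n => ?_
        rw [parseval (basis H)]
        exact tsum_congr fun i => by rw [norm_inner_symm]
    _ = ∑' j, ENNReal.ofReal (‖posSqrt ρ (basis (Mode H) j)‖ ^ 2) := by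
        refine tsum_congr fun j => ?_
        have h := lp.hasSum_norm (p := 2) (by norm_num) (posSqrt ρ (basis (Mode H) j))
        simp only [ENNReal.toReal_ofNat, Real.rpow_ofNat] at h
        rw [← h.tsum_eq, ENNReal.ofReal_tsum_of_nonneg (fun _ => by positivity) h.summable]
    _ = trace ρ := (trace_eq_hs_posSqrt hρ).symm

theorem norm_attachCoherent_le (β : ℂ) : ‖attachCoherent (H := H) β‖ ≤ 1 :=
  LinearMap.mkContinuous_norm_le _ zero_le_one _

theorem isPositive_prepare (β : ℂ) {ρ : H →L[ℂ] H} (hρ : ρ.IsPositive) :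
    (prepare β ρ).IsPositive := hρ.conj_adjoint (attachCoherent β)

theorem trace_prepare_le (β : ℂ) {ρ : H →L[ℂ] H} (hρ : ρ.IsPositive) :
    trace (prepare β ρ) ≤ trace ρ := by
  have h := trace_conj_le (attachCoherent (H := H) β).adjoint
    (norm_adjoint_le_one (norm_attachCoherent_le β)) hρ
  rwa [ContinuousLinearMap.adjoint_adjoint] at h

theorem Channel.isPositive_app (Φ : Channel H K) {T : H →L[ℂ] H} (hT : T.IsPositive) :
    (Φ.app T).IsPositive := by
  unfold Channel.app
  split_ifs with h
  · have h1 := Φ.completely_positive 1 (fun _ _ => ⟨T, h⟩) (by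
      have h2 := isPositive_blockDiag (X := Fin 1) (ρ := fun _ => T) fun _ => hT
      unfold blockDiag at h2
      convert h2 using 4 with i j
      simp [Subsingleton.elim i j])
    have h3 : blockOp (fun i j : Fin 1 => (Φ.toLin ⟨T, h⟩ : K →L[ℂ] K)) =
        blockDiag fun _ : Fin 1 => (Φ.toLin ⟨T, h⟩ : K →L[ℂ] K) := by
      unfold blockDiag
      congr 1
      funext i j
      simp [Subsingleton.elim i j]
    rw [h3] at h1
    have h4 := h1.conj_adjoint (coord K (0 : Fin 1))
    rwa [coord_comp_blockDiag] at h4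
  · exact ContinuousLinearMap.isPositive_zero

theorem Channel.trace_app_le (Φ : Channel H K) {T : H →L[ℂ] H} (hT : T.IsPositive) :
    trace (Φ.app T) ≤ trace T := by
  unfold Channel.app
  split_ifs with h
  · exact (Φ.trace_preserving ⟨T, h⟩ hT).le
  · rw [trace_zero]; exact zero_le

end Heterodyne

/-! ### The regions of phase space -/

section PhaseSpace

theorem zero_mem_quadrant (z : ℕ) : (0 : ℂ) ∈ quadrant z :=
  ⟨Real.pi / 4 * (2 * z - 1), ⟨le_rfl, by nlinarith [Real.pi_pos]⟩, by simp⟩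

/-- After rotation to the quadrant of the positive real axis, the quadrant is a range of the
principal argument; the origin belongs to every quadrant. -/
theorem mem_quadrant_iff (z : ℕ) (y : ℂ) : y ∈ quadrant z ↔ y = 0 ∨
    (y * Complex.exp (-(z * (Real.pi / 2) : ℝ) * Complex.I)).arg ∈
      Set.Ico (-(Real.pi / 4)) (Real.pi / 4) := by
  have hpi := Real.pi_pos
  rcases eq_or_ne y 0 with rfl | hy
  · simp [zero_mem_quadrant]
  simp only [hy, false_or]
  have hy' : 0 < ‖y‖ := norm_pos_iff.2 hy
  constructor
  · rintro ⟨θ, hθ, hyθ⟩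
    have h1 : y * Complex.exp (-(z * (Real.pi / 2) : ℝ) * Complex.I) =
        (‖y‖ : ℂ) * (Complex.cos ((θ - z * (Real.pi / 2) : ℝ) : ℂ) +
          Complex.sin ((θ - z * (Real.pi / 2) : ℝ) : ℂ) * Complex.I) := by
      rw [← Complex.exp_mul_I]
      conv_lhs => rw [hyθ]
      rw [mul_assoc, ← Complex.exp_add]
      congr 2
      push_cast; ring
    have h2 : θ - z * (Real.pi / 2) ∈ Set.Ico (-(Real.pi / 4)) (Real.pi / 4) :=
      ⟨by linarith [hθ.1], by linarith [hθ.2]⟩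
    rw [h1, Complex.arg_mul_cos_add_sin_mul_I hy' ⟨by linarith [h2.1], by linarith [h2.2]⟩]
    exact h2
  · intro h
    set u := y * Complex.exp (-(z * (Real.pi / 2) : ℝ) * Complex.I) with hu
    refine ⟨u.arg + z * (Real.pi / 2), ⟨by linarith [h.1], by linarith [h.2]⟩, ?_⟩
    have hn : ‖u‖ = ‖y‖ := by
      rw [hu, norm_mul, ← Complex.ofReal_neg, Complex.norm_exp_ofReal_mul_I, mul_one]
    have h1 := Complex.norm_mul_exp_arg_mul_I u
    rw [hn] at h1
    rw [Complex.ofReal_add, add_mul, Complex.exp_add, ← mul_assoc, h1, hu, mul_assoc,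
      ← Complex.exp_add]
    simp

theorem measurableSet_quadrant (z : ℕ) : MeasurableSet (quadrant z) := by
  have h : quadrant z = {0} ∪ (fun y : ℂ =>
      (y * Complex.exp (-(z * (Real.pi / 2) : ℝ) * Complex.I)).arg) ⁻¹'
        Set.Ico (-(Real.pi / 4)) (Real.pi / 4) := by
    ext y
    exact mem_quadrant_iff z y
  rw [h]
  exact (measurableSet_singleton _).union
    ((Complex.measurable_arg.comp (measurable_id.mul_const _)) measurableSet_Ico)

/-- Quadrants overlap in the origin only, a null set. -/
theorem eq_zero_of_mem_quadrant_of_lt {z z' : ℕ} (h : z < z') (h' : z' < 4) {y : ℂ}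
    (hy : y ∈ quadrant z) (hy' : y ∈ quadrant z') : y = 0 := by
  by_contra h0
  obtain ⟨θ, hθ, h1⟩ := hy
  obtain ⟨θ', hθ', h2⟩ := hy'
  have hpi := Real.pi_pos
  have hn : (‖y‖ : ℂ) ≠ 0 := by exact_mod_cast norm_ne_zero_iff.2 h0
  have h3 : Complex.exp (θ' * Complex.I) = Complex.exp (θ * Complex.I) :=
    mul_left_cancel₀ hn (h2.symm.trans h1)
  obtain ⟨k, hk⟩ := Complex.exp_eq_exp_iff_exists_int.1 h3
  have h4 : θ' = θ + k * (2 * Real.pi) := by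
    have h5 := congrArg Complex.im hk
    simpa using h5
  have hz : (z : ℝ) + 1 ≤ z' := by exact_mod_cast h
  have hz' : (z' : ℝ) + 1 ≤ 4 := by exact_mod_cast h'
  have hz0 : (0 : ℝ) ≤ z := Nat.cast_nonneg z
  have h6 : 0 < (k : ℝ) := by
    by_contra hk0
    push Not at hk0
    nlinarith [hθ.1, hθ.2, hθ'.1, hθ'.2]
  have h7 : (k : ℝ) < 1 := by
    by_contra hk1
    push Not at hk1
    nlinarith [hθ.1, hθ.2, hθ'.1, hθ'.2]
  have h8 : 0 < k := by exact_mod_cast h6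
  have h9 : k < 1 := by exact_mod_cast h7
  omega

theorem eq_zero_of_mem_quadrant {z z' : ℕ} (h : z ≠ z') (hz : z < 4) (hz' : z' < 4) {y : ℂ}
    (hy : y ∈ quadrant z) (hy' : y ∈ quadrant z') : y = 0 := by
  rcases h.lt_or_gt with h | h
  · exact eq_zero_of_mem_quadrant_of_lt h hz' hy hy'
  · exact eq_zero_of_mem_quadrant_of_lt h hz hy' hy

theorem aedisjoint_of_inter_subset {A B : Set ℂ} (h : ∀ y, y ∈ A → y ∈ B → y = 0) :
    AEDisjoint volume A B :=
  measure_mono_null (t := ({0} : Set ℂ))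
    (fun y hy => Set.mem_singleton_iff.2 (h y hy.1 hy.2)) (by simp)

theorem measurableSet_testModule (δ Δ : ℝ) (z : Fin 6) : MeasurableSet (testModule δ Δ z) := by
  unfold testModule
  split_ifs
  · exact (measurableSet_quadrant _).inter (measurableSet_lt measurable_norm measurable_const)
  · exact (measurableSet_le measurable_const measurable_norm).inter
      (measurableSet_lt measurable_norm measurable_const)
  · exact measurableSet_le measurable_const measurable_norm

theorem eq_zero_of_mem_testModule {δ Δ : ℝ} (h : δ < Δ) {z z' : Fin 6} (hz : z ≠ z') {y : ℂ}
    (hy : y ∈ testModule δ Δ z) (hy' : y ∈ testModule δ Δ z') : y = 0 := by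
  have hne : (z : ℕ) ≠ z' := fun h => hz (Fin.ext h)
  have h6 := z.2
  have h6' := z'.2
  unfold testModule at hy hy'
  split_ifs at hy hy' with h1 h2 h3 h4 h5
  all_goals simp only [Set.mem_inter_iff, Set.mem_ofPred_eq] at hy hy'
  all_goals first
    | exact eq_zero_of_mem_quadrant hne h1 h2 hy.1 hy'.1
    | (exfalso; linarith [hy.2, hy'.1])
    | (exfalso; linarith [hy.2, hy'])
    | (exfalso; linarith [hy, hy'.2])
    | (exfalso; omega)

end PhaseSpace

/-! ### The state produced by the protocol -/

section Rounds

variable {H : Type*} [NormedAddCommGroup H] [InnerProductSpace ℂ H] [CompleteSpace H]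
variable {K : Type*} [NormedAddCommGroup K] [InnerProductSpace ℂ K] [CompleteSpace K]

theorem isPositive_roundMap (P : Params) (Φ : Channel (Mode H) (Mode K)) (t : Round)
    {ρ : H →L[ℂ] H} (hρ : ρ.IsPositive) : (roundMap P Φ t ρ).IsPositive := by
  rcases t with ⟨x, z⟩ | ⟨x, z⟩
  · exact isPositive_smul (div_nonneg P.pK_mem.1 (by norm_num))
      (isPositive_heterodyne (Φ.isPositive_app (isPositive_prepare _ hρ)) _)
  · exact isPositive_smul (div_nonneg (sub_nonneg.2 P.pK_mem.2) (by norm_num))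
      (isPositive_heterodyne (Φ.isPositive_app (isPositive_prepare _ hρ)) _)

theorem sum_trace_heterodyne_app_le {ι : Type*} [Fintype ι] {A : ι → Set ℂ}
    (hA : ∀ z, MeasurableSet (A z)) (hd : Pairwise (Function.onFun (AEDisjoint volume) A))
    (Φ : Channel (Mode H) (Mode K)) (β : ℂ) {ρ : H →L[ℂ] H} (hρ : ρ.IsPositive) :
    ∑ z, trace (heterodyne (A z) (Φ.app (prepare β ρ))) ≤ trace ρ :=
  (sum_trace_heterodyne_le hA hd (Φ.isPositive_app (isPositive_prepare β hρ))).trans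
    ((Φ.trace_app_le (isPositive_prepare β hρ)).trans (trace_prepare_le β hρ))

/-- One round, summed over its possible records, does not increase the trace. -/
theorem sum_trace_roundMap_le (P : Params) (Φ : Channel (Mode H) (Mode K))
    {ρ : H →L[ℂ] H} (hρ : ρ.IsPositive) : ∑ t, trace (roundMap P Φ t ρ) ≤ trace ρ := by
  have hp0 : 0 ≤ P.pK := P.pK_mem.1
  have hp1 : 0 ≤ 1 - P.pK := sub_nonneg.2 P.pK_mem.2
  have hq : Pairwise (Function.onFun (AEDisjoint volume) fun z : Fin 4 => quadrant z) :=
    fun z z' h => aedisjoint_of_inter_subset fun y hy hy' =>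
      eq_zero_of_mem_quadrant (fun h' => h (Fin.ext h')) z.2 z'.2 hy hy'
  have ht : Pairwise (Function.onFun (AEDisjoint volume) (testModule P.δ P.Δ)) :=
    fun z z' h => aedisjoint_of_inter_subset fun y hy hy' => eq_zero_of_mem_testModule P.δ_lt h hy hy'
  rw [Fintype.sum_sum_type, Fintype.sum_prod_type, Fintype.sum_prod_type]
  have hkey : ∑ x : Fin 4, ∑ z : Fin 4, trace (roundMap P Φ (.inl (x, z)) ρ) ≤
      ENNReal.ofReal P.pK * trace ρ := by
    calc ∑ x : Fin 4, ∑ z : Fin 4, trace (roundMap P Φ (.inl (x, z)) ρ)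
        ≤ ∑ _x : Fin 4, ENNReal.ofReal (P.pK / 4) * trace ρ := by
          refine Finset.sum_le_sum fun x _ => ?_
          simp only [roundMap, trace_smul (div_nonneg hp0 (by norm_num : (0 : ℝ) ≤ 4)),
            ← Finset.mul_sum]
          gcongr
          exact sum_trace_heterodyne_app_le (A := fun z : Fin 4 => quadrant z)
            (fun z => measurableSet_quadrant z) hq Φ _ hρ
      _ = _ := by
          rw [Finset.sum_const, Finset.card_univ, Fintype.card_fin, nsmul_eq_mul, ← mul_assoc,
            show ((4 : ℕ) : ℝ≥0∞) = ENNReal.ofReal 4 by simp, ← ENNReal.ofReal_mul (by norm_num)]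
          congr 2; ring
  have htest : ∑ x : Fin 4, ∑ z : Fin 6, trace (roundMap P Φ (.inr (x, z)) ρ) ≤
      ENNReal.ofReal (1 - P.pK) * trace ρ := by
    calc ∑ x : Fin 4, ∑ z : Fin 6, trace (roundMap P Φ (.inr (x, z)) ρ)
        ≤ ∑ _x : Fin 4, ENNReal.ofReal ((1 - P.pK) / 4) * trace ρ := by
          refine Finset.sum_le_sum fun x _ => ?_
          simp only [roundMap, trace_smul (div_nonneg hp1 (by norm_num : (0 : ℝ) ≤ 4)),
            ← Finset.mul_sum]
          gcongr
          exact sum_trace_heterodyne_app_le (fun z => measurableSet_testModule _ _ z) ht Φ _ hρ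
      _ = _ := by
          rw [Finset.sum_const, Finset.card_univ, Fintype.card_fin, nsmul_eq_mul, ← mul_assoc,
            show ((4 : ℕ) : ℝ≥0∞) = ENNReal.ofReal 4 by simp, ← ENNReal.ofReal_mul (by norm_num)]
          congr 2; ring
  refine (add_le_add hkey htest).trans_eq ?_
  rw [← add_mul, ← ENNReal.ofReal_add hp0 hp1, add_sub_cancel, ENNReal.ofReal_one, one_mul]

universe u
variable {E : ℕ → Type u} [∀ i, NormedAddCommGroup (E i)] [∀ i, InnerProductSpace ℂ (E i)]
  [∀ i, CompleteSpace (E i)]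

theorem isPositive_roundsState (P : Params) (𝒜 : Attack E) (n : ℕ) (r : Fin n → Round) :
    (roundsState P 𝒜 n r).IsPositive := by
  induction n with
  | zero => exact 𝒜.init_mem.1
  | succ n ih => exact isPositive_roundMap P _ _ (ih _)

/-- The records of all rounds have total probability at most one. -/
theorem sum_trace_roundsState_le (P : Params) (𝒜 : Attack E) (n : ℕ) :
    ∑ r, trace (roundsState P 𝒜 n r) ≤ 1 := by
  induction n with
  | zero =>
    rw [Fintype.sum_unique]
    exact 𝒜.init_mem.2.le
  | succ n ih =>
    rw [← (Fin.snocEquiv fun _ : Fin (n + 1) => Round).sum_comp, Fintype.sum_prod_type,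
      Finset.sum_comm]
    refine le_trans (Finset.sum_le_sum fun r _ => ?_) ih
    have h : ∀ t : Round, roundsState P 𝒜 (n + 1) (Fin.snocEquiv (fun _ => Round) (t, r)) =
        roundMap P (𝒜.channel n fun i => (r i).Xtilde) t (roundsState P 𝒜 n r) := fun t => by
      simp [roundsState, Fin.snocEquiv]
    simp only [h]
    exact sum_trace_roundMap_le P _ (isPositive_roundsState P 𝒜 n r)

variable {n : ℕ} {𝓕 𝓥 𝓛 : Type*} [Fintype 𝓕] [Fintype 𝓛]

/-- The classical registers as a product. -/
def outcomeEquiv : (Fin n → Round) × 𝓕 × 𝓛 × RawKey n ≃ Outcome n 𝓕 𝓛 where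
  toFun x := ⟨x.1, x.2.1, x.2.2.1, x.2.2.2⟩
  invFun o := (o.rounds, o.F, o.L, o.Xbar)
  left_inv _ := rfl
  right_inv _ := rfl

theorem isPositive_rawState (P : Params) (𝒜 : Attack E) (C : ErrorCorrection n 𝓕 𝓥 𝓛)
    (o : Outcome n 𝓕 𝓛) : (rawState P 𝒜 C o).IsPositive :=
  isPositive_smul ENNReal.toReal_nonneg (isPositive_roundsState P 𝒜 n _)

theorem sum_trace_rawState_le (P : Params) (𝒜 : Attack E) (C : ErrorCorrection n 𝓕 𝓥 𝓛) :
    ∑ o, trace (rawState P 𝒜 C o) ≤ 1 := by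
  have h : ∀ o, trace (rawState P 𝒜 C o) =
      C.hashDist o.F * C.encode o.F o.Zhat o.Xtilde o.Ztilde o.L *
        C.guess o.Xhat o.Xtilde o.L o.Xbar * trace (roundsState P 𝒜 n o.rounds) := fun o => by
    rw [rawState, trace_smul ENNReal.toReal_nonneg, ENNReal.ofReal_toReal]
    exact ENNReal.mul_ne_top (ENNReal.mul_ne_top (PMF.apply_ne_top _ _) (PMF.apply_ne_top _ _))
      (PMF.apply_ne_top _ _)
  simp only [h]
  rw [← outcomeEquiv.sum_comp]
  simp only [Fintype.sum_prod_type]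
  refine le_trans (le_of_eq (Finset.sum_congr rfl fun r _ => ?_)) (sum_trace_roundsState_le P 𝒜 n)
  have h1 : ∀ F L, ∑ X : RawKey n, C.hashDist F *
      C.encode F (fun i => (r i).Zhat) (fun i => (r i).Xtilde) (fun i => (r i).Ztilde) L *
      C.guess (fun i => (r i).Xhat) (fun i => (r i).Xtilde) L X * trace (roundsState P 𝒜 n r) =
      C.hashDist F * C.encode F (fun i => (r i).Zhat) (fun i => (r i).Xtilde)
        (fun i => (r i).Ztilde) L * trace (roundsState P 𝒜 n r) := fun F L => by
    rw [← Finset.sum_mul, ← Finset.mul_sum, sum_pmf_eq_one, mul_one]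
  have h2 : ∀ F, ∑ L, C.hashDist F * C.encode F (fun i => (r i).Zhat) (fun i => (r i).Xtilde)
        (fun i => (r i).Ztilde) L * trace (roundsState P 𝒜 n r) =
      C.hashDist F * trace (roundsState P 𝒜 n r) := fun F => by
    rw [← Finset.sum_mul, ← Finset.mul_sum, sum_pmf_eq_one, mul_one]
  calc _ = ∑ F, ∑ L, ∑ X : RawKey n, C.hashDist F *
      C.encode F (fun i => (r i).Zhat) (fun i => (r i).Xtilde) (fun i => (r i).Ztilde) L *
      C.guess (fun i => (r i).Xhat) (fun i => (r i).Xtilde) L X * trace (roundsState P 𝒜 n r) := rfl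
    _ = trace (roundsState P 𝒜 n r) := by
      simp only [h1, h2]
      rw [← Finset.sum_mul, sum_pmf_eq_one, one_mul]

end Rounds

/-! ### Soundness from correctness and secrecy -/

section Soundness

variable {H : Type*} [NormedAddCommGroup H] [InnerProductSpace ℂ H] [CompleteSpace H]
variable {X S S' 𝒦 : Type*} [Fintype X] [Fintype S] [Fintype S'] [Fintype 𝒦]

/-- Trace distance (without the factor `1/2`) of the key `k` from a uniform one that is independent
of the classical register `side` and the quantum system. -/
noncomputable def nonuniformity (R : CQ X H) (k : X → 𝒦) (side : X → S) : ℝ≥0∞ :=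
  ∑ s, ∑ a, traceNorm (∑ x, (if side x = s then
    (if k x = a then 1 else 0) - (Fintype.card 𝒦 : ℝ)⁻¹ else 0) • R x)

/-- Discarding side information does not increase the distance from uniform. -/
theorem nonuniformity_comp_le (R : CQ X H) (k : X → 𝒦) (side : X → S) (h : S → S') :
    nonuniformity R k (fun x => h (side x)) ≤ nonuniformity R k side := by
  unfold nonuniformity
  set D : S → 𝒦 → H →L[ℂ] H := fun s a => ∑ x, (if side x = s then
    (if k x = a then 1 else 0) - (Fintype.card 𝒦 : ℝ)⁻¹ else 0) • R x with hD
  have h1 : ∀ s' a, ∑ x, (if h (side x) = s' then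
      (if k x = a then 1 else 0) - (Fintype.card 𝒦 : ℝ)⁻¹ else 0) • R x =
      ∑ s, if h s = s' then D s a else 0 := fun s' a => by
    have h2 : ∀ s, (if h s = s' then D s a else 0) = ∑ x, if side x = s then (if h s = s' then
        ((if k x = a then 1 else 0) - (Fintype.card 𝒦 : ℝ)⁻¹) • R x else 0) else 0 := fun s => by
      split_ifs with h3
      · exact Finset.sum_congr rfl fun x _ => by rw [ite_smul, zero_smul]
      · simp
    simp only [h2]
    rw [Finset.sum_comm]
    refine Finset.sum_congr rfl fun x _ => ?_
    rw [Finset.sum_ite_eq, if_pos (Finset.mem_univ _), ite_smul, zero_smul]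
  simp only [h1]
  calc ∑ s', ∑ a, traceNorm (∑ s, if h s = s' then D s a else 0)
      ≤ ∑ s', ∑ a, ∑ s, if h s = s' then traceNorm (D s a) else 0 := by
        refine Finset.sum_le_sum fun s' _ => Finset.sum_le_sum fun a _ => ?_
        refine (traceNorm_sum_le _ _).trans_eq (Finset.sum_congr rfl fun s _ => ?_)
        split_ifs
        · rfl
        · exact traceNorm_zero
    _ = ∑ s, ∑ a, traceNorm (D s a) := by
        rw [Finset.sum_congr rfl fun s' _ => Finset.sum_comm, Finset.sum_comm]
        refine Finset.sum_congr rfl fun s _ => ?_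
        rw [Finset.sum_comm]
        refine Finset.sum_congr rfl fun a _ => ?_
        rw [Finset.sum_ite_eq, if_pos (Finset.mem_univ _)]

/-- The product is `0` when `p` is `0` or `∞`, by the conventions on inverses. -/
theorem mul_ofReal_toReal_inv_le (p : ℝ≥0∞) : p * ENNReal.ofReal p.toReal⁻¹ ≤ 1 := by
  rcases eq_or_ne p ∞ with rfl | hp
  · simp
  rcases eq_or_ne p 0 with rfl | hp0
  · simp
  rw [ENNReal.ofReal_inv_of_pos (ENNReal.toReal_pos hp0 hp), ENNReal.ofReal_toReal hp]
  exact ENNReal.mul_inv_le_one p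

/-- Correctness and secrecy of the key imply soundness: replacing the key of Alice by the key of Bob
costs the probability of disagreement, and the rest is the distance of the key of Bob from uniform.
-/
theorem isSound_of_le {ρ : CQ X H} (hρ : ∀ x, (ρ x).IsPositive) {NA : Set X} {KA KB : X → 𝒦}
    {side : X → S} {a b ε : ℝ} (ha : 0 ≤ a) (hb : 0 ≤ b) (hε : a + b / 2 = ε)
    (hcorr : ρ.prob {x | KA x ≠ KB x ∧ x ∈ NA} ≤ ENNReal.ofReal a)
    (hsec : nonuniformity (ρ.restrict NA) KB side ≤ ENNReal.ofReal b) :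
    IsSound ρ NA KA KB side ε := by
  set c := (ρ.prob NA).toReal⁻¹ with hc
  have hc0 : 0 ≤ c := inv_nonneg.2 ENNReal.toReal_nonneg
  set R := ρ.restrict NA with hR
  have hRtr : ∀ x, traceNorm (R x) = if x ∈ NA then trace (ρ x) else 0 := fun x => by
    simp only [hR, CQ.restrict]
    split_ifs
    · exact traceNorm_of_isPositive (hρ x)
    · exact traceNorm_zero
  let tri : X → 𝒦 × 𝒦 × S := fun x => (KA x, KB x, side x)
  let diag : X → 𝒦 × 𝒦 × S := fun x => (KB x, KB x, side x)
  -- the difference of the two states splits into an error of correctness and one of secrecy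
  let e : X → 𝒦 × 𝒦 × S → ℝ := fun x y =>
    (if tri x = y then 1 else 0) - (if diag x = y then 1 else 0)
  let d : X → 𝒦 × 𝒦 × S → ℝ := fun x y => if y.1 = y.2.1 then (if side x = y.2.2 then
    (if KB x = y.2.1 then 1 else 0) - (Fintype.card 𝒦 : ℝ)⁻¹ else 0) else 0
  have hdiff : ∀ y : 𝒦 × 𝒦 × S,
      CQ.marginal (fun x => c • R x) tri y - (if y.1 = y.2.1 then (Fintype.card 𝒦 : ℝ)⁻¹ •
        CQ.marginal (fun x => c • R x) side y.2.2 else 0) =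
      c • (∑ x, e x y • R x + ∑ x, d x y • R x) := by
    rintro ⟨k₁, k₂, s⟩
    have h1 : (if k₁ = k₂ then (Fintype.card 𝒦 : ℝ)⁻¹ •
        CQ.marginal (fun x => c • R x) side s else 0) =
        ∑ x, if k₁ = k₂ then (Fintype.card 𝒦 : ℝ)⁻¹ • (if side x = s then c • R x else 0)
          else 0 := by
      split_ifs
      · rw [CQ.marginal, Finset.smul_sum]
      · simp
    simp only [h1]
    rw [CQ.marginal, ← Finset.sum_sub_distrib, ← Finset.sum_add_distrib, Finset.smul_sum]
    refine Finset.sum_congr rfl fun x _ => ?_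
    have hdiag : (if diag x = (k₁, k₂, s) then (1 : ℝ) else 0) =
        if k₁ = k₂ then (if side x = s then (if KB x = k₂ then 1 else 0) else 0) else 0 := by
      simp only [diag, Prod.mk.injEq, ← ite_and]
      congr 1
      exact propext ⟨fun h => ⟨h.1.symm.trans h.2.1, h.2.2, h.2.1⟩,
        fun h => ⟨h.2.2.trans h.1.symm, h.2.2, h.2.1⟩⟩
    simp only [e, d, hdiag]
    by_cases h5 : tri x = (k₁, k₂, s) <;> simp only [h5, if_true, if_false] <;>
      by_cases h2 : side x = s <;> by_cases h3 : k₁ = k₂ <;> by_cases h4 : KB x = k₂ <;>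
      simp only [h2, h3, h4, if_true, if_false] <;> module
  have he : ∑ y, traceNorm (∑ x, e x y • R x) ≤ 2 * ENNReal.ofReal a := by
    calc ∑ y, traceNorm (∑ x, e x y • R x)
        ≤ ∑ y, ∑ x, ENNReal.ofReal |e x y| * traceNorm (R x) := by
          refine Finset.sum_le_sum fun y _ => (traceNorm_sum_le _ _).trans ?_
          exact Finset.sum_le_sum fun x _ => traceNorm_smul_le_abs _ _
      _ = ∑ x, ENNReal.ofReal (∑ y, |e x y|) * traceNorm (R x) := by
          rw [Finset.sum_comm]
          refine Finset.sum_congr rfl fun x _ => ?_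
          rw [ENNReal.ofReal_sum_of_nonneg fun _ _ => abs_nonneg _, Finset.sum_mul]
      _ ≤ ∑ x, 2 * (if x ∈ {x | KA x ≠ KB x ∧ x ∈ NA} then trace (ρ x) else 0) := by
          refine Finset.sum_le_sum fun x _ => ?_
          by_cases hx : KA x = KB x
          · have h1 : ∀ y, e x y = 0 := fun y => by simp [e, tri, diag, hx]
            simp [h1]
          · have h1 : ∑ y, |e x y| ≤ 2 := by
              calc ∑ y, |e x y| ≤ ∑ y, ((if tri x = y then 1 else 0) +
                    (if diag x = y then 1 else 0)) := by
                    refine Finset.sum_le_sum fun y _ => ?_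
                    simp only [e]
                    split_ifs <;> norm_num
                _ = 2 := by
                    rw [Finset.sum_add_distrib, Finset.sum_ite_eq, Finset.sum_ite_eq]
                    norm_num
            rw [hRtr]
            refine mul_le_mul' ((ENNReal.ofReal_le_ofReal h1).trans_eq (by simp)) (le_of_eq ?_)
            simp [hx]
      _ = 2 * ρ.prob {x | KA x ≠ KB x ∧ x ∈ NA} := by
          rw [← Finset.mul_sum, CQ.prob]
          congr! 3
      _ ≤ _ := by gcongr
  have hd : ∑ y, traceNorm (∑ x, d x y • R x) ≤ ENNReal.ofReal b := by
    refine le_trans (le_of_eq ?_) hsec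
    unfold nonuniformity
    rw [Fintype.sum_prod_type]
    simp only [Fintype.sum_prod_type]
    rw [Finset.sum_comm (s := (Finset.univ : Finset S))]
    refine Finset.sum_congr rfl fun k _ => ?_
    rw [Finset.sum_eq_single k]
    · simp [d]
    · intro k' _ hk'
      refine Finset.sum_eq_zero fun s _ => ?_
      simp [d, hk'.symm, traceNorm_zero]
    · simp
  unfold IsSound
  simp only
  rw [blockDiag_sub]
  calc ρ.prob NA * (1 / 2) * traceNorm _
      ≤ ρ.prob NA * (1 / 2) * (ENNReal.ofReal c * (2 * ENNReal.ofReal a + ENNReal.ofReal b)) := by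
        gcongr
        refine (traceNorm_blockDiag_le _).trans ?_
        calc _ = ∑ y, traceNorm (c • (∑ x, e x y • R x + ∑ x, d x y • R x)) :=
              Finset.sum_congr rfl fun y _ => congrArg traceNorm (hdiff y)
          _ ≤ ∑ y, ENNReal.ofReal c * (traceNorm (∑ x, e x y • R x) +
                traceNorm (∑ x, d x y • R x)) := by
              refine Finset.sum_le_sum fun y _ => (traceNorm_smul_le hc0 _).trans ?_
              gcongr
              exact traceNorm_add_le _ _
          _ ≤ _ := by
              rw [← Finset.mul_sum, Finset.sum_add_distrib]
              gcongr
    _ = (ρ.prob NA * ENNReal.ofReal c) * ((1 / 2) * (2 * ENNReal.ofReal a + ENNReal.ofReal b)) := by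
        ring
    _ ≤ 1 * ((1 / 2) * (2 * ENNReal.ofReal a + ENNReal.ofReal b)) := by
        gcongr
        exact mul_ofReal_toReal_inv_le _
    _ = ENNReal.ofReal ε := by
        rw [one_mul, show (2 : ℝ≥0∞) = ENNReal.ofReal 2 by simp,
          ← ENNReal.ofReal_mul (by norm_num), ← ENNReal.ofReal_add (by positivity) hb,
          show (1 / ENNReal.ofReal 2 : ℝ≥0∞) = ENNReal.ofReal (1 / 2) by
            rw [ENNReal.ofReal_div_of_pos (by norm_num), ENNReal.ofReal_one],
          ← ENNReal.ofReal_mul (by norm_num), ← hε]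
        congr 1; ring

end Soundness

/-! ### Secrecy from the smooth min-entropy -/

section SmoothEntropy

variable {H : Type*} [NormedAddCommGroup H] [InnerProductSpace ℂ H] [CompleteSpace H]
variable {X Z S Y 𝒦 𝓖 : Type*} [Fintype X] [Fintype Z] [Fintype S] [Fintype Y] [Fintype 𝒦]
  [Fintype 𝓖]

/-- The leftover hashing lemma in terms of the smooth min-entropy. -/
theorem TwoUniversal.leftover_hashing_of_le_smoothMinEntropy [Nonempty 𝒦] [Nonempty Y]
    (G : TwoUniversal Z 𝒦 𝓖) {ω : Z → S → Y → H →L[ℂ] H} (hω : ∀ z s l, (ω z s l).IsPositive)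
    (hω1 : ∑ z, ∑ s, ∑ l, trace (ω z s l) ≤ 1) {ε : ℝ} (hε : 0 ≤ ε) {δ : ℝ} (hδ : 0 < δ)
    (h : ((Real.logb 2 (Fintype.card 𝒦) + Real.logb 2 (Fintype.card Y) +
      2 * Real.logb 2 (1 / δ) : ℝ) : EReal) ≤
      smoothMinEntropy ε (blockDiag fun z => blockDiag fun s => ∑ l, ω z s l)) :
    ∑ s, ∑ l, ∑ g, G.dist g * ∑ k, traceNorm (∑ z, G.deviation g k z • ω z s l) ≤
      ENNReal.ofReal (4 * ε + δ) := by
  have hK : (0 : ℝ) < Fintype.card 𝒦 := by exact_mod_cast Fintype.card_pos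
  have hY : (0 : ℝ) < Fintype.card Y := by exact_mod_cast Fintype.card_pos
  -- the supremum in the smooth min-entropy need not be attained, hence the loss of `η` bits
  have key : ∀ η : ℝ, 0 < η →
      ∑ s, ∑ l, ∑ g, G.dist g * ∑ k, traceNorm (∑ z, G.deviation g k z • ω z s l) ≤
        ENNReal.ofReal (4 * ε + δ * 2 ^ (η / 2)) := by
    intro η hη
    have h1 : ((Real.logb 2 (Fintype.card 𝒦) + Real.logb 2 (Fintype.card Y) +
        2 * Real.logb 2 (1 / δ) - η : ℝ) : EReal) < smoothMinEntropy ε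
        (blockDiag fun z => blockDiag fun s => ∑ l, ω z s l) :=
      lt_of_lt_of_le (EReal.coe_lt_coe_iff.2 (sub_lt_self _ hη)) h
    simp only [smoothMinEntropy, minEntropy, lt_iSup_iff] at h1
    obtain ⟨τ, ⟨hτ, hdist⟩, σ, hσ, lam, hlam, hlt⟩ := h1
    rw [EReal.coe_lt_coe_iff] at hlt
    have hc : (0 : ℝ) ≤ 2 ^ (-lam) := by positivity
    refine (G.leftover_hashing_of_purifiedDist_le hω hω1 hτ hε hdist hσ hc hlam).trans ?_
    rw [ENNReal.ofReal_add (by positivity) (by positivity)]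
    gcongr
    rw [← ENNReal.ofReal_natCast, ← ENNReal.ofReal_natCast (Fintype.card Y),
      ← ENNReal.ofReal_mul (by positivity), ← ENNReal.ofReal_mul (by positivity),
      ofReal_eq_sqrt_sq (by positivity : 0 ≤ δ * 2 ^ (η / 2))]
    gcongr
    have e1 : (Fintype.card 𝒦 : ℝ) = 2 ^ Real.logb 2 (Fintype.card 𝒦) :=
      (Real.rpow_logb (by norm_num) (by norm_num) hK).symm
    have e2 : (Fintype.card Y : ℝ) = 2 ^ Real.logb 2 (Fintype.card Y) :=
      (Real.rpow_logb (by norm_num) (by norm_num) hY).symm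
    have e3 : δ = 2 ^ (-Real.logb 2 (1 / δ)) := by
      rw [one_div, Real.logb_inv, neg_neg, Real.rpow_logb (by norm_num) (by norm_num) hδ]
    calc (Fintype.card 𝒦 : ℝ) * 2 ^ (-lam) * Fintype.card Y
        = 2 ^ (Real.logb 2 (Fintype.card 𝒦) + -lam + Real.logb 2 (Fintype.card Y)) := by
          rw [Real.rpow_add two_pos, Real.rpow_add two_pos, ← e1, ← e2]
      _ ≤ 2 ^ (2 * (-Real.logb 2 (1 / δ) + η / 2)) :=
          Real.rpow_le_rpow_of_exponent_le (by norm_num) (by linarith)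
      _ = (δ * 2 ^ (η / 2)) ^ 2 := by
          conv_rhs => rw [e3]
          rw [← Real.rpow_add two_pos, ← Real.rpow_mul_natCast (by norm_num), Nat.cast_ofNat,
            mul_comm]
  have hcont : Continuous fun η : ℝ => ENNReal.ofReal (4 * ε + δ * 2 ^ (η / 2)) :=
    ENNReal.continuous_ofReal.comp (continuous_const.add (continuous_const.mul
      (Real.continuous_const_rpow two_ne_zero |>.comp (continuous_id.div_const 2))))
  have hlim := (hcont.tendsto 0).mono_left (nhdsWithin_le_nhds (s := Set.Ioi (0 : ℝ)))
  rw [zero_div, Real.rpow_zero, mul_one] at hlim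
  exact ge_of_tendsto hlim (Filter.eventually_of_mem self_mem_nhdsWithin key)

/-- The part of `ρ` on the event `NA`, normalised by the probability of the event `PE`. -/
noncomputable def condPart (ρ : CQ X H) (PE NA : Set X) : CQ X H :=
  fun x => (ρ.prob PE).toReal⁻¹ • ρ.restrict NA x

theorem isPositive_condPart {ρ : CQ X H} (hρ : ∀ x, (ρ x).IsPositive) (PE NA : Set X) (x : X) :
    (condPart ρ PE NA x).IsPositive := by
  rw [condPart, CQ.restrict]
  split_ifs
  · exact isPositive_smul (inv_nonneg.2 ENNReal.toReal_nonneg) (hρ x)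
  · rw [smul_zero]; exact ContinuousLinearMap.isPositive_zero

theorem sum_trace_condPart_le (ρ : CQ X H) {PE NA : Set X} (hsub : NA ⊆ PE) :
    ∑ x, trace (condPart ρ PE NA x) ≤ 1 := by
  calc ∑ x, trace (condPart ρ PE NA x)
      ≤ ∑ x, ENNReal.ofReal (ρ.prob PE).toReal⁻¹ * (if x ∈ PE then trace (ρ x) else 0) := by
        refine Finset.sum_le_sum fun x _ => ?_
        rw [condPart, trace_smul (inv_nonneg.2 ENNReal.toReal_nonneg), CQ.restrict]
        refine mul_le_mul_right ?_ _
        by_cases hx : x ∈ NA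
        · simp [hx, hsub hx]
        · simp [hx, trace_zero]
    _ = ρ.prob PE * ENNReal.ofReal (ρ.prob PE).toReal⁻¹ := by
        rw [← Finset.mul_sum, mul_comm, CQ.prob]
    _ ≤ 1 := mul_ofReal_toReal_inv_le _

theorem isPositive_marginal {ρ : CQ X H} (hρ : ∀ x, (ρ x).IsPositive) (g : X → S) (s : S) :
    (CQ.marginal ρ g s).IsPositive := by
  refine ContinuousLinearMap.isPositive_sum _ fun x _ => ?_
  split_ifs
  · exact hρ x
  · exact ContinuousLinearMap.isPositive_zero

theorem sum_trace_marginal {ρ : CQ X H} (hρ : ∀ x, (ρ x).IsPositive) (g : X → S) :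
    ∑ s, trace (CQ.marginal ρ g s) = ∑ x, trace (ρ x) := by
  have h1 : ∀ s, trace (CQ.marginal ρ g s) = ∑ x, if g x = s then trace (ρ x) else 0 := fun s => by
    rw [CQ.marginal, trace_sum]
    · refine Finset.sum_congr rfl fun x _ => ?_
      split_ifs
      · rfl
      · exact trace_zero
    · intro x
      split_ifs
      · exact hρ x
      · exact ContinuousLinearMap.isPositive_zero
  simp only [h1]
  rw [Finset.sum_comm]
  exact Finset.sum_congr rfl fun x _ => by rw [Finset.sum_ite_eq, if_pos (Finset.mem_univ _)]

/-- Summing over one of the registers forgets it. -/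
theorem sum_marginal (ρ : CQ X H) (zf : X → Z) (sf : X → S) (lf : X → Y) (z : Z) (s : S) :
    ∑ l, CQ.marginal ρ (fun x => (zf x, sf x, lf x)) (z, s, l) =
      CQ.marginal ρ (fun x => (zf x, sf x)) (z, s) := by
  simp only [CQ.marginal]
  rw [Finset.sum_comm]
  refine Finset.sum_congr rfl fun x _ => ?_
  simp only [Prod.mk.injEq]
  by_cases hx : zf x = z ∧ sf x = s
  · simp [hx]
  · rw [if_neg hx]
    exact Finset.sum_eq_zero fun l _ => if_neg fun h => hx ⟨h.1, h.2.1⟩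

/-- Normalising by a probability can only increase the trace norm of a linear combination. The
point is the case of probability zero, where the inverse is `0` and both sides vanish. -/
theorem traceNorm_sum_smul_restrict_le {ρ : CQ X H} (hρ : ∀ x, (ρ x).IsPositive)
    (htr : ∑ x, trace (ρ x) ≤ 1) {PE NA : Set X} (hsub : NA ⊆ PE) (c : X → ℝ) :
    traceNorm (∑ x, c x • ρ.restrict NA x) ≤ traceNorm (∑ x, c x • condPart ρ PE NA x) := by
  have hp1 : ρ.prob PE ≤ 1 := by
    refine le_trans (Finset.sum_le_sum fun x _ => ?_) htr
    split_ifs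
    · exact le_rfl
    · exact zero_le
  have hpt : ρ.prob PE ≠ ∞ := (hp1.trans_lt ENNReal.one_lt_top).ne
  rcases eq_or_ne (ρ.prob PE) 0 with hp0 | hp0
  · refine le_trans (le_of_eq ?_) zero_le
    refine le_antisymm ((traceNorm_sum_le _ _).trans ?_) zero_le
    refine (Finset.sum_eq_zero fun x _ => ?_).le
    refine le_antisymm ((traceNorm_smul_le_abs _ _).trans (le_of_eq ?_)) zero_le
    rw [CQ.restrict]
    split_ifs with hx
    · have h1 := (Finset.sum_eq_zero_iff.1 hp0) x (Finset.mem_univ x)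
      rw [if_pos (hsub hx)] at h1
      rw [traceNorm_of_isPositive (hρ x), h1, mul_zero]
    · rw [traceNorm_zero, mul_zero]
  · have h1 : ∑ x, c x • ρ.restrict NA x =
        (ρ.prob PE).toReal • ∑ x, c x • condPart ρ PE NA x := by
      rw [Finset.smul_sum]
      refine Finset.sum_congr rfl fun x _ => ?_
      rw [condPart, smul_comm (c x), smul_inv_smul₀ (ENNReal.toReal_pos hp0 hpt).ne']
    rw [h1]
    refine (traceNorm_smul_le ENNReal.toReal_nonneg _).trans ?_
    rw [ENNReal.ofReal_toReal hpt]
    exact mul_le_of_le_one_left' hp1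

/-- The distance from uniform, with the hash function revealed, in the form in which the leftover
hashing lemma bounds it: an average over the hash functions, for the state normalised by the
probability of `PE`. -/
theorem nonuniformity_le_sum_marginal {ρ : CQ X H} (hρ : ∀ x, (ρ x).IsPositive)
    (htr : ∑ x, trace (ρ x) ≤ 1) {PE NA : Set X} (hsub : NA ⊆ PE)
    (zf : X → Z) (sf : X → S) (lf : X → Y) (G : TwoUniversal Z 𝒦 𝓖) :
    nonuniformity (CQ.restrict (fun q : X × 𝓖 => (G.dist q.2).toReal • ρ q.1) {q | q.1 ∈ NA})
      (fun q => G.hash q.2 (zf q.1)) (fun q => (sf q.1, lf q.1, q.2)) ≤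
    ∑ s, ∑ l, ∑ g, G.dist g * ∑ k, traceNorm (∑ z, G.deviation g k z •
      CQ.marginal (condPart ρ PE NA) (fun x => (zf x, sf x, lf x)) (z, s, l)) := by
  unfold nonuniformity
  simp only [Fintype.sum_prod_type (α₁ := S), Fintype.sum_prod_type (α₁ := Y)]
  refine Finset.sum_le_sum fun s _ => Finset.sum_le_sum fun l _ => Finset.sum_le_sum fun g _ => ?_
  rw [Finset.mul_sum]
  refine Finset.sum_le_sum fun k _ => ?_
  set c : X → ℝ := fun x => if sf x = s ∧ lf x = l then G.deviation g k (zf x) else 0 with hc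
  have h1 : ∑ q : X × 𝓖, (if (sf q.1, lf q.1, q.2) = (s, l, g) then
      (if G.hash q.2 (zf q.1) = k then 1 else 0) - (Fintype.card 𝒦 : ℝ)⁻¹ else 0) •
        CQ.restrict (fun q : X × 𝓖 => (G.dist q.2).toReal • ρ q.1) {q | q.1 ∈ NA} q =
      (G.dist g).toReal • ∑ x, c x • ρ.restrict NA x := by
    rw [Fintype.sum_prod_type, Finset.smul_sum]
    refine Finset.sum_congr rfl fun x _ => ?_
    rw [Finset.sum_eq_single g]
    · rw [smul_comm (G.dist g).toReal]
      simp only [CQ.restrict, hc, Prod.mk.injEq, and_true, TwoUniversal.deviation,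
        Set.mem_ofPred_eq, smul_ite, smul_zero]
    · intro g' _ hg'
      simp [hg']
    · simp
  have h2 : ∑ z, G.deviation g k z •
      CQ.marginal (condPart ρ PE NA) (fun x => (zf x, sf x, lf x)) (z, s, l) =
      ∑ x, c x • condPart ρ PE NA x := by
    simp only [CQ.marginal, Finset.smul_sum]
    rw [Finset.sum_comm]
    refine Finset.sum_congr rfl fun x _ => ?_
    rw [Finset.sum_eq_single (zf x)]
    · simp only [hc, Prod.mk.injEq, true_and, smul_ite, smul_zero, ite_smul, zero_smul]
    · intro z _ hz
      simp [hz.symm]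
    · simp
  rw [h1, h2]
  refine (traceNorm_smul_le ENNReal.toReal_nonneg _).trans ?_
  rw [ENNReal.ofReal_toReal (PMF.apply_ne_top _ _)]
  gcongr
  exact traceNorm_sum_smul_restrict_le hρ htr hsub c

/-- Secrecy of the key: the smooth min-entropy of the raw key `zf` given `sf` and the quantum system
bounds the distance from uniform given `sf`, the leaked string `lf` and the hash function. -/
theorem nonuniformity_le_of_le_smoothMinEntropy [Nonempty 𝒦] [Nonempty Y]
    {ρ : CQ X H} (hρ : ∀ x, (ρ x).IsPositive)
    (htr : ∑ x, trace (ρ x) ≤ 1) {PE NA : Set X} (hsub : NA ⊆ PE)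
    (zf : X → Z) (sf : X → S) (lf : X → Y) (G : TwoUniversal Z 𝒦 𝓖) {ε : ℝ} (hε : 0 ≤ ε) {δ : ℝ}
    (hδ : 0 < δ) (h : ((Real.logb 2 (Fintype.card 𝒦) + Real.logb 2 (Fintype.card Y) +
      2 * Real.logb 2 (1 / δ) : ℝ) : EReal) ≤ smoothMinEntropy ε (blockDiag fun z =>
        blockDiag fun s => CQ.marginal (condPart ρ PE NA) (fun x => (zf x, sf x)) (z, s))) :
    nonuniformity (CQ.restrict (fun q : X × 𝓖 => (G.dist q.2).toReal • ρ q.1) {q | q.1 ∈ NA})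
      (fun q => G.hash q.2 (zf q.1)) (fun q => (sf q.1, lf q.1, q.2)) ≤
    ENNReal.ofReal (4 * ε + δ) := by
  have hcpos := isPositive_condPart hρ PE NA
  have hone := (sum_trace_marginal hcpos fun x => (zf x, sf x, lf x)).trans_le
    (sum_trace_condPart_le _ hsub)
  simp only [Fintype.sum_prod_type] at hone
  simp only [← sum_marginal _ zf sf lf] at h
  exact (nonuniformity_le_sum_marginal hρ htr hsub zf sf lf G).trans
    (G.leftover_hashing_of_le_smoothMinEntropy
      (fun z s l => isPositive_marginal hcpos _ (z, s, l)) hone hε hδ h)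

end SmoothEntropy

/-! ### Secrecy of the key of the protocol -/

section Protocol

universe u
variable {n : ℕ} {E : ℕ → Type u} [∀ i, NormedAddCommGroup (E i)]
  [∀ i, InnerProductSpace ℂ (E i)] [∀ i, CompleteSpace (E i)]
variable {𝓕 𝓥 𝓛 𝓖 𝒦 : Type*} [Fintype 𝓕] [Fintype 𝓛] [Fintype 𝓖] [Fintype 𝒦]

theorem isPositive_keyState (P : Params) (𝒜 : Attack E) (C : ErrorCorrection n 𝓕 𝓥 𝓛)
    (G : TwoUniversal (RawKey n) 𝒦 𝓖) (q : Outcome n 𝓕 𝓛 × 𝓖) :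
    (keyState P 𝒜 C G q).IsPositive :=
  isPositive_smul ENNReal.toReal_nonneg (isPositive_rawState P 𝒜 C q.1)

/-- The key of Bob is close to uniform for Eve, who knows `X̃`, `I`, `L` and the hash function and
holds the system `E'`. -/
theorem nonuniformity_keyState_le [Nonempty 𝒦] (P : Params) (𝒜 : Attack E)
    (C : ErrorCorrection n 𝓕 𝓥 𝓛) (G : TwoUniversal (RawKey n) 𝒦 𝓖) {ε : ℝ} (hε : 0 ≤ ε) {δ : ℝ}
    (hδ : 0 < δ) (h : ((Real.logb 2 (Fintype.card 𝒦) + Real.logb 2 (Fintype.card 𝓛) +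
      2 * Real.logb 2 (1 / δ) : ℝ) : EReal) ≤
      smoothMinEntropy (H := Reg (PublicReg n) (E n)) ε (conditionedState P 𝒜 C)) :
    nonuniformity ((keyState P 𝒜 C G).restrict {q | q.1 ∈ omegaNA P C}) (keyB G)
      (fun q => ((q.1.Xtilde, q.1.I), q.1.L, q.2)) ≤ ENNReal.ofReal (4 * ε + δ) := by
  -- a probability distribution on `𝓛` exists, so `log |𝓛|` is not a junk value
  have : Nonempty 𝓛 :=
    (C.encode C.hashDist.support_nonempty.some (fun _ => none) (fun _ => none)
      (fun _ => none)).support_nonempty.to_type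
  exact nonuniformity_le_of_le_smoothMinEntropy (isPositive_rawState P 𝒜 C)
    (sum_trace_rawState_le P 𝒜 C) Set.inter_subset_left Outcome.Zhat
    (fun o => (o.Xtilde, o.I)) Outcome.L G hε hδ h

end Protocol

end QKD

theorem mainTheorem4
    -- number of rounds, Eve's systems
    (n : ℕ) (E : ℕ → Type*) [∀ i, NormedAddCommGroup (E i)] [∀ i, InnerProductSpace ℂ (E i)]
    [∀ i, CompleteSpace (E i)] [∀ i, TopologicalSpace.SeparableSpace (E i)]
    -- index set and values of the hash functions of error correction, the strings sent during
    -- error correction, index set of the hash functions of privacy amplification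
    {𝓕 𝓥 𝓛 𝓖 : Type*} [Fintype 𝓕] [Fintype 𝓛] [Fintype 𝓖]
    (P : QKD.Params) (𝒜 : QKD.Attack E) (C : QKD.ErrorCorrection n 𝓕 𝓥 𝓛)
    (ε εEC εPA : ℝ) (hε : ε ∈ Set.Ioo (0 : ℝ) 1) (hεEC : εEC ∈ Set.Ioo (0 : ℝ) 1)
    (hεPA : 0 < εPA)
    -- the length of the key and the hash functions
    (l : ℕ) (G : QKD.TwoUniversal (QKD.RawKey n) (Fin l → Bool) 𝓖)
    -- `Pr[K_A ≠ K_B ∧ Ω_EC] ≤ ε_EC`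
    (hEC : (QKD.keyState P 𝒜 C G).prob
      {q | QKD.keyA G q ≠ QKD.keyB G q ∧ q.1 ∈ QKD.omegaEC C} ≤ ENNReal.ofReal εEC)
    (hl : (l : EReal) ≤
      QKD.smoothMinEntropy (H := QKD.Reg (QKD.PublicReg n) (E n)) ε (QKD.conditionedState P 𝒜 C)
        - (Real.logb 2 (Fintype.card 𝓛) : ℝ) - (2 * Real.logb 2 (1 / εPA) : ℝ)) :
    -- soundness against Eve holding `X̃ I L E'`
    QKD.IsSound (QKD.keyState P 𝒜 C G) {q | q.1 ∈ QKD.omegaNA P C}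
      (QKD.keyA G) (QKD.keyB G) (fun q => (q.1.Xtilde, q.1.I, q.1.L))
      (εPA / 2 + 2 * ε + εEC) ∧
    -- and also if the hash function of privacy amplification is revealed to her
    QKD.IsSound (QKD.keyState P 𝒜 C G) {q | q.1 ∈ QKD.omegaNA P C}
      (QKD.keyA G) (QKD.keyB G) (fun q => (q.1.Xtilde, q.1.I, q.1.L, q.2))
      (εPA / 2 + 2 * ε + εEC) := by
  have hbound : ((Real.logb 2 (Fintype.card (Fin l → Bool)) + Real.logb 2 (Fintype.card 𝓛) +
      2 * Real.logb 2 (1 / εPA) : ℝ) : EReal) ≤ QKD.smoothMinEntropy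
        (H := QKD.Reg (QKD.PublicReg n) (E n)) ε (QKD.conditionedState P 𝒜 C) := by
    have hcard : Real.logb 2 (Fintype.card (Fin l → Bool)) = l := by
      rw [Fintype.card_fun, Fintype.card_bool, Fintype.card_fin, Nat.cast_pow, Nat.cast_ofNat,
        Real.logb_pow, Real.logb_self_eq_one (by norm_num), mul_one]
    rw [hcard]
    generalize QKD.smoothMinEntropy (H := QKD.Reg (QKD.PublicReg n) (E n)) ε
      (QKD.conditionedState P 𝒜 C) = h at hl ⊢
    rw [← EReal.coe_coe_eq_natCast] at hl
    induction h with
    | bot => exact absurd hl (by simpa using EReal.coe_ne_bot (l : ℝ))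
    | top => exact le_top
    | coe h =>
      norm_cast at hl ⊢
      linarith
  have hsec := QKD.nonuniformity_keyState_le P 𝒜 C G hε.1.le hεPA hbound
  have hcorr : (QKD.keyState P 𝒜 C G).prob
      {q | QKD.keyA G q ≠ QKD.keyB G q ∧ q ∈ {q | q.1 ∈ QKD.omegaNA P C}} ≤
      ENNReal.ofReal εEC := by
    refine le_trans (Finset.sum_le_sum fun q _ => ?_) hEC
    split_ifs with h₁ h₂
    · exact le_rfl
    · exact absurd ⟨h₁.1, h₁.2.2⟩ h₂
    · exact zero_le
    · exact le_rfl
  have hb : 0 ≤ 4 * ε + εPA := by linarith [hε.1]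
  have hsum : εEC + (4 * ε + εPA) / 2 = εPA / 2 + 2 * ε + εEC := by ring
  have hpos := QKD.isPositive_keyState P 𝒜 C G
  -- both kinds of side information are functions of the one that includes the hash function
  let side : QKD.Outcome n 𝓕 𝓛 × 𝓖 → QKD.PublicReg n × 𝓛 × 𝓖 :=
    fun q => ((q.1.Xtilde, q.1.I), q.1.L, q.2)
  constructor
  · refine QKD.isSound_of_le hpos hεEC.1.le hb hsum hcorr (le_trans ?_ hsec)
    exact QKD.nonuniformity_comp_le _ _ side fun y => (y.1.1, y.1.2, y.2.1)
  · refine QKD.isSound_of_le hpos hεEC.1.le hb hsum hcorr (le_trans ?_ hsec)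
    exact QKD.nonuniformity_comp_le _ _ side fun y => (y.1.1, y.1.2, y.2.1, y.2.2)
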